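/- Let $(\mathcal C,\oplus,0,\gamma)$ be a small permutative category, i.e. a small category with a functor $\oplus:\mathcal C\times\mathcal C\to\mathcal C$ that is strictly associative with strict unit $0$, and with a natural symmetry $\gamma:a\oplus b\cong b\oplus a$ that makes it a symmetric (strict) monoidal category. *Segal's construction.* For a finite based set $A$, let $\overline{\mathcal C}_A$ be the category whose objects are systems $\{C_S,\rho_{S,T}\}$, where $S$ runs over the subsets of $A$ not containing the basepoint, $C_S$ is an object of $\mathcal C$, and for disjoint $S,T$ the map $\rho_{S,T}:C_S\oplus C_T\to C_{S\cup T}$ is an isomorphism, such that $C_\emptyset=0$; $\rho_{S,T}=\mathrm{id}$ if $S$ or $T$ is empty; $\rho_{S,T}=\rho_{T,S}\circ\gamma$; and $\rho_{S\cup T,U}\circ(\rho_{S,T}\oplus \mathrm{id})=\rho_{S,T\cup U}\circ(\mathrm{id}\oplus\rho_{T,U})$ for pairwise disjoint $S,T,U$. A morphism $\{C_S,\rho_{S,T}\}\to\{C'_S,\rho'_{S,T}\}$ is a family of maps $f_S:C_S\to C'_S$ with $f_\emptyset=\mathrm{id}_0$ and $f_{S\cup T}\circ\rho_{S,T}=\rho'_{S,T}\circ(f_S\oplus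 f_T)$. A based map $g:A\to B$ induces the functor $\overline{\mathcal C}_A\to\overline{\mathcal C}_B$, $\{C_S\}\mapsto\{C_{g^{-1}(S)}\}$ (with the corresponding $\rho$'s). *The multivariable construction.* For finite based sets $A_1,\dots,A_n$, let $\overline{\mathcal C}_{(A_1,\dots,A_n)}$ be the category whose objects are systems $\{C_{\langle S\rangle},\rho_{\langle S\rangle;i,T,U}\}$, where $\langle S\rangle=(S_1,\dots,S_n)$ runs over the tuples of subsets $S_i\subset A_i$ not containing the basepoint, and for every $i$ and every decomposition $S_i=T\amalg U$ there is a map (not necessarily an isomorphism) $$\rho_{\langle S\rangle;i,T,U}: C_{\langle S\rangle[S_i\to T]}\oplus C_{\langle S\rangle[S_i\to U]}\to C_{\langle S\rangle},$$ where $[S_i\to T]$ means that the $i$-th entry is replaced by $T$, such that: $C_{\langle S\rangle}=0$ if some $S_k=\emptyset$; $\rho_{\langle S\rangle;i,T,U}=\mathrm{id}$ if $T$, $U$ or some $S_k$ is empty; for each fixed $i$ the maps $\rho_{\langle S\rangle;i,T,U}$ satisfy the symmetry and associativity conditions as above; and for $i\ne j$, $S_i=T\amalg U$, $S_j=V\amalg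 W$, the two maps $$C_{TV}\oplus C_{UV}\oplus C_{TW}\oplus C_{UW}\to C_{\langle S\rangle}$$ agree, the first being $\rho_{\langle S\rangle;j,V,W}\circ(\rho_{i}\oplus\rho_{i})$ and the second $\rho_{\langle S\rangle;i,T,U}\circ(\rho_{j}\oplus\rho_{j})\circ(\mathrm{id}\oplus\gamma\oplus\mathrm{id})$, where $C_{TV}=C_{\langle S\rangle[S_i\to T,S_j\to V]}$ etc. Morphisms are families of maps $f_{\langle S\rangle}$ commuting with all $\rho$'s, with $f_{\langle S\rangle}=\mathrm{id}_0$ whenever some $S_k=\emptyset$. For $n=0$ there is one (empty) tuple and $\overline{\mathcal C}_{()}=\mathcal C$. The construction is functorial in the based sets $A_i$ by preimages; a permutation $\sigma\in\Sigma_n$ induces a functor $\overline{\mathcal C}_{(A_{\sigma(1)},\dots,A_{\sigma(n)})}\to\overline{\mathcal C}_{(A_1,\dots,A_n)}$, $\{C_{\langle S\rangle}\}\mapsto\{C_{(S_{\sigma(1)},\dots,S_{\sigma(n)})}\}$; and an element $x\in A_{n+1}$ induces an extension functor $\overline{\mathcal C}_{(A_1,\dots,A_n)}\to\overline{\mathcal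 C}_{(A_1,\dots,A_{n+1})}$ that sends $\{C_{\langle S\rangle}\}$ to the system with value $C_{(S_1,\dots,S_n)}$ at $(S_1,\dots,S_{n+1})$ if $x\in S_{n+1}$, and $0$ if $x\notin S_{n+1}$. *The spectra.* Let $S^1=\Delta^1/\partial\Delta^1$ be the simplicial circle, with set of $q$-simplices $S^1_q=\{0,\dots,q\}$ based at $0$, and let $N$ denote the nerve, followed by the diagonal when applied to a simplicial category. A symmetric spectrum (of simplicial sets) is a sequence of based simplicial sets $X(n)$ with actions of $\Sigma_n$ and based structure maps $X(n)\wedge S^1\to X(n+1)$ whose iterates $X(n)\wedge (S^1)^{\wedge q}\to X(n+q)$ are $(\Sigma_n\times\Sigma_q)$-equivariant. Then: - $K^{\mathrm{Seg}}\mathcal C$ is the symmetric spectrum with $n$-th space $N\overline{\mathcal C}_{S^1\wedge\cdots\wedge S^1}$ ($n$ factors; for $n=0$ the smash product is $S^0$). The group $\Sigma_n$ acts by permuting the smash factors, and the structure map on $q$-simplices is induced, for $x\in S^1_q$, by the based map $y\mapsto y\wedge x$. - $K^{\mathrm{new}}\mathcal C$ is the symmetric spectrum with $n$-th space $N\overline{\mathcal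 C}_{(S^1,\dots,S^1)}$ ($n$ entries). The group $\Sigma_n$ acts by the permutation functors, and the structure map on $q$-simplices is induced, for $x\in S^1_q$, by the extension functor of $x$. In both cases the basepoints are given by the system with all objects $0$ and all maps identities. The functors $$\overline{\mathcal C}_{A_1\wedge\cdots\wedge A_n}\to\overline{\mathcal C}_{(A_1,\dots,A_n)},\qquad \{C_S\}\mapsto\{C_{S_1\times\cdots\times S_n}\}_{(S_1,\dots,S_n)},$$ commute with the functors induced by based maps, permutations and extensions, and so define a map of symmetric spectra $K^{\mathrm{Seg}}\mathcal C\to K^{\mathrm{new}}\mathcal C$. **Theorem.** For every small permutative category $\mathcal C$, the map of symmetric spectra $K^{\mathrm{Seg}}\mathcal C\to K^{\mathrm{new}}\mathcal C$ is a level equivalence: for every $n\ge 0$, the map of $n$-th spaces $(K^{\mathrm{Seg}}\mathcal C)(n)\to(K^{\mathrm{new}}\mathcal C)(n)$ is a weak equivalence of simplicial sets, i.e. its geometric realization is a homotopy equivalence. -/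

import Mathlib

universe v u

open CategoryTheory MonoidalCategory Opposite

lemma eqToHom_heq_eqToHom {C : Type u} [Category.{v} C] {A B A' B' : C} (hA : A = A')
    (h : A = B) (h' : A' = B') : HEq (eqToHom h) (eqToHom h') := by
  subst h h' hA
  rfl

/-- A permutative category: a symmetric monoidal category whose associativity and unit
isomorphisms are identities. -/
class PermutativeCategory (C : Type u) [Category.{v} C] [MonoidalCategory C]
    [SymmetricCategory C] : Prop where
  tensor_assoc (X Y Z : C) : (X ⊗ Y) ⊗ Z = X ⊗ (Y ⊗ Z)
  unit_tensor (X : C) : 𝟙_ C ⊗ X = X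
  tensor_unit (X : C) : X ⊗ 𝟙_ C = X
  associator_eq (X Y Z : C) : (α_ X Y Z).hom = eqToHom (tensor_assoc X Y Z)
  leftUnitor_eq (X : C) : (λ_ X).hom = eqToHom (unit_tensor X)
  rightUnitor_eq (X : C) : (ρ_ X).hom = eqToHom (tensor_unit X)

/-- The combinatorics that indexes a system of objects and sum maps: a type of indices, some of
which are declared empty, and for each direction `i` a relation `Split i S T U`, read
"`S` is the disjoint union of `T` and `U` in direction `i`". -/
structure Shape where
  Idx : Type
  Dir : Type
  IsEmpty : Idx → Prop
  Split : Dir → Idx → Idx → Idx → Prop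
  symm : ∀ {i S T U}, Split i S T U → Split i S U T
  unique : ∀ {i S S' T U}, Split i S T U → Split i S' T U → S = S'
  assoc : ∀ {i S TU T U V}, Split i S TU V → Split i TU T U →
    ∃ UV, Split i UV U V ∧ Split i S T UV

namespace Shape

/-- The relation `Split` after a further empty index `none` and a further direction `none` have
been adjoined; in the new direction only the trivial splittings `S = S ⊔ ∅ = ∅ ⊔ S` exist. -/
def SplitPlus (J : Shape) :
    Option J.Dir → Option J.Idx → Option J.Idx → Option J.Idx → Prop
  | some i, some S, some T, some U => J.Split i S T U
  | some _, none, none, none => True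
  | none, S, T, U => (T = S ∧ U = none) ∨ (T = none ∧ U = S)
  | _, _, _, _ => False

lemma splitPlus_some (J : Shape) {i : J.Dir} {S T U : Option J.Idx}
    (h : J.SplitPlus (some i) S T U) : (S = none ∧ T = none ∧ U = none) ∨
      ∃ s t u, S = some s ∧ T = some t ∧ U = some u ∧ J.Split i s t u := by
  rcases S with _ | S <;> rcases T with _ | T <;> rcases U with _ | U <;>
    simp_all [SplitPlus]

/-- The shape `J` with a further empty index and a further direction adjoined. -/
abbrev plus (J : Shape) : Shape where
  Idx := Option J.Idx
  Dir := Option J.Dir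
  IsEmpty S := ∀ k ∈ S, J.IsEmpty k
  Split := J.SplitPlus
  symm {i S T U} h := by
    rcases i with _ | i <;> rcases S with _ | S <;> rcases T with _ | T <;>
      rcases U with _ | U <;> simp_all [SplitPlus] <;> exact J.symm h
  unique {i S S' T U} h h' := by
    rcases i with _ | i <;> rcases S with _ | S <;> rcases S' with _ | S' <;>
      rcases T with _ | T <;> rcases U with _ | U <;> simp_all [SplitPlus]
    exact J.unique h h'
  assoc {i S TU T U V} h h' := by
    rcases i with _ | i
    · simp only [SplitPlus] at *
      rcases h with ⟨rfl, rfl⟩ | ⟨rfl, rfl⟩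
      · exact ⟨U, by simp, h'⟩
      · have : T = none ∧ U = none := by
          rcases h' with h' | h' <;> simp_all
        exact ⟨V, by simp [this], by simp [this]⟩
    · rcases TU with _ | TU <;> rcases S with _ | S <;> rcases T with _ | T <;>
        rcases U with _ | U <;> rcases V with _ | V <;> simp_all [SplitPlus]
      · exact ⟨none, by simp⟩
      · obtain ⟨UV, h₁, h₂⟩ := J.assoc h h'
        exact ⟨some UV, h₁, h₂⟩

/-- A map of shapes: it preserves empty indices and splittings. -/
@[ext]
structure Hom (J K : Shape) where
  idx : J.Idx → K.Idx
  dir : J.Dir → K.Dir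
  empty : ∀ {S}, J.IsEmpty S → K.IsEmpty (idx S)
  split : ∀ {i S T U}, J.Split i S T U → K.Split (dir i) (idx S) (idx T) (idx U)

/-- A partial map of shapes `J → K`; the indices that are not mapped to an index of `K` are
mapped to an additional empty index. -/
abbrev PMap (J K : Shape) := Hom J K.plus

namespace PMap

variable {J K L : Shape}

/-- A map of shapes as a partial map. -/
def ofTotal (φ : Hom J K) : PMap J K where
  idx S := some (φ.idx S)
  dir i := some (φ.dir i)
  empty h := by
    rintro _ ⟨⟩
    exact φ.empty h
  split h := φ.split h

/-- Composition of partial maps. -/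
def comp (φ : PMap J K) (ψ : PMap K L) : PMap J L where
  idx S := Option.bind (φ.idx S) ψ.idx
  dir i := Option.bind (φ.dir i) ψ.dir
  empty {S} h := by
    have h' := φ.empty h
    generalize φ.idx S = o at h'
    rcases o with _ | k
    · simp [plus]
    · exact ψ.empty (h' k rfl)
  split {i S T U} h := by
    have h' := φ.split h
    generalize φ.idx S = s at h'
    generalize φ.idx T = t at h'
    generalize φ.idx U = u at h'
    generalize φ.dir i = d at h'
    rcases d with _ | d
    · rcases h' with ⟨rfl, rfl⟩ | ⟨rfl, rfl⟩
      · exact Or.inl ⟨rfl, rfl⟩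
      · exact Or.inr ⟨rfl, rfl⟩
    · rcases splitPlus_some _ h' with ⟨rfl, rfl, rfl⟩ | ⟨s, t, u, rfl, rfl, rfl, h''⟩
      · show SplitPlus L (Option.bind (some d) ψ.dir) none none none
        rw [Option.bind_some]
        generalize ψ.dir d = e
        rcases e with _ | e
        · exact Or.inl ⟨rfl, rfl⟩
        · trivial
      · exact ψ.split h''

end PMap

end Shape

section Systems

variable (C : Type u) [Category.{v} C] [MonoidalCategory C] [SymmetricCategory C]

/-- A system `{C_S, ρ_{i,S,T,U}}` of objects of `C` and maps `ρ : C_T ⊕ C_U ⟶ C_S`, one for each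
splitting `S = T ⊔ U` in direction `i`; the maps `ρ` are required to lie in the class `W`. -/
structure System (J : Shape) (W : MorphismProperty C) where
  obj : J.Idx → C
  ρ : ∀ {i S T U}, J.Split i S T U → (obj T ⊗ obj U ⟶ obj S)
  mem : ∀ {i S T U} (h : J.Split i S T U), W (ρ h)
  obj_empty : ∀ {S}, J.IsEmpty S → obj S = 𝟙_ C
  ρ_empty : ∀ {i S T U} (h : J.Split i S T U), J.IsEmpty T ∨ J.IsEmpty U →
    ∃ e : obj T ⊗ obj U = obj S, ρ h = eqToHom e
  ρ_symm : ∀ {i S T U} (h : J.Split i S T U),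
    (β_ (obj T) (obj U)).hom ≫ ρ (J.symm h) = ρ h
  ρ_assoc : ∀ {i S TU UV T U V} (h₁ : J.Split i TU T U) (h₂ : J.Split i S TU V)
    (h₃ : J.Split i UV U V) (h₄ : J.Split i S T UV),
    ρ h₁ ▷ obj V ≫ ρ h₂ = (α_ (obj T) (obj U) (obj V)).hom ≫ obj T ◁ ρ h₃ ≫ ρ h₄
  ρ_interchange : ∀ {i j}, i ≠ j → ∀ {S T U V W TV UV TW UW}
    (hV : J.Split i V TV UV) (hW : J.Split i W TW UW) (hVW : J.Split j S V W)
    (hT : J.Split j T TV TW) (hU : J.Split j U UV UW) (hTU : J.Split i S T U),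
    (ρ hV ⊗ₘ ρ hW) ≫ ρ hVW =
      tensorμ (obj TV) (obj UV) (obj TW) (obj UW) ≫ (ρ hT ⊗ₘ ρ hU) ≫ ρ hTU

variable {C}

namespace System

variable {J : Shape} {W : MorphismProperty C}

/-- A morphism of systems: morphisms `f_S : C_S ⟶ C'_S` compatible with the maps `ρ`, which are
identities for empty `S`. -/
@[ext]
structure Hom (X Y : System C J W) where
  app : ∀ S, X.obj S ⟶ Y.obj S
  app_empty : ∀ {S} (h : J.IsEmpty S),
    app S = eqToHom ((X.obj_empty h).trans (Y.obj_empty h).symm)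
  comm : ∀ {i S T U} (h : J.Split i S T U),
    X.ρ h ≫ app S = (app T ⊗ₘ app U) ≫ Y.ρ h

instance : Category (System C J W) where
  Hom := Hom
  id X := { app := fun S => 𝟙 _, app_empty := fun h => by simp, comm := fun h => by simp }
  comp f g :=
    { app := fun S => f.app S ≫ g.app S
      app_empty := fun h => by simp [f.app_empty h, g.app_empty h]
      comm := fun h => by
        rw [← Category.assoc, f.comm, Category.assoc, g.comm, ← Category.assoc,
          tensorHom_comp_tensorHom] }
  id_comp f := Hom.ext (funext fun S => Category.id_comp _)
  comp_id f := Hom.ext (funext fun S => Category.comp_id _)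
  assoc f g h := Hom.ext (funext fun S => Category.assoc _ _ _)

lemma id_app (X : System C J W) (S : J.Idx) : Hom.app (𝟙 X) S = 𝟙 _ := rfl

lemma comp_app {X Y Z : System C J W} (f : X ⟶ Y) (g : Y ⟶ Z) (S : J.Idx) :
    Hom.app (f ≫ g) S = Hom.app f S ≫ Hom.app g S := rfl

lemma ext_heq {X Y : System C J W} (h₁ : ∀ S, X.obj S = Y.obj S)
    (h₂ : ∀ {i S T U} (h : J.Split i S T U), HEq (X.ρ h) (Y.ρ h)) : X = Y := by
  obtain ⟨o, r, _, _, _, _, _, _⟩ := X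
  obtain ⟨o', r', _, _, _, _, _, _⟩ := Y
  obtain rfl : o = o' := funext h₁
  obtain rfl : @r = @r' := by
    funext i S T U h
    exact eq_of_heq (h₂ h)
  rfl

lemma hom_heq {X Y X' Y' : System C J W} (hX : X = X') (hY : Y = Y') (f : X ⟶ Y)
    (g : X' ⟶ Y') (h : ∀ S, HEq (Hom.app f S) (Hom.app g S)) : HEq f g := by
  subst hX hY
  exact heq_of_eq (Hom.ext (funext fun S => eq_of_heq (h S)))

/-- The interchange law within a single direction follows from associativity and symmetry. -/
lemma interchange (X : System C J W) {i j : J.Dir} {S T U V W TV UV TW UW : J.Idx}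
    (hV : J.Split i V TV UV) (hW : J.Split i W TW UW) (hVW : J.Split j S V W)
    (hT : J.Split j T TV TW) (hU : J.Split j U UV UW) (hTU : J.Split i S T U) :
    (X.ρ hV ⊗ₘ X.ρ hW) ≫ X.ρ hVW =
      tensorμ (X.obj TV) (X.obj UV) (X.obj TW) (X.obj UW) ≫
        (X.ρ hT ⊗ₘ X.ρ hU) ≫ X.ρ hTU := by
  by_cases hij : i = j
  · subst hij
    obtain ⟨N, hN, hSN⟩ := J.assoc hVW hV
    obtain ⟨M', hM', hNM'⟩ := J.assoc (J.symm hN) (J.symm hW)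
    have hM := J.symm hM'
    have hNM := J.symm hNM'
    obtain ⟨U', hU', hNU⟩ := J.assoc hNM hM'
    obtain rfl : U' = U := J.unique hU' hU
    have e1 := X.ρ_assoc hV hVW hN hSN
    have e2 := X.ρ_assoc hM hNM hW hN
    have e3 := X.ρ_assoc hM' hNM hU hNU
    have e4 := X.ρ_assoc hT hTU hNU hSN
    have e5 := X.ρ_symm hM
    have e2' : X.obj UV ◁ X.ρ hW ≫ X.ρ hN =
        (α_ _ _ _).inv ≫ X.ρ hM ▷ _ ≫ X.ρ hNM := by
      rw [e2]; simp
    have e3' : X.ρ hM ▷ X.obj UW ≫ X.ρ hNM =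
        (β_ _ _).hom ▷ _ ≫ (α_ _ _ _).hom ≫ X.obj TW ◁ X.ρ hU ≫ X.ρ hNU := by
      rw [← e3, ← e5]; simp
    rw [MonoidalCategory.tensorHom_def', MonoidalCategory.tensorHom_def', Category.assoc,
      Category.assoc, e1, e4, associator_naturality_right_assoc,
      associator_naturality_right_assoc, ← whiskerLeft_comp_assoc, e2', e3', tensorμ]
    simp
  · exact X.ρ_interchange hij hV hW hVW hT hU hTU


end System

section Strict

variable [PermutativeCategory C]

open PermutativeCategory

lemma strict_associator_inv (X Y Z : C) :
    (α_ X Y Z).inv = eqToHom (tensor_assoc X Y Z).symm := by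
  rw [← cancel_epi (α_ X Y Z).hom, Iso.hom_inv_id, associator_eq, eqToHom_trans, eqToHom_refl]

lemma interchange_unit₁ (X Y : C) {Z : C} (f : X ⊗ Y ⟶ Z) :
    (eqToHom (unit_tensor X) ⊗ₘ eqToHom (unit_tensor Y)) ≫ f =
      tensorμ (𝟙_ C) X (𝟙_ C) Y ≫ (eqToHom (unit_tensor (𝟙_ C)) ⊗ₘ f) ≫
        eqToHom (unit_tensor Z) := by
  simp only [← leftUnitor_eq]
  rw [leftUnitor_monoidal, MonoidalCategory.tensorHom_def]
  simp

lemma interchange_unit₂ (X Y : C) {Z : C} (f : X ⊗ Y ⟶ Z) :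
    (eqToHom (tensor_unit X) ⊗ₘ eqToHom (tensor_unit Y)) ≫ f =
      tensorμ X (𝟙_ C) Y (𝟙_ C) ≫ (f ⊗ₘ eqToHom (unit_tensor (𝟙_ C))) ≫
        eqToHom (tensor_unit Z) := by
  simp only [← leftUnitor_eq, ← rightUnitor_eq]
  rw [rightUnitor_monoidal, MonoidalCategory.tensorHom_def']
  simp

lemma interchange_unit₃ (X Y : C) {Z : C} (f : X ⊗ Y ⟶ Z) :
    (eqToHom (unit_tensor (𝟙_ C)) ⊗ₘ f) ≫ eqToHom (unit_tensor Z) =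
      tensorμ (𝟙_ C) (𝟙_ C) X Y ≫
        (eqToHom (unit_tensor X) ⊗ₘ eqToHom (unit_tensor Y)) ≫ f := by
  have := tensor_left_unitality X Y
  rw [← cancel_epi ((λ_ (𝟙_ C)).inv ▷ (X ⊗ Y)), ← Category.assoc, ← Category.assoc,
    ← Category.assoc]
  simp only [← leftUnitor_eq]
  rw [Category.assoc _ (tensorμ _ _ _ _), ← this, MonoidalCategory.tensorHom_def]
  simp

lemma interchange_unit₄ (X Y : C) {Z : C} (f : X ⊗ Y ⟶ Z) :
    (f ⊗ₘ eqToHom (unit_tensor (𝟙_ C))) ≫ eqToHom (tensor_unit Z) =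
      tensorμ X Y (𝟙_ C) (𝟙_ C) ≫
        (eqToHom (tensor_unit X) ⊗ₘ eqToHom (tensor_unit Y)) ≫ f := by
  have := tensor_right_unitality X Y
  rw [← cancel_epi ((X ⊗ Y) ◁ (λ_ (𝟙_ C)).inv), ← Category.assoc, ← Category.assoc,
    ← Category.assoc]
  simp only [← leftUnitor_eq, ← rightUnitor_eq]
  rw [Category.assoc _ (tensorμ _ _ _ _), ← this, MonoidalCategory.tensorHom_def']
  simp

namespace System

variable {J : Shape} {W : MorphismProperty C}

/-- The objects of a system, extended by `0` to a further empty index. -/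
def objPlus (X : System C J W) : Option J.Idx → C
  | none => 𝟙_ C
  | some S => X.obj S

lemma objPlus_eq (X : System C J W) {S T U : Option J.Idx} (h : J.SplitPlus none S T U) :
    X.objPlus T ⊗ X.objPlus U = X.objPlus S := by
  rcases h with ⟨rfl, rfl⟩ | ⟨rfl, rfl⟩
  · exact tensor_unit _
  · exact unit_tensor _

/-- The maps `ρ` of a system, extended by identities to the trivial splittings. -/
def ρPlus (X : System C J W) : ∀ {i : Option J.Dir} {S T U : Option J.Idx},
    J.SplitPlus i S T U → (X.objPlus T ⊗ X.objPlus U ⟶ X.objPlus S)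
  | some _, some _, some _, some _, h => X.ρ h
  | some _, none, none, none, _ => eqToHom (unit_tensor (𝟙_ C))
  | none, _, _, _, h => eqToHom (X.objPlus_eq h)

/-- The extension by zero of a system. -/
def plus [W.ContainsIdentities] (X : System C J W) : System C J.plus W where
  obj := X.objPlus
  ρ := X.ρPlus
  mem {i S T U} h := by
    rcases i with _ | i
    · exact MorphismProperty.ContainsIdentities.eqToHom W (X.objPlus_eq h)
    · rcases S with _ | S <;> rcases T with _ | T <;> rcases U with _ | U <;>
        first | exact h.elim | skip
      · exact MorphismProperty.ContainsIdentities.eqToHom W (unit_tensor (𝟙_ C))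
      · exact X.mem h
  obj_empty {S} h := by
    rcases S with _ | S
    · rfl
    · exact X.obj_empty (h S rfl)
  ρ_empty {i S T U} h h' := by
    rcases i with _ | i
    · exact ⟨X.objPlus_eq h, rfl⟩
    · rcases S with _ | S <;> rcases T with _ | T <;> rcases U with _ | U <;>
        first | exact h.elim | skip
      · exact ⟨unit_tensor (𝟙_ C), rfl⟩
      · exact X.ρ_empty h (h'.imp (fun k => k T rfl) (fun k => k U rfl))
  ρ_symm {i S T U} h := by
    rcases i with _ | i
    · rcases h with ⟨rfl, rfl⟩ | ⟨rfl, rfl⟩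
      · simp [ρPlus, objPlus, ← rightUnitor_eq, ← leftUnitor_eq]
      · simp [ρPlus, objPlus, ← rightUnitor_eq, ← leftUnitor_eq]
    · rcases S with _ | S <;> rcases T with _ | T <;> rcases U with _ | U <;>
        first | exact h.elim | skip
      · simp [ρPlus, objPlus, ← leftUnitor_eq, ← unitors_equal]
      · exact X.ρ_symm h
  ρ_assoc {i S TU UV T U V} h₁ h₂ h₃ h₄ := by
    rcases i with _ | i
    · simp [ρPlus, associator_eq]
    · rcases S with _ | S <;> rcases T with _ | T <;> rcases U with _ | U <;>
        rcases V with _ | V <;> rcases TU with _ | TU <;> rcases UV with _ | UV <;>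
        first | exact h₁.elim | exact h₂.elim | exact h₃.elim | exact h₄.elim | skip
      · simp only [ρPlus, objPlus, associator_eq, eqToHom_whiskerRight, whiskerLeft_eqToHom,
          eqToHom_trans]
      · exact X.ρ_assoc h₁ h₂ h₃ h₄
  ρ_interchange {i j} hij {S T U V W TV UV TW UW} hV hW hVW hT hU hTU := by
    rcases i with _ | i <;> rcases j with _ | j
    · exact (hij rfl).elim
    · rcases J.splitPlus_some hT with ⟨rfl, rfl, rfl⟩ | ⟨t, tv, tw, rfl, rfl, rfl, -⟩ <;>
      rcases J.splitPlus_some hU with ⟨rfl, rfl, rfl⟩ | ⟨u, uv, uw, rfl, rfl, rfl, -⟩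
      · obtain rfl : V = none := by rcases hV with h | h <;> simp_all
        obtain rfl : W = none := by rcases hW with h | h <;> simp_all
        obtain rfl : S = none := by rcases hTU with h | h <;> simp_all
        exact interchange_unit₁ _ _ (eqToHom (unit_tensor (𝟙_ C)))
      · obtain rfl : V = some uv := by rcases hV with h | h <;> simp_all
        obtain rfl : W = some uw := by rcases hW with h | h <;> simp_all
        obtain rfl : S = some u := by rcases hTU with h | h <;> simp_all
        exact interchange_unit₁ _ _ (X.ρ hU)
      · obtain rfl : V = some tv := by rcases hV with h | h <;> simp_all
        obtain rfl : W = some tw := by rcases hW with h | h <;> simp_all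
        obtain rfl : S = some t := by rcases hTU with h | h <;> simp_all
        exact interchange_unit₂ _ _ (X.ρ hT)
      · rcases hTU with h | h <;> simp at h
    · rcases J.splitPlus_some hV with ⟨rfl, rfl, rfl⟩ | ⟨v, tv, uv, rfl, rfl, rfl, -⟩ <;>
      rcases J.splitPlus_some hW with ⟨rfl, rfl, rfl⟩ | ⟨w, tw, uw, rfl, rfl, rfl, -⟩
      · obtain rfl : T = none := by rcases hT with h | h <;> simp_all
        obtain rfl : U = none := by rcases hU with h | h <;> simp_all
        obtain rfl : S = none := by rcases hVW with h | h <;> simp_all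
        exact interchange_unit₃ _ _ (eqToHom (unit_tensor (𝟙_ C)))
      · obtain rfl : T = some tw := by rcases hT with h | h <;> simp_all
        obtain rfl : U = some uw := by rcases hU with h | h <;> simp_all
        obtain rfl : S = some w := by rcases hVW with h | h <;> simp_all
        exact interchange_unit₃ _ _ (X.ρ hW)
      · obtain rfl : T = some tv := by rcases hT with h | h <;> simp_all
        obtain rfl : U = some uv := by rcases hU with h | h <;> simp_all
        obtain rfl : S = some v := by rcases hVW with h | h <;> simp_all
        exact interchange_unit₄ _ _ (X.ρ hV)
      · rcases hVW with h | h <;> simp at h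
    · rcases J.splitPlus_some hVW with ⟨rfl, rfl, rfl⟩ | ⟨s, v, w, rfl, rfl, rfl, -⟩ <;>
      rcases J.splitPlus_some hT with ⟨rfl, rfl, rfl⟩ | ⟨t, tv, tw, rfl, rfl, rfl, -⟩ <;>
      rcases J.splitPlus_some hU with ⟨rfl, rfl, rfl⟩ | ⟨u, uv, uw, rfl, rfl, rfl, -⟩ <;>
      first | exact hTU.elim | exact hV.elim | skip
      · exact interchange_unit₁ _ _ (eqToHom (unit_tensor (𝟙_ C)))
      · exact X.ρ_interchange (fun e => hij (congrArg some e)) hV hW hVW hT hU hTU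


lemma plus_ρ_some [W.ContainsIdentities] (X : System C J W) {i S T U}
    (h : J.Split i S T U) :
    X.plus.ρ (i := some i) (S := some S) (T := some T) (U := some U) h = X.ρ h := rfl

/-- The extension of a morphism of systems by the identity of `0`. -/
def Hom.plus [W.ContainsIdentities] {X Y : System C J W} (f : Hom X Y) :
    Hom X.plus Y.plus where
  app
    | none => 𝟙 (𝟙_ C)
    | some S => f.app S
  app_empty {S} h := by
    rcases S with _ | S
    · rfl
    · exact f.app_empty (h S rfl)
  comm {i S T U} h := by
    rcases i with _ | i
    · rcases h with ⟨rfl, rfl⟩ | ⟨rfl, rfl⟩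
      · rcases T with _ | T
        · simp [System.plus, ρPlus, objPlus]
        · simp [System.plus, ρPlus, objPlus, ← rightUnitor_eq]
      · rcases U with _ | U
        · simp [System.plus, ρPlus, objPlus]
        · simp [System.plus, ρPlus, objPlus, ← leftUnitor_eq]
    · rcases Shape.splitPlus_some _ h with ⟨rfl, rfl, rfl⟩ | ⟨s, t, u, rfl, rfl, rfl, h'⟩
      · simp [System.plus, ρPlus, objPlus]
      · exact f.comm h'

variable {K L : Shape} {W' W'' : MorphismProperty C} [W.ContainsIdentities]

/-- The functor that reindexes systems along a partial map of shapes: `C_S` becomes `C_{φ S}`,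
and `ρ_{i,S,T,U}` becomes `ρ_{φ i,φ S,φ T,φ U}`. -/
def pull (φ : Shape.PMap J K) (hW : W ≤ W') : System C K W ⥤ System C J W' where
  obj X :=
    { obj := fun S => X.plus.obj (φ.idx S)
      ρ := fun h => X.plus.ρ (φ.split h)
      mem := fun h => hW _ (X.plus.mem _)
      obj_empty := fun h => X.plus.obj_empty (φ.empty h)
      ρ_empty := fun h h' => X.plus.ρ_empty _ (h'.imp φ.empty φ.empty)
      ρ_symm := fun h => X.plus.ρ_symm (φ.split h)
      ρ_assoc := fun h₁ h₂ h₃ h₄ =>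
        X.plus.ρ_assoc (φ.split h₁) (φ.split h₂) (φ.split h₃) (φ.split h₄)
      ρ_interchange := fun _ _ _ _ _ _ _ _ _ _ hV hW hVW hT hU hTU =>
        X.plus.interchange (φ.split hV) (φ.split hW) (φ.split hVW) (φ.split hT) (φ.split hU)
          (φ.split hTU) }
  map f :=
    { app := fun S => (Hom.plus f).app (φ.idx S)
      app_empty := fun h => (Hom.plus f).app_empty (φ.empty h)
      comm := fun h => (Hom.plus f).comm (φ.split h) }
  map_id X := by
    refine Hom.ext (funext fun S => ?_)
    show (Hom.plus (𝟙 X)).app (φ.idx S) = 𝟙 (X.objPlus (φ.idx S))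
    generalize φ.idx S = o
    rcases o with _ | o <;> rfl
  map_comp f g := by
    refine Hom.ext (funext fun S => ?_)
    show (Hom.plus (f ≫ g)).app (φ.idx S) =
      (Hom.plus f).app (φ.idx S) ≫ (Hom.plus g).app (φ.idx S)
    generalize φ.idx S = o
    rcases o with _ | o
    · exact (Category.id_comp _).symm
    · rfl

lemma pull_ofTotal_id : pull (Shape.PMap.ofTotal ⟨id, id, id, id⟩) (le_refl W) =
    𝟭 (System C J W) := by
  refine Functor.hext (fun X => ?_) (fun X Y f => ?_)
  · exact ext_heq (fun _ => rfl) (fun _ => HEq.rfl)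
  · exact hom_heq rfl rfl _ _ (fun _ => HEq.rfl)

lemma pull_pull_obj [W'.ContainsIdentities] (ψ : Shape.PMap K L) (h : W ≤ W') (X : System C L W)
    (S : Option K.Idx) :
    ((pull ψ h).obj X).plus.obj S = X.plus.obj (Option.bind S ψ.idx) := by
  rcases S with _ | S <;> rfl

lemma pull_pull_ρ [W'.ContainsIdentities] (ψ : Shape.PMap K L) (h : W ≤ W') (X : System C L W)
    {i : Option K.Dir} {S T U : Option K.Idx} (k : K.plus.Split i S T U)
    (k' : L.plus.Split (Option.bind i ψ.dir) (Option.bind S ψ.idx) (Option.bind T ψ.idx)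
      (Option.bind U ψ.idx)) :
    HEq (((pull ψ h).obj X).plus.ρ k) (X.plus.ρ k') := by
  rcases i with _ | i
  · refine eqToHom_heq_eqToHom ?_ (((pull ψ h).obj X).objPlus_eq k) (X.objPlus_eq k')
    exact congrArg₂ tensorObj (pull_pull_obj ψ h X T) (pull_pull_obj ψ h X U)
  · rcases Shape.splitPlus_some _ k with ⟨rfl, rfl, rfl⟩ | ⟨s, t, u, rfl, rfl, rfl, k''⟩
    · obtain ⟨e, he⟩ := X.plus.ρ_empty k' (Or.inl (fun _ h => by simp at h))
      rw [he]
      exact eqToHom_heq_eqToHom rfl (unit_tensor (𝟙_ C)) e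
    · exact HEq.rfl

lemma pull_comp [W'.ContainsIdentities] (φ : Shape.PMap J K) (ψ : Shape.PMap K L) (h : W ≤ W') (h' : W' ≤ W'') :
    pull ψ h ⋙ pull φ h' = pull (C := C) (φ.comp ψ) (h.trans h') := by
  have hobj : ∀ X : System C L W,
      (pull ψ h ⋙ pull φ h').obj X = (pull (φ.comp ψ) (h.trans h')).obj X := fun X =>
    ext_heq (fun S => pull_pull_obj ψ h X (φ.idx S))
      (fun k => pull_pull_ρ ψ h X (φ.split k) ((φ.comp ψ).split k))
  refine Functor.hext hobj (fun X Y f => hom_heq (hobj X) (hobj Y) _ _ (fun S => ?_))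
  show HEq ((Hom.plus ((pull ψ h).map f)).app (φ.idx S))
    ((Hom.plus f).app (Option.bind (φ.idx S) ψ.idx))
  generalize φ.idx S = o
  rcases o with _ | o <;> rfl

lemma pull_congr {φ ψ : Shape.PMap J K} (h : W ≤ W')
    (h₁ : ∀ S, φ.idx S = ψ.idx S ∨ (K.plus.IsEmpty (φ.idx S) ∧ K.plus.IsEmpty (ψ.idx S)))
    (h₂ : ∀ i, φ.dir i = ψ.dir i ∨ ∀ S T U, J.Split i S T U →
      K.plus.IsEmpty (φ.idx T) ∨ K.plus.IsEmpty (φ.idx U)) :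
    pull (C := C) φ h = pull ψ h := by
  have ho : ∀ (X : System C K W) S, X.plus.obj (φ.idx S) = X.plus.obj (ψ.idx S) := by
    intro X S
    rcases h₁ S with e | ⟨e, e'⟩
    · rw [e]
    · rw [X.plus.obj_empty e, X.plus.obj_empty e']
  have he : ∀ S, K.plus.IsEmpty (φ.idx S) → K.plus.IsEmpty (ψ.idx S) := by
    intro S e
    rcases h₁ S with e' | ⟨-, e'⟩
    · rwa [← e']
    · exact e'
  have hobj : ∀ X : System C K W, (pull φ h).obj X = (pull ψ h).obj X := by
    intro X
    refine ext_heq (ho X) (fun {i S T U} k => ?_)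
    show HEq (X.plus.ρ (φ.split k)) (X.plus.ρ (ψ.split k))
    by_cases hE : K.plus.IsEmpty (φ.idx T) ∨ K.plus.IsEmpty (φ.idx U)
    · obtain ⟨e₁, r₁⟩ := X.plus.ρ_empty (φ.split k) hE
      obtain ⟨e₂, r₂⟩ := X.plus.ρ_empty (ψ.split k) (hE.imp (he T) (he U))
      rw [r₁, r₂]
      exact eqToHom_heq_eqToHom (congrArg₂ tensorObj (ho X T) (ho X U)) _ _
    · have hd : φ.dir i = ψ.dir i := (h₂ i).resolve_right (fun e => hE (e S T U k))
      have hT : φ.idx T = ψ.idx T := (h₁ T).resolve_right (fun e => hE (Or.inl e.1))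
      have hU : φ.idx U = ψ.idx U := (h₁ U).resolve_right (fun e => hE (Or.inr e.1))
      have k₁ := φ.split k
      have k₂ := ψ.split k
      show HEq (X.plus.ρ k₁) (X.plus.ρ k₂)
      generalize φ.dir i = d at *
      generalize φ.idx T = t at *
      generalize φ.idx U = u at *
      subst hd hT hU
      have hS := K.plus.unique k₁ k₂
      generalize φ.idx S = s at *
      subst hS
      rfl
  refine Functor.hext hobj (fun X Y f => hom_heq (hobj X) (hobj Y) _ _ (fun S => ?_))
  show HEq ((Hom.plus f).app (φ.idx S)) ((Hom.plus f).app (ψ.idx S))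
  rcases h₁ S with e | ⟨e, e'⟩
  · rw [e]
  · rw [(Hom.plus f).app_empty e, (Hom.plus f).app_empty e']
    exact eqToHom_heq_eqToHom (ho X S) _ _

end System

end Strict

end Systems

section Shapes

/-- The subsets of a based set that do not contain the basepoint. -/
abbrev FreeSet (A : Pointed.{0}) := {S : Set A // A.point ∉ S}

/-- `S` is the disjoint union of `T` and `U`. -/
def IsDisjUnion {X : Type} (S T U : Set X) : Prop := T ∪ U = S ∧ T ∩ U = ∅

/-- The indices for Segal's construction on a based set `A`: the subsets of `A` that do not
contain the basepoint, with their decompositions as disjoint unions. -/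
abbrev segShape (A : Pointed.{0}) : Shape where
  Idx := FreeSet A
  Dir := Unit
  IsEmpty S := S.1 = ∅
  Split _ S T U := IsDisjUnion S.1 T.1 U.1
  symm h := ⟨by rw [Set.union_comm]; exact h.1, by rw [Set.inter_comm]; exact h.2⟩
  unique h h' := Subtype.ext (h.1.symm.trans h'.1)
  assoc {_ S TU T U V} h h' := by
    obtain ⟨h₁, h₂⟩ := h
    obtain ⟨k₁, k₂⟩ := h'
    refine ⟨⟨U.1 ∪ V.1, fun h => h.elim U.2 V.2⟩, ⟨rfl, ?_⟩, ?_, ?_⟩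
    · rw [← k₁] at h₂; grind
    · rw [← h₁, ← k₁, Set.union_assoc]
    · rw [← k₁] at h₂; grind

/-- The indices for the multivariable construction on a tuple `A` of based sets: tuples `S` of
subsets `S i ⊆ A i` that do not contain the basepoint; a tuple is empty if one of its entries is,
and a splitting in direction `i` decomposes `S i` as a disjoint union and leaves the other entries
unchanged. -/
abbrev multiShape {ι : Type} (A : ι → Pointed.{0}) : Shape where
  Idx := ∀ i, FreeSet (A i)
  Dir := ι
  IsEmpty S := ∃ i, (S i).1 = ∅
  Split i S T U := (∀ j, j ≠ i → T j = S j ∧ U j = S j) ∧ IsDisjUnion (S i).1 (T i).1 (U i).1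
  symm {i _ _ _} h := ⟨fun j hj => (h.1 j hj).symm, (segShape (A i)).symm (i := ()) h.2⟩
  unique {i S S' T U} h h' := by
    funext j
    by_cases hj : j = i
    · subst hj
      exact (segShape (A j)).unique (i := ()) h.2 h'.2
    · rw [← (h.1 j hj).1, ← (h'.1 j hj).1]
  assoc {i S TU T U V} h h' := by
    classical
    obtain ⟨UV, h₁, h₂⟩ := (segShape (A i)).assoc (i := ()) h.2 h'.2
    refine ⟨Function.update S i UV, ⟨fun j hj => ?_, ?_⟩, fun j hj => ?_, ?_⟩
    · rw [Function.update_of_ne hj, (h'.1 j hj).2, (h.1 j hj).1, (h.1 j hj).2]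
      exact ⟨rfl, rfl⟩
    · rw [Function.update_self]; exact h₁
    · rw [Function.update_of_ne hj, (h'.1 j hj).1, (h.1 j hj).1]
      exact ⟨rfl, rfl⟩
    · rw [Function.update_self]; exact h₂

/-- The preimage of a basepoint-free subset under a based map. -/
def FreeSet.preimage {A B : Pointed.{0}} (f : A ⟶ B) (S : FreeSet B) : FreeSet A :=
  ⟨f.toFun ⁻¹' S.1, by rw [Set.mem_preimage, f.map_point]; exact S.2⟩

lemma IsDisjUnion.preimage {X Y : Type} (f : X → Y) {S T U : Set Y} (h : IsDisjUnion S T U) :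
    IsDisjUnion (f ⁻¹' S) (f ⁻¹' T) (f ⁻¹' U) :=
  ⟨by rw [← h.1]; rfl, by rw [← Set.preimage_inter, h.2, Set.preimage_empty]⟩

/-- The map of index shapes induced by a based map. -/
def segShapeMap {A B : Pointed.{0}} (f : A ⟶ B) : Shape.Hom (segShape B) (segShape A) where
  idx := FreeSet.preimage f
  dir := id
  empty {S} h := by
    show f.toFun ⁻¹' S.1 = ∅
    rw [show S.1 = ∅ from h, Set.preimage_empty]
  split h := h.preimage f.toFun

/-- The map of index shapes induced by a tuple of based maps. -/
def multiShapeMap {ι : Type} {A B : ι → Pointed.{0}} (f : A ⟶ B) :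
    Shape.Hom (multiShape B) (multiShape A) where
  idx S i := FreeSet.preimage (f i) (S i)
  dir := id
  empty {S} := fun ⟨i, h⟩ => ⟨i, by
    show (f i).toFun ⁻¹' (S i).1 = ∅
    rw [h, Set.preimage_empty]⟩
  split {i S T U} h := ⟨fun j hj => ⟨congrArg _ (h.1 j hj).1, congrArg _ (h.1 j hj).2⟩,
    h.2.preimage _⟩

/-- The map of index shapes that permutes the entries of a tuple. -/
def permShapeMap {ι κ : Type} (e : ι ≃ κ) (A : κ → Pointed.{0}) :
    Shape.Hom (multiShape A) (multiShape (fun i => A (e i))) where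
  idx S i := S (e i)
  dir := e.symm
  empty {S} := fun ⟨k, h⟩ => by
    obtain ⟨i, rfl⟩ := e.surjective k
    exact ⟨i, h⟩
  split {i S T U} h := by
    obtain ⟨i, rfl⟩ := e.surjective i
    rw [e.symm_apply_apply]
    exact ⟨fun j hj => h.1 (e j) (fun hk => hj (e.injective hk)), h.2⟩

open Classical in
/-- The partial map of index shapes that sends `(S₁, …, Sₙ, Sₙ₊₁)` to `(S₁, …, Sₙ)` if `x ∈ Sₙ₊₁`,
and to the additional empty index otherwise. -/
noncomputable def extShapeMap {n : ℕ} (A : Fin (n + 1) → Pointed.{0}) (x : A (Fin.last n)) :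
    Shape.PMap (multiShape A) (multiShape (fun i : Fin n => A i.castSucc)) where
  idx S := if x ∈ (S (Fin.last n)).1 then some (fun i => S i.castSucc) else none
  dir i := Fin.lastCases (motive := fun _ => Option (Fin n)) none some i
  empty {S} := fun ⟨i, h⟩ => by
    induction i using Fin.lastCases with
    | last => simp [h]
    | cast i =>
      intro k hk
      split_ifs at hk with hx
      · cases hk
        exact ⟨i, h⟩
      · cases hk
  split {i S T U} h := by
    induction i using Fin.lastCases with
    | last =>
      rw [Fin.lastCases_last]
      have hT : (fun i : Fin n => T i.castSucc) = fun i : Fin n => S i.castSucc :=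
        funext fun j => (h.1 _ (Fin.castSucc_lt_last j).ne).1
      have hU : (fun i : Fin n => U i.castSucc) = fun i : Fin n => S i.castSucc :=
        funext fun j => (h.1 _ (Fin.castSucc_lt_last j).ne).2
      have h₁ : x ∈ (S (Fin.last n)).1 ↔ x ∈ (T (Fin.last n)).1 ∨ x ∈ (U (Fin.last n)).1 := by
        rw [← h.2.1]; rfl
      have h₂ : ¬ (x ∈ (T (Fin.last n)).1 ∧ x ∈ (U (Fin.last n)).1) := by
        have : x ∉ (T (Fin.last n)).1 ∩ (U (Fin.last n)).1 := by rw [h.2.2]; simp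
        exact this
      show (_ ∧ _) ∨ (_ ∧ _)
      rw [hT, hU]
      by_cases ht : x ∈ (T (Fin.last n)).1 <;> by_cases hu : x ∈ (U (Fin.last n)).1 <;>
        simp_all
    | cast i =>
      rw [Fin.lastCases_castSucc]
      have hl := h.1 (Fin.last n) (Fin.castSucc_lt_last i).ne'
      rw [hl.1, hl.2]
      by_cases hx : x ∈ (S (Fin.last n)).1
      · rw [if_pos hx, if_pos hx, if_pos hx]
        exact ⟨fun j hj => h.1 _ (fun e => hj (Fin.castSucc_injective n e)), h.2⟩
      · rw [if_neg hx, if_neg hx, if_neg hx]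
        trivial

/-- The smash product of a finite family of based sets: the tuples without basepoint entries,
together with a basepoint. For the empty family it has one element besides the basepoint. -/
def smash {ι : Type} (A : ι → Pointed.{0}) : Pointed.{0} where
  X := Option {a : ∀ i, A i // ∀ i, a i ≠ (A i).point}
  point := none

open Classical in
/-- The element of the smash product represented by a tuple. -/
noncomputable def smash.mk {ι : Type} {A : ι → Pointed.{0}} (a : ∀ i, A i) : smash A :=
  if h : ∀ i, a i ≠ (A i).point then some ⟨a, h⟩ else none

/-- The map of index shapes that sends `(S₁, …, Sₙ)` to `S₁ × ⋯ × Sₙ`. -/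
def prodShapeMap {ι : Type} (A : ι → Pointed.{0}) :
    Shape.Hom (multiShape A) (segShape (smash A)) where
  idx S := ⟨{z | ∃ a, z = some a ∧ ∀ i, a.1 i ∈ (S i).1}, fun ⟨_, h, _⟩ => by cases h⟩
  dir _ := ()
  empty {S} := fun ⟨i, h⟩ => by
    refine Set.eq_empty_of_forall_notMem ?_
    rintro _ ⟨a, -, ha⟩
    have := ha i
    rw [h] at this
    exact this
  split {i S T U} h := by
    have hT : ∀ a : ∀ i, A i, (∀ j, a j ∈ (T j).1) ↔ (∀ j, a j ∈ (S j).1) ∧ a i ∈ (T i).1 := by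
      intro a
      refine ⟨fun ha => ⟨fun j => ?_, ha i⟩, fun ha j => ?_⟩
      · by_cases hj : j = i
        · subst hj; rw [← h.2.1]; exact Or.inl (ha j)
        · rw [← (h.1 j hj).1]; exact ha j
      · by_cases hj : j = i
        · subst hj; exact ha.2
        · rw [(h.1 j hj).1]; exact ha.1 j
    have hU : ∀ a : ∀ i, A i, (∀ j, a j ∈ (U j).1) ↔ (∀ j, a j ∈ (S j).1) ∧ a i ∈ (U i).1 := by
      intro a
      refine ⟨fun ha => ⟨fun j => ?_, ha i⟩, fun ha j => ?_⟩
      · by_cases hj : j = i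
        · subst hj; rw [← h.2.1]; exact Or.inr (ha j)
        · rw [← (h.1 j hj).2]; exact ha j
      · by_cases hj : j = i
        · subst hj; exact ha.2
        · rw [(h.1 j hj).2]; exact ha.1 j
    constructor
    · ext z
      constructor
      · rintro (⟨a, rfl, ha⟩ | ⟨a, rfl, ha⟩)
        · exact ⟨a, rfl, ((hT _).1 ha).1⟩
        · exact ⟨a, rfl, ((hU _).1 ha).1⟩
      · rintro ⟨a, rfl, ha⟩
        have : a.1 i ∈ (T i).1 ∪ (U i).1 := by rw [h.2.1]; exact ha i
        rcases this with k | k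
        · exact Or.inl ⟨a, rfl, (hT _).2 ⟨ha, k⟩⟩
        · exact Or.inr ⟨a, rfl, (hU _).2 ⟨ha, k⟩⟩
    · refine Set.eq_empty_of_forall_notMem ?_
      rintro _ ⟨⟨a, rfl, ha⟩, ⟨b, hb, hb'⟩⟩
      cases hb
      have : a.1 i ∈ (T i).1 ∩ (U i).1 := ⟨ha i, hb' i⟩
      rw [h.2.2] at this
      exact this

end Shapes

section Spectra

/-- The face and degeneracy maps of the simplicial circle: for a monotone map
`θ : {0, …, a} → {0, …, b}`, an element `j` of `{0, …, b}` is sent to the number of `k` with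
`θ k < j`, where the number `a + 1` is read as `0`. -/
def simplicialCircleMap {a b : ℕ} (θ : Fin (a + 1) →o Fin (b + 1)) (j : Fin (b + 1)) : Fin (a + 1) :=
  if h : (Finset.univ.filter (fun k => θ k < j)).card < a + 1 then ⟨_, h⟩ else 0

lemma circle_lt_card_iff {a b : ℕ} (θ : Fin (a + 1) →o Fin (b + 1)) (j : Fin (b + 1))
    (k : Fin (a + 1)) : k.1 < (Finset.univ.filter (fun k => θ k < j)).card ↔ θ k < j := by
  constructor
  · intro h
    by_contra hk
    have : Finset.univ.filter (fun k => θ k < j) ⊆ Finset.Iio k := by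
      intro l hl
      simp only [Finset.mem_filter, Finset.mem_univ, true_and] at hl
      rw [Finset.mem_Iio]
      by_contra hkl
      exact hk (lt_of_le_of_lt (θ.monotone (not_lt.1 hkl)) hl)
    have := Finset.card_le_card this
    rw [Fin.card_Iio] at this
    omega
  · intro h
    have : Finset.Iic k ⊆ Finset.univ.filter (fun k => θ k < j) := by
      intro l hl
      simp only [Finset.mem_filter, Finset.mem_univ, true_and]
      exact lt_of_le_of_lt (θ.monotone (Finset.mem_Iic.1 hl)) h
    have := Finset.card_le_card this
    rw [Fin.card_Iic] at this
    omega

lemma simplicialCircleMap_zero {a b : ℕ} (θ : Fin (a + 1) →o Fin (b + 1)) : simplicialCircleMap θ 0 = 0 := by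
  simp [simplicialCircleMap]

lemma simplicialCircleMap_id {a : ℕ} (j : Fin (a + 1)) : simplicialCircleMap OrderHom.id j = j := by
  have : (Finset.univ.filter (fun k : Fin (a + 1) => k < j)).card = j.1 := by
    rw [Finset.filter_gt_eq_Iio, Fin.card_Iio]
  have h' : (Finset.univ.filter (fun k => (OrderHom.id : Fin (a + 1) →o _) k < j)).card = j.1 :=
    this
  rw [simplicialCircleMap, dif_pos (by rw [h']; exact j.2)]
  exact Fin.ext h'

lemma simplicialCircleMap_comp {a b c : ℕ} (θ : Fin (a + 1) →o Fin (b + 1)) (η : Fin (b + 1) →o Fin (c + 1))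
    (j : Fin (c + 1)) : simplicialCircleMap (η.comp θ) j = simplicialCircleMap θ (simplicialCircleMap η j) := by
  by_cases h : (Finset.univ.filter (fun k => η k < j)).card < b + 1
  · have e : simplicialCircleMap η j = ⟨_, h⟩ := dif_pos h
    have : ∀ k, (η.comp θ) k < j ↔ θ k < simplicialCircleMap η j := by
      intro k
      rw [e]
      exact (circle_lt_card_iff η j (θ k)).symm
    unfold simplicialCircleMap
    simp only [this]
    rfl
  · have e : simplicialCircleMap η j = 0 := dif_neg h
    rw [e, simplicialCircleMap_zero]
    have : ∀ k, (η.comp θ) k < j := by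
      intro k
      exact (circle_lt_card_iff η j (θ k)).1 (by omega)
    rw [simplicialCircleMap, dif_neg]
    rw [Finset.filter_true_of_mem (fun k _ => this k), Finset.card_univ, Fintype.card_fin]
    omega

/-- The simplicial circle, a simplicial object in based sets: its set of `n`-simplices is
`{0, …, n}`, with basepoint `0`. -/
def circle : SimplexCategoryᵒᵖ ⥤ Pointed.{0} where
  obj n := ⟨Fin (n.unop.len + 1), 0⟩
  map θ := ⟨simplicialCircleMap θ.unop.toOrderHom, simplicialCircleMap_zero _⟩
  map_id _ := Pointed.Hom.ext (funext fun j => simplicialCircleMap_id j)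
  map_comp _ _ := Pointed.Hom.ext (funext fun j => simplicialCircleMap_comp _ _ j)

/-- The product `X × S¹` of a simplicial set with the simplicial circle. -/
def prodCircle (X : SSet.{u}) : SSet.{u} where
  obj n := X.obj n × circle.obj n
  map f := ↾fun z => (X.map f z.1, (circle.map f).toFun z.2)
  map_id n := by
    refine ConcreteCategory.hom_ext _ _ (fun z => ?_)
    exact congrArg₂ Prod.mk (congrArg (fun g : X.obj n ⟶ X.obj n => g z.1) (X.map_id n))
      (congrFun (congrArg Pointed.Hom.toFun (circle.map_id n)) z.2)
  map_comp f g := by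
    refine ConcreteCategory.hom_ext _ _ (fun z => ?_)
    exact congrArg₂ Prod.mk (congrArg (fun h : X.obj _ ⟶ X.obj _ => h z.1) (X.map_comp f g))
      (congrFun (congrArg Pointed.Hom.toFun (circle.map_comp f g)) z.2)

/-- The iterated maps `X(p) × (S¹)^q ⟶ X(p + q)`. -/
def suspIter (X : ℕ → SSet.{u}) (susp : ∀ p, prodCircle (X p) ⟶ X (p + 1)) (p : ℕ) :
    ∀ (q : ℕ) (n : SimplexCategoryᵒᵖ), (X p).obj n → (Fin q → circle.obj n) → (X (p + q)).obj n
  | 0, _, x, _ => x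
  | q + 1, n, x, t =>
    (susp (p + q)).app n (suspIter X susp p q n x (fun i => t i.castSucc), t (Fin.last q))

/-- The permutation of `{1, …, p + q}` given by permutations of the first `p` and of the last `q`
elements. -/
def blockPerm {p q : ℕ} (α : Equiv.Perm (Fin p)) (β : Equiv.Perm (Fin q)) :
    Equiv.Perm (Fin (p + q)) :=
  finSumFinEquiv.permCongr (Equiv.sumCongr α β)

/-- A symmetric spectrum (of simplicial sets): based simplicial sets `X(p)` with an action of the
symmetric group `Σ_p` and maps `X(p) × S¹ ⟶ X(p + 1)` which factor through `X(p) ∧ S¹`, such that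
the iterated maps `X(p) × (S¹)^q ⟶ X(p + q)` are `(Σ_p × Σ_q)`-equivariant. -/
structure SymmetricSpectrum where
  level : ℕ → SSet.{u}
  act : ∀ p, Equiv.Perm (Fin p) →* End (level p)
  pt : ∀ p n, (level p).obj n
  pt_map : ∀ p {m n} (f : m ⟶ n), (level p).map f (pt p m) = pt p n
  act_pt : ∀ p α n, NatTrans.app (act p α) n (pt p n) = pt p n
  susp : ∀ p, prodCircle (level p) ⟶ level (p + 1)
  susp_pt_left : ∀ p n (t : circle.obj n), (susp p).app n (pt p n, t) = pt (p + 1) n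
  susp_pt_right : ∀ p n (x : (level p).obj n),
    (susp p).app n (x, (circle.obj n).point) = pt (p + 1) n
  equivariant : ∀ p q (α : Equiv.Perm (Fin p)) (β : Equiv.Perm (Fin q)) n
    (x : (level p).obj n) (t : Fin q → circle.obj n),
    suspIter level susp p q n (NatTrans.app (act p α) n x) (fun i => t (β.symm i)) =
      NatTrans.app (act (p + q) (blockPerm α β)) n (suspIter level susp p q n x t)

namespace SymmetricSpectrum

/-- A map of symmetric spectra: maps `X(p) ⟶ Y(p)` that preserve the basepoints, the actions of
the symmetric groups and the structure maps. -/
@[ext]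
structure Hom (X Y : SymmetricSpectrum.{u}) where
  app : ∀ p, X.level p ⟶ Y.level p
  app_pt : ∀ p n, (app p).app n (X.pt p n) = Y.pt p n
  app_act : ∀ p α n (x : (X.level p).obj n),
    (app p).app n (NatTrans.app (X.act p α) n x) = NatTrans.app (Y.act p α) n ((app p).app n x)
  app_susp : ∀ p n (x : (X.level p).obj n) (t : circle.obj n),
    (app (p + 1)).app n ((X.susp p).app n (x, t)) = (Y.susp p).app n ((app p).app n x, t)

instance : Category SymmetricSpectrum.{u} where
  Hom := Hom
  id X :=
    { app := fun _ => 𝟙 _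
      app_pt := fun _ _ => rfl
      app_act := fun _ _ _ _ => rfl
      app_susp := fun _ _ _ _ => rfl }
  comp f g :=
    { app := fun p => f.app p ≫ g.app p
      app_pt := fun p n => by simp [f.app_pt, g.app_pt]
      app_act := fun p α n x => by simp [f.app_act, g.app_act]
      app_susp := fun p n x t => by simp [f.app_susp, g.app_susp] }

/-- A map of simplicial sets is a weak equivalence if its geometric realization is a homotopy
equivalence. -/
def WeakEquiv {X Y : SSet.{u}} (f : X ⟶ Y) : Prop :=
  ∃ e : ContinuousMap.HomotopyEquiv (SSet.toTop.obj X) (SSet.toTop.obj Y),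
    e.toFun = (SSet.toTop.map f).hom

/-- A map of symmetric spectra is a level equivalence if each of the maps `X(p) ⟶ Y(p)` is a
weak equivalence of simplicial sets. -/
def IsLevelEquiv {X Y : SymmetricSpectrum.{u}} (f : X ⟶ Y) : Prop :=
  ∀ p, WeakEquiv (Hom.app f p)

end SymmetricSpectrum

/-- The diagonal of a bisimplicial set. -/
def diagonal : (SimplexCategoryᵒᵖ ⥤ SSet.{u}) ⥤ SSet.{u} where
  obj X :=
    { obj := fun n => (X.obj n).obj n
      map := fun {m n} f => (X.obj m).map f ≫ (X.map f).app n
      map_id := fun n => by simp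
      map_comp := fun f g => by simp }
  map η := { app := fun n => (η.app n).app n }

end Spectra

section Construction

/-- The data from which a symmetric spectrum is built: for each `p` a functor `F p` from based sets
to categories, with an action of `Σ_p`, distinguished objects `0`, and for each element `x` of `A`
an extension functor `F p A ⥤ F (p + 1) A`. -/
structure SymmetricSequence where
  F : ℕ → Pointed.{0} ⥤ Cat.{u, u}
  perm : ∀ p, Equiv.Perm (Fin p) →* End (F p)
  zero : ∀ p A, (F p).obj A
  map_zero : ∀ p {A B} (f : A ⟶ B), ((F p).map f).toFunctor.obj (zero p A) = zero p B
  perm_zero : ∀ p α A, (NatTrans.app (perm p α) A).toFunctor.obj (zero p A) = zero p A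
  ext : ∀ p {A : Pointed.{0}} (_ : A), (F p).obj A ⟶ (F (p + 1)).obj A
  ext_natural : ∀ p {A B : Pointed.{0}} (f : A ⟶ B) (x : A),
    ext p x ≫ (F (p + 1)).map f = (F p).map f ≫ ext p (f.toFun x)
  ext_zero : ∀ p {A : Pointed.{0}} (x : A), (ext p x).toFunctor.obj (zero p A) = zero (p + 1) A
  ext_point : ∀ p (A : Pointed.{0}),
    (ext p A.point).toFunctor = (Functor.const _).obj (zero (p + 1) A)
  iter : ∀ p q {A : Pointed.{0}} (_ : Fin q → A), (F p).obj A ⟶ (F (p + q)).obj A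
  iter_zero : ∀ p {A : Pointed.{0}} (t : Fin 0 → A), iter p 0 t = 𝟙 _
  iter_succ : ∀ p q {A : Pointed.{0}} (t : Fin (q + 1) → A),
    iter p (q + 1) t = iter p q (fun i => t i.castSucc) ≫ ext (p + q) (t (Fin.last q))
  equivariant : ∀ p q {A : Pointed.{0}} (α : Equiv.Perm (Fin p)) (β : Equiv.Perm (Fin q))
    (t : Fin q → A),
    NatTrans.app (perm p α) A ≫ iter p q (fun i => t (β.symm i)) =
      iter p q t ≫ NatTrans.app (perm (p + q) (blockPerm α β)) A

namespace SymmetricSequence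

/-- The bisimplicial set `(m, n) ↦ (N (F p (S¹ m))) n`. -/
abbrev bisimplicial (F : Pointed.{0} ⥤ Cat.{u, u}) : SimplexCategoryᵒᵖ ⥤ SSet.{u} :=
  circle ⋙ F ⋙ nerveFunctor

lemma const_comp_eq {I C D : Type*} [Category I] [Category C] [Category D] (X : C) (G : C ⥤ D) :
    (Functor.const I).obj X ⋙ G = (Functor.const I).obj (G.obj X) :=
  CategoryTheory.Functor.ext (fun _ => rfl) (fun _ _ _ => by simp)

/-- The structure maps of the symmetric spectrum: on `n`-simplices, the map indexed by an
`n`-simplex `x` of the circle is induced by the extension functor of `x`. -/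
def suspMap (F : SymmetricSequence.{u}) (p : ℕ) :
    prodCircle (diagonal.obj (bisimplicial (F.F p))) ⟶
      diagonal.obj (bisimplicial (F.F (p + 1))) where
  app := fun n => ↾fun z => (nerveFunctor.map (F.ext p z.2)).app n z.1
  naturality m n f := by
    refine ConcreteCategory.hom_ext _ _ (fun z => ?_)
    exact congrArg (fun G : (F.F p).obj (circle.obj m) ⟶ (F.F (p + 1)).obj (circle.obj n) =>
      (nerveFunctor.map G).app n ((nerve _).map f z.1))
      (F.ext_natural p (circle.map f) z.2).symm

lemma suspIter_eq (F : SymmetricSequence.{u}) (p q : ℕ) (n : SimplexCategoryᵒᵖ)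
    (x : (diagonal.obj (bisimplicial (F.F p))).obj n) (t : Fin q → circle.obj n) :
    suspIter (fun p => diagonal.obj (bisimplicial (F.F p))) F.suspMap p q n x t =
      (nerveFunctor.map (F.iter p q t)).app n x := by
  induction q with
  | zero =>
    rw [F.iter_zero]
    rfl
  | succ q ih =>
    rw [F.iter_succ, suspIter, ih]
    rfl

/-- The symmetric spectrum with `p`-th level the diagonal of the nerve of the simplicial category
`F p (S¹)`. -/
def spectrum (F : SymmetricSequence.{u}) : SymmetricSpectrum.{u} where
  level p := diagonal.obj (bisimplicial (F.F p))
  act p :=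
    { toFun := fun α => diagonal.map
        (Functor.whiskerLeft circle (Functor.whiskerRight (F.perm p α) nerveFunctor))
      map_one' := by
        rw [map_one]
        rfl
      map_mul' := fun α β => by
        rw [map_mul]
        rfl }
  pt p n := (Functor.const _).obj (F.zero p (circle.obj n))
  pt_map p m n f := by
    show ((Functor.const _).obj (F.zero p (circle.obj m))) ⋙ ((F.F p).map (circle.map f)).toFunctor
      = _
    rw [const_comp_eq, F.map_zero]
  act_pt p α n := by
    show ((Functor.const _).obj (F.zero p (circle.obj n))) ⋙
      (NatTrans.app (F.perm p α) (circle.obj n)).toFunctor = _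
    rw [const_comp_eq, F.perm_zero]
  susp p := F.suspMap p
  susp_pt_left p n t := by
    show ((Functor.const _).obj (F.zero p (circle.obj n))) ⋙ (F.ext p t).toFunctor = _
    rw [const_comp_eq, F.ext_zero]
  susp_pt_right p n x := by
    show Functor.comp x (F.ext p (circle.obj n).point).toFunctor = _
    rw [F.ext_point]
    rfl
  equivariant p q α β n x t := by
    rw [suspIter_eq, suspIter_eq]
    exact congrArg (fun G : (F.F p).obj (circle.obj n) ⟶ (F.F (p + q)).obj (circle.obj n) =>
      (nerveFunctor.map G).app n x) (F.equivariant p q α β t)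

/-- A map of the data from which symmetric spectra are built. -/
structure Hom (F G : SymmetricSequence.{u}) where
  app : ∀ p, F.F p ⟶ G.F p
  app_zero : ∀ p A, ((app p).app A).toFunctor.obj (F.zero p A) = G.zero p A
  app_perm : ∀ p α, F.perm p α ≫ app p = app p ≫ G.perm p α
  app_ext : ∀ p {A : Pointed.{0}} (x : A),
    F.ext p x ≫ (app (p + 1)).app A = (app p).app A ≫ G.ext p x

/-- The induced map of symmetric spectra. -/
def Hom.spectrumMap {F G : SymmetricSequence.{u}} (f : Hom F G) : F.spectrum ⟶ G.spectrum :=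
  SymmetricSpectrum.Hom.mk
    (app := fun p => diagonal.map
      (Functor.whiskerLeft circle (Functor.whiskerRight (f.app p) nerveFunctor)))
    (app_pt := fun p n => by
      show ((Functor.const _).obj (F.zero p (circle.obj n))) ⋙
        ((f.app p).app (circle.obj n)).toFunctor = _
      rw [const_comp_eq, f.app_zero]
      rfl)
    (app_act := fun p α n x => congrArg (fun η : F.F p ⟶ G.F p =>
      (nerveFunctor.map (η.app (circle.obj n))).app n x) (f.app_perm p α))
    (app_susp := fun p n x t => congrArg
      (fun g : (F.F p).obj (circle.obj n) ⟶ (G.F (p + 1)).obj (circle.obj n) =>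
        (nerveFunctor.map g).app n x) (f.app_ext p t))

end SymmetricSequence

end Construction

namespace smash

variable {ι κ : Type} {A : ι → Pointed.{0}}

lemma mk_of_ne (a : ∀ i, A i) (h : ∀ i, a i ≠ (A i).point) : mk a = some ⟨a, h⟩ := dif_pos h

lemma mk_of_eq (a : ∀ i, A i) (i : ι) (h : a i = (A i).point) : mk a = (smash A).point :=
  dif_neg fun h' => h' i h

/-- The based map out of a smash product given by a map `g` on tuples. -/
def lift {B : Pointed.{0}} (g : (∀ i, A i) → B) : smash A ⟶ B :=
  ⟨fun z => Option.elim z B.point (fun a => g a.1), rfl⟩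

lemma lift_mk {B : Pointed.{0}} (g : (∀ i, A i) → B)
    (hg : ∀ a i, a i = (A i).point → g a = B.point) (a : ∀ i, A i) :
    (lift g).toFun (mk a) = g a := by
  by_cases h : ∀ i, a i ≠ (A i).point
  · rw [mk_of_ne a h]
    rfl
  · push Not at h
    obtain ⟨i, hi⟩ := h
    rw [mk_of_eq a i hi, hg a i hi]
    rfl

lemma hom_ext {B : Pointed.{0}} {f g : smash A ⟶ B}
    (h : ∀ a : ∀ i, A i, (∀ i, a i ≠ (A i).point) → f.toFun (mk a) = g.toFun (mk a)) :
    f = g := by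
  refine Pointed.Hom.ext (funext fun z => ?_)
  rcases z with _ | ⟨a, ha⟩
  · exact f.map_point.trans g.map_point.symm
  · rw [← mk_of_ne a ha]
    exact h a ha

/-- The smash product of based maps. -/
noncomputable def map {B : ι → Pointed.{0}} (f : ∀ i, A i ⟶ B i) : smash A ⟶ smash B :=
  lift fun a => mk fun i => (f i).toFun (a i)

lemma map_mk {B : ι → Pointed.{0}} (f : ∀ i, A i ⟶ B i) (a : ∀ i, A i) :
    (map f).toFun (mk a) = mk fun i => (f i).toFun (a i) :=
  lift_mk _ (fun a i h => mk_of_eq _ i (by rw [h, (f i).map_point])) a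

variable {B : Pointed.{0}} {p q : ℕ}

/-- The permutation of the factors of a smash power. -/
noncomputable def perm (α : Equiv.Perm (Fin p)) :
    smash (fun _ : Fin p => B) ⟶ smash (fun _ : Fin p => B) :=
  lift fun a => mk fun i => a (α.symm i)

lemma perm_mk (α : Equiv.Perm (Fin p)) (a : Fin p → B) :
    (perm α).toFun (mk a) = mk fun i => a (α.symm i) :=
  lift_mk _ (fun a i h => mk_of_eq _ (α i) (by rw [α.symm_apply_apply]; exact h)) a

/-- The map `y ↦ y ∧ t₁ ∧ ⋯ ∧ t_q` of smash powers. -/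
noncomputable def append (t : Fin q → B) :
    smash (fun _ : Fin p => B) ⟶ smash (fun _ : Fin (p + q) => B) :=
  lift fun a => mk (Fin.append a t)

lemma append_mk (t : Fin q → B) (a : Fin p → B) :
    (append t).toFun (mk a) = mk (A := fun _ : Fin (p + q) => B) (Fin.append a t) :=
  lift_mk _ (fun a i h => mk_of_eq _ (Fin.castAdd q i) (by rw [Fin.append_left]; exact h)) a

/-- The map `y ↦ y ∧ x` of smash powers. -/
noncomputable def ext (x : B) :
    smash (fun _ : Fin p => B) ⟶ smash (fun _ : Fin (p + 1) => B) :=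
  lift fun a => mk (Fin.snoc (α := fun _ => B) a x)

lemma ext_mk (x : B) (a : Fin p → B) :
    (ext x).toFun (mk a) = mk (A := fun _ : Fin (p + 1) => B) (Fin.snoc (α := fun _ => B) a x) :=
  lift_mk _ (fun a i h => mk_of_eq _ i.castSucc (by rw [Fin.snoc_castSucc]; exact h)) a

/-- The functor `A ↦ A ∧ ⋯ ∧ A`. -/
noncomputable def pow (p : ℕ) : Pointed.{0} ⥤ Pointed.{0} where
  obj A := smash (fun _ : Fin p => A)
  map f := map fun _ => f
  map_id A := hom_ext fun a _ => map_mk _ a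
  map_comp f g := hom_ext fun a _ => by
    show _ = (map _).toFun ((map _).toFun (mk a))
    rw [map_mk, map_mk, map_mk]
    rfl

/-- The action of the symmetric group on smash powers. -/
noncomputable def powPerm (p : ℕ) : Equiv.Perm (Fin p) →* End (pow p) where
  toFun α :=
    { app := fun A => perm α
      naturality := fun A B f => hom_ext fun a _ => by
        simp only [pow, Pointed.Hom.comp_toFun', Function.comp_apply, map_mk, perm_mk] }
  map_one' := NatTrans.ext (funext fun A => hom_ext fun a _ => perm_mk _ a)
  map_mul' α β := NatTrans.ext (funext fun A => hom_ext fun a _ => by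
    show (perm (α * β)).toFun (mk a) = (perm α).toFun ((perm β).toFun (mk a))
    rw [perm_mk, perm_mk, perm_mk]
    rfl)

end smash

lemma blockPerm_symm_castAdd {p q : ℕ} (α : Equiv.Perm (Fin p)) (β : Equiv.Perm (Fin q))
    (i : Fin p) : (blockPerm α β).symm (Fin.castAdd q i) = Fin.castAdd q (α.symm i) := by
  rw [Equiv.symm_apply_eq]
  simp [blockPerm, Equiv.permCongr_apply]

lemma blockPerm_symm_natAdd {p q : ℕ} (α : Equiv.Perm (Fin p)) (β : Equiv.Perm (Fin q))
    (i : Fin q) : (blockPerm α β).symm (Fin.natAdd p i) = Fin.natAdd p (β.symm i) := by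
  rw [Equiv.symm_apply_eq]
  simp [blockPerm, Equiv.permCongr_apply]

lemma append_comp_blockPerm {B : Type} {p q : ℕ} (α : Equiv.Perm (Fin p))
    (β : Equiv.Perm (Fin q)) (a : Fin p → B) (t : Fin q → B) :
    Fin.append (fun i => a (α.symm i)) (fun i => t (β.symm i)) =
      fun i => Fin.append a t ((blockPerm α β).symm i) := by
  funext i
  induction i using Fin.addCases with
  | left i => rw [blockPerm_symm_castAdd, Fin.append_left, Fin.append_left]
  | right i => rw [blockPerm_symm_natAdd, Fin.append_right, Fin.append_right]

lemma append_succ {B : Type} {p q : ℕ} (a : Fin p → B) (t : Fin (q + 1) → B) :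
    Fin.append a t = Fin.snoc (α := fun _ => B) (Fin.append a fun i => t i.castSucc)
      (t (Fin.last q)) := by
  funext i
  induction i using Fin.lastCases (n := p + q) with
  | last =>
    refine Eq.trans ?_ (Fin.snoc_last (α := fun _ => B) _ _).symm
    exact Fin.append_right a t (Fin.last q)
  | cast i =>
    refine Eq.trans ?_ (Fin.snoc_castSucc (α := fun _ => B) _ _ _).symm
    induction i using Fin.addCases with
    | left i =>
      rw [Fin.append_left]
      exact Fin.append_left a t i
    | right i =>
      rw [Fin.append_right]
      exact Fin.append_right a t i.castSucc

section KTheory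

namespace Shape.PMap

/-- The partial map of shapes that is nowhere defined. -/
def trivial (J K : Shape) : PMap J K where
  idx _ := none
  dir _ := none
  empty _ _ h := by cases h
  split _ := Or.inl ⟨rfl, rfl⟩

end Shape.PMap

/-- The shape without indices. -/
abbrev emptyShape : Shape where
  Idx := Empty
  Dir := Empty
  IsEmpty _ := True
  Split _ _ _ _ := False
  symm h := h
  unique h := h.elim
  assoc h := h.elim

variable (C : Type u) [SmallCategory C] [MonoidalCategory C] [SymmetricCategory C]
  [PermutativeCategory C]

namespace System

variable {C}
variable {J K : Shape} {W W' : MorphismProperty C} [W.ContainsIdentities]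

/-- The system without objects. -/
def empty : System C emptyShape W where
  obj := Empty.elim
  ρ h := h.elim
  mem h := h.elim
  obj_empty {S} := S.elim
  ρ_empty h := h.elim
  ρ_symm h := h.elim
  ρ_assoc h := h.elim
  ρ_interchange {i} := i.elim

/-- The system with all objects `0` and all maps `ρ` the identity. -/
def zero : System C J W := (pull (Shape.PMap.trivial J emptyShape) le_rfl).obj empty

lemma pull_zero [W'.ContainsIdentities] (φ : Shape.PMap J K) (h : W ≤ W') :
    (pull φ h).obj (zero : System C K W) = zero := by
  have h₁ := pull_comp (C := C) φ (Shape.PMap.trivial K emptyShape) (le_refl W) h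
  have h₂ := pull_congr (C := C) (φ := φ.comp (Shape.PMap.trivial K emptyShape))
    (ψ := Shape.PMap.trivial J emptyShape) h
    (fun S => Or.inl (by
      show Option.bind (φ.idx S) (fun _ => none) = none
      simp))
    (fun i => Or.inl (by
      show Option.bind (φ.dir i) (fun _ => none) = none
      simp))
  exact (Functor.congr_obj h₁ empty).trans (Functor.congr_obj h₂ empty)

lemma pull_eq_const [W'.ContainsIdentities] (φ : Shape.PMap J K) (h : W ≤ W')
    (hφ : ∀ S, K.plus.IsEmpty (φ.idx S)) :
    pull φ h = (Functor.const (System C K W)).obj zero := by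
  have h₁ := pull_congr (C := C) (φ := φ) (ψ := Shape.PMap.trivial J K) h
    (fun S => Or.inr ⟨hφ S, fun _ h => by cases h⟩) (fun i => Or.inr fun _ T _ _ => Or.inl (hφ T))
  rw [h₁]
  have hobj : ∀ X : System C K W, (pull (Shape.PMap.trivial J K) h).obj X = zero := fun X =>
    ext_heq (fun _ => rfl) (fun _ => HEq.rfl)
  exact Functor.hext hobj (fun X Y f => hom_heq (hobj X) (hobj Y) _ _ (fun S => HEq.rfl))

lemma pull_square {K' L : Shape} {V V' : MorphismProperty C} [V.ContainsIdentities]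
    [V'.ContainsIdentities] (φ : Shape.PMap J K) (ψ : Shape.PMap K L)
    (φ' : Shape.PMap J K') (ψ' : Shape.PMap K' L) (h₁ : W ≤ V) (h₂ : V ≤ W') (h₁' : W ≤ V')
    (h₂' : V' ≤ W')
    (h : ∀ S, (φ.comp ψ).idx S = (φ'.comp ψ').idx S ∨
      (L.plus.IsEmpty ((φ.comp ψ).idx S) ∧ L.plus.IsEmpty ((φ'.comp ψ').idx S)))
    (h' : ∀ i, (φ.comp ψ).dir i = (φ'.comp ψ').dir i ∨ ∀ S T U, J.Split i S T U →
      L.plus.IsEmpty ((φ.comp ψ).idx T) ∨ L.plus.IsEmpty ((φ.comp ψ).idx U)) :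
    (pull (C := C) ψ h₁).toCatHom ≫ (pull φ h₂).toCatHom =
      (pull ψ' h₁').toCatHom ≫ (pull φ' h₂').toCatHom :=
  congrArg Functor.toCatHom ((pull_comp φ ψ h₁ h₂).trans
    ((pull_congr _ h h').trans (pull_comp φ' ψ' h₁' h₂').symm))

end System

/-- Segal's construction as a functor from based sets to categories: an object of `C̄_A` is a
system of objects `C_S` and isomorphisms `ρ_{S,T} : C_S ⊕ C_T ⟶ C_{S ∪ T}`, and a based map `f`
acts by reindexing along preimages. -/
def segalCat : Pointed.{0} ⥤ Cat.{u, u} where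
  obj A := Cat.of (System C (segShape A) (MorphismProperty.isomorphisms C))
  map f := (System.pull (Shape.PMap.ofTotal (segShapeMap f)) le_rfl).toCatHom
  map_id _ := congrArg Functor.toCatHom System.pull_ofTotal_id
  map_comp f g := congrArg Functor.toCatHom (System.pull_comp
    (Shape.PMap.ofTotal (segShapeMap g)) (Shape.PMap.ofTotal (segShapeMap f)) le_rfl le_rfl).symm

/-- The multivariable construction `C̄_{(A₁, …, Aₙ)}`, as a functor from tuples of based sets to
categories: the maps `ρ` need not be isomorphisms. -/
def multiCat (ι : Type) : (ι → Pointed.{0}) ⥤ Cat.{u, u} where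
  obj A := Cat.of (System C (multiShape A) ⊤)
  map f := (System.pull (Shape.PMap.ofTotal (multiShapeMap f)) le_rfl).toCatHom
  map_id _ := congrArg Functor.toCatHom System.pull_ofTotal_id
  map_comp f g := congrArg Functor.toCatHom (System.pull_comp
    (Shape.PMap.ofTotal (multiShapeMap g)) (Shape.PMap.ofTotal (multiShapeMap f))
    le_rfl le_rfl).symm

/-- The permutation functors of the multivariable construction. -/
def permFunctor {ι κ : Type} (e : ι ≃ κ) (A : κ → Pointed.{0}) :
    (multiCat C ι).obj (fun i => A (e i)) ⟶ (multiCat C κ).obj A :=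
  (System.pull (Shape.PMap.ofTotal (permShapeMap e A)) le_rfl).toCatHom

/-- The extension functors of the multivariable construction: for `x ∈ Aₙ₊₁`, the system
`{C_{(S₁, …, Sₙ)}}` is sent to the system whose value at `(S₁, …, Sₙ₊₁)` is `C_{(S₁, …, Sₙ)}` if
`x ∈ Sₙ₊₁` and `0` otherwise. -/
noncomputable def extFunctor {n : ℕ} (A : Fin (n + 1) → Pointed.{0}) (x : A (Fin.last n)) :
    (multiCat C (Fin n)).obj (fun i => A i.castSucc) ⟶ (multiCat C (Fin (n + 1))).obj A :=
  (System.pull (extShapeMap A x) le_rfl).toCatHom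

/-- The canonical functor `C̄_{A₁ ∧ ⋯ ∧ Aₙ} ⥤ C̄_{(A₁, …, Aₙ)}`, which sends `{C_S}` to the system
with value `C_{S₁ × ⋯ × Sₙ}` at `(S₁, …, Sₙ)`. -/
def compareFunctor {ι : Type} (A : ι → Pointed.{0}) :
    (segalCat C).obj (smash A) ⟶ (multiCat C ι).obj A :=
  (System.pull (Shape.PMap.ofTotal (prodShapeMap A)) le_top).toCatHom

/-- Segal's construction on smash powers, `A ↦ C̄_{A ∧ ⋯ ∧ A}`. -/
noncomputable def segalSequence : SymmetricSequence.{u} where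
  F p := smash.pow p ⋙ segalCat C
  perm p :=
    { toFun := fun α => Functor.whiskerRight (smash.powPerm p α) (segalCat C)
      map_one' := by
        rw [map_one]
        exact Functor.whiskerRight_id' _
      map_mul' := fun α β => by
        rw [map_mul]
        exact Functor.whiskerRight_comp _ _ _ }
  zero p A := System.zero
  map_zero p A B f := System.pull_zero _ le_rfl
  perm_zero p α A := System.pull_zero _ le_rfl
  ext p A x := (segalCat C).map (smash.ext x)
  ext_natural p A B f x := by
    refine ((segalCat C).map_comp _ _).symm.trans (Eq.trans ?_ ((segalCat C).map_comp _ _))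
    refine congrArg _ (smash.hom_ext fun a _ => ?_)
    show (smash.map _).toFun ((smash.ext x).toFun (smash.mk a)) =
      (smash.ext _).toFun ((smash.map _).toFun (smash.mk a))
    rw [smash.ext_mk, smash.map_mk, smash.map_mk, smash.ext_mk]
    congr 1
    funext i
    induction i using Fin.lastCases with
    | last => simp
    | cast i => simp
  ext_zero p A x := System.pull_zero _ le_rfl
  ext_point p A := System.pull_eq_const _ le_rfl fun S k hk => by
    cases hk
    refine Set.eq_empty_of_forall_notMem fun z hz => ?_
    have : (smash.ext A.point).toFun z = (smash (fun _ : Fin (p + 1) => A)).point := by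
      rcases z with _ | ⟨a, ha⟩
      · rfl
      · rw [← smash.mk_of_ne a ha, smash.ext_mk]
        exact smash.mk_of_eq _ (Fin.last p) (Fin.snoc_last _ _)
    have hz' : (smash.ext A.point).toFun z ∈ S.1 := hz
    rw [this] at hz'
    exact S.2 hz'
  iter p q A t := (segalCat C).map (smash.append t)
  iter_zero p A t := by
    refine Eq.trans (congrArg _ ?_) ((segalCat C).map_id _)
    refine smash.hom_ext fun a _ => ?_
    refine (smash.append_mk t a).trans ?_
    rw [Fin.append_right_nil _ _ rfl]
    rfl
  iter_succ p q A t := by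
    refine Eq.trans (congrArg _ ?_) ((segalCat C).map_comp _ _)
    refine smash.hom_ext fun a _ => ?_
    show _ = (smash.ext _).toFun ((smash.append _).toFun (smash.mk a))
    rw [smash.append_mk, smash.append_mk, smash.ext_mk, append_succ]
  equivariant p q A α β t := by
    refine ((segalCat C).map_comp _ _).symm.trans (Eq.trans ?_ ((segalCat C).map_comp _ _))
    refine congrArg _ (smash.hom_ext fun a _ => ?_)
    show (smash.append _).toFun ((smash.perm α).toFun (smash.mk a)) =
      (smash.perm _).toFun ((smash.append t).toFun (smash.mk a))
    rw [smash.perm_mk, smash.append_mk, smash.append_mk, smash.perm_mk, append_comp_blockPerm]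

lemma extShapeMap_idx_of_mem {n : ℕ} (A : Fin (n + 1) → Pointed.{0}) (x : A (Fin.last n))
    (S : ∀ i, FreeSet (A i)) (h : x ∈ (S (Fin.last n)).1) :
    (extShapeMap A x).idx S = some (fun i : Fin n => S i.castSucc) := if_pos h

lemma extShapeMap_idx_of_notMem {n : ℕ} (A : Fin (n + 1) → Pointed.{0}) (x : A (Fin.last n))
    (S : ∀ i, FreeSet (A i)) (h : x ∉ (S (Fin.last n)).1) :
    (extShapeMap A x).idx S = none := if_neg h

lemma extShapeMap_dir_last {n : ℕ} (A : Fin (n + 1) → Pointed.{0}) (x : A (Fin.last n)) :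
    (extShapeMap A x).dir (Fin.last n) = none :=
  Fin.lastCases_last (motive := fun _ => Option (Fin n))

lemma extShapeMap_dir_castSucc {n : ℕ} (A : Fin (n + 1) → Pointed.{0}) (x : A (Fin.last n))
    (i : Fin n) : (extShapeMap A x).dir i.castSucc = some i :=
  Fin.lastCases_castSucc (motive := fun _ => Option (Fin n)) _

lemma blockPerm_castAdd {p q : ℕ} (α : Equiv.Perm (Fin p)) (β : Equiv.Perm (Fin q))
    (i : Fin p) : blockPerm α β (Fin.castAdd q i) = Fin.castAdd q (α i) := by
  simp [blockPerm, Equiv.permCongr_apply]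

lemma blockPerm_natAdd {p q : ℕ} (α : Equiv.Perm (Fin p)) (β : Equiv.Perm (Fin q))
    (i : Fin q) : blockPerm α β (Fin.natAdd p i) = Fin.natAdd p (β i) := by
  simp [blockPerm, Equiv.permCongr_apply]

lemma mk_mem_prodShapeMap {ι : Type} {A : ι → Pointed.{0}} (S : ∀ i, FreeSet (A i))
    (a : ∀ i, A i) : smash.mk a ∈ ((prodShapeMap A).idx S).1 ↔ ∀ i, a i ∈ (S i).1 := by
  constructor
  · rintro ⟨b, hb, hb'⟩
    by_cases h : ∀ i, a i ≠ (A i).point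
    · rw [smash.mk_of_ne a h] at hb
      cases hb
      exact hb'
    · push Not at h
      obtain ⟨i, hi⟩ := h
      rw [smash.mk_of_eq a i hi] at hb
      cases hb
  · intro h
    have h' : ∀ i, a i ≠ (A i).point := fun i hi => (S i).2 (by
      have := h i
      rwa [hi] at this)
    exact ⟨⟨a, h'⟩, smash.mk_of_ne a h', h⟩

lemma smash.freeSet_ext {ι : Type} {A : ι → Pointed.{0}} {S T : FreeSet (smash A)}
    (h : ∀ a, (∀ i, a i ≠ (A i).point) → (smash.mk a ∈ S.1 ↔ smash.mk a ∈ T.1)) : S = T := by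
  refine Subtype.ext (Set.ext fun z => ?_)
  rcases z with _ | ⟨a, ha⟩
  · exact ⟨fun k => (S.2 k).elim, fun k => (T.2 k).elim⟩
  · rw [← smash.mk_of_ne a ha]
    exact h a ha

/-- The partial map of index shapes underlying an iterated extension functor. -/
noncomputable def iterShapeMap (p : ℕ) {A : Pointed.{0}} : ∀ (q : ℕ) (_ : Fin q → A),
    Shape.PMap (multiShape (fun _ : Fin (p + q) => A)) (multiShape (fun _ : Fin p => A))
  | 0, _ => Shape.PMap.ofTotal ⟨id, id, id, id⟩
  | q + 1, t => (extShapeMap (fun _ : Fin (p + q + 1) => A) (t (Fin.last q))).comp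
      (iterShapeMap p q fun i => t i.castSucc)

open Classical in
lemma iterShapeMap_idx (p q : ℕ) {A : Pointed.{0}} (t : Fin q → A)
    (S : Fin (p + q) → FreeSet A) :
    (iterShapeMap p q t).idx S = if ∀ j, t j ∈ (S (Fin.natAdd p j)).1
      then some (fun i => S (Fin.castAdd q i)) else none := by
  induction q with
  | zero =>
    rw [if_pos (fun j => j.elim0)]
    rfl
  | succ q ih =>
    have h₁ : (∀ j : Fin (q + 1), t j ∈ (S (Fin.natAdd p j)).1) ↔
        t (Fin.last q) ∈ (S (Fin.last (p + q))).1 ∧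
          ∀ j : Fin q, t j.castSucc ∈ (S (Fin.natAdd p j).castSucc).1 := by
      rw [Fin.forall_fin_succ', and_comm]
      rfl
    show Option.bind (if t (Fin.last q) ∈ (S (Fin.last (p + q))).1
      then some (fun i : Fin (p + q) => S i.castSucc) else none) _ = _
    by_cases h : t (Fin.last q) ∈ (S (Fin.last (p + q))).1
    · rw [if_pos h]
      refine (ih (fun i => t i.castSucc) (fun i => S i.castSucc)).trans ?_
      simp only [h₁, h, true_and]
      rfl
    · rw [if_neg h, if_neg (fun k => h (h₁.1 k).1)]
      rfl

lemma iterShapeMap_dir_castAdd (p q : ℕ) {A : Pointed.{0}} (t : Fin q → A) (i : Fin p) :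
    (iterShapeMap p q t).dir (Fin.castAdd q i) = some i := by
  induction q with
  | zero => rfl
  | succ q ih =>
    show Option.bind (Fin.lastCases (motive := fun _ => Option (Fin (p + q))) none some
      (Fin.castAdd q i).castSucc) _ = _
    rw [Fin.lastCases_castSucc]
    exact ih _

lemma iterShapeMap_dir_natAdd (p q : ℕ) {A : Pointed.{0}} (t : Fin q → A) (i : Fin q) :
    (iterShapeMap p q t).dir (Fin.natAdd p i) = none := by
  induction q with
  | zero => exact i.elim0
  | succ q ih =>
    induction i using Fin.lastCases with
    | last =>
      show Option.bind (Fin.lastCases (motive := fun _ => Option (Fin (p + q))) none some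
        (Fin.last (p + q))) _ = _
      rw [Fin.lastCases_last]
      rfl
    | cast i =>
      show Option.bind (Fin.lastCases (motive := fun _ => Option (Fin (p + q))) none some
        (Fin.natAdd p i).castSucc) _ = _
      rw [Fin.lastCases_castSucc]
      exact ih _ i

/-- The functor that sends `A` to the tuple `(A, …, A)`. -/
def constTuple (p : ℕ) : Pointed.{0} ⥤ (Fin p → Pointed.{0}) where
  obj A _ := A
  map f _ := f

/-- The multivariable construction on constant tuples, `A ↦ C̄_{(A, …, A)}`. -/
noncomputable def multiSequence : SymmetricSequence.{u} where
  F p := constTuple p ⋙ multiCat C (Fin p)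
  perm p :=
    { toFun := fun α =>
        { app := fun A => permFunctor C α (fun _ => A)
          naturality := fun A B f => System.pull_square
            (Shape.PMap.ofTotal (permShapeMap α fun _ => B))
            (Shape.PMap.ofTotal (multiShapeMap ((constTuple p).map f)))
            (Shape.PMap.ofTotal (multiShapeMap ((constTuple p).map f)))
            (Shape.PMap.ofTotal (permShapeMap α fun _ => A)) le_rfl le_rfl le_rfl le_rfl
            (fun _ => Or.inl rfl) (fun _ => Or.inl rfl) }
      map_one' := NatTrans.ext (funext fun A => congrArg Functor.toCatHom System.pull_ofTotal_id)
      map_mul' := fun α β => NatTrans.ext (funext fun A => congrArg Functor.toCatHom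
        (System.pull_comp (Shape.PMap.ofTotal (permShapeMap α fun _ => A))
          (Shape.PMap.ofTotal (permShapeMap β fun _ => A)) le_rfl le_rfl).symm) }
  zero p A := System.zero
  map_zero p A B f := System.pull_zero _ le_rfl
  perm_zero p α A := System.pull_zero _ le_rfl
  ext p A x := extFunctor C (fun _ => A) x
  ext_natural p A B f x := by
    refine System.pull_square
      (Shape.PMap.ofTotal (multiShapeMap ((constTuple (p + 1)).map f)))
      (extShapeMap (fun _ => A) x) (extShapeMap (fun _ => B) (f.toFun x))
      (Shape.PMap.ofTotal (multiShapeMap ((constTuple p).map f))) le_rfl le_rfl le_rfl le_rfl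
      (fun S => Or.inl ?_) (fun i => Or.inl ?_)
    · by_cases h : f.toFun x ∈ (S (Fin.last p)).1
      · refine (extShapeMap_idx_of_mem (fun _ => A) x _ h).trans ?_
        show _ = Option.bind ((extShapeMap (fun _ => B) (f.toFun x)).idx S) _
        exact (congrArg (fun o => Option.bind o (Shape.PMap.ofTotal (multiShapeMap
          ((constTuple p).map f))).idx) (extShapeMap_idx_of_mem (fun _ => B) _ S h)).symm
      · refine (extShapeMap_idx_of_notMem (fun _ => A) x _ h).trans ?_
        show _ = Option.bind ((extShapeMap (fun _ => B) (f.toFun x)).idx S) _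
        exact (congrArg (fun o => Option.bind o (Shape.PMap.ofTotal (multiShapeMap
          ((constTuple p).map f))).idx) (extShapeMap_idx_of_notMem (fun _ => B) _ S h)).symm
    · exact (Option.bind_fun_some ((extShapeMap (fun _ => B) (f.toFun x)).dir i)).symm
  ext_zero p A x := System.pull_zero _ le_rfl
  ext_point p A := System.pull_eq_const _ le_rfl fun S k hk => by
    rw [extShapeMap_idx_of_notMem _ _ _ (S (Fin.last p)).2] at hk
    cases hk
  iter p q A t := (System.pull (iterShapeMap p q t) le_rfl).toCatHom
  iter_zero p A t := congrArg Functor.toCatHom System.pull_ofTotal_id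
  iter_succ p q A t := congrArg Functor.toCatHom (System.pull_comp _ _ le_rfl le_rfl).symm
  equivariant p q A α β t := by
    refine System.pull_square (iterShapeMap p q fun i => t (β.symm i))
      (Shape.PMap.ofTotal (permShapeMap α fun _ => A))
      (Shape.PMap.ofTotal (permShapeMap (blockPerm α β) fun _ => A)) (iterShapeMap p q t)
      le_rfl le_rfl le_rfl le_rfl (fun S => Or.inl ?_) (fun i => Or.inl ?_)
    · show Option.bind ((iterShapeMap p q fun i => t (β.symm i)).idx S) _ =
        (iterShapeMap p q t).idx (fun i => S (blockPerm α β i))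
      rw [iterShapeMap_idx, iterShapeMap_idx]
      have h : (∀ j, t (β.symm j) ∈ (S (Fin.natAdd p j)).1) ↔
          ∀ j, t j ∈ (S (blockPerm α β (Fin.natAdd p j))).1 := by
        constructor
        · intro h j
          rw [blockPerm_natAdd]
          simpa using h (β j)
        · intro h j
          have := h (β.symm j)
          rwa [blockPerm_natAdd, β.apply_symm_apply] at this
      by_cases hS : ∀ j, t (β.symm j) ∈ (S (Fin.natAdd p j)).1
      · rw [if_pos hS, if_pos (h.1 hS)]
        refine congrArg some (funext fun i => ?_)
        show S (Fin.castAdd q (α i)) = S (blockPerm α β (Fin.castAdd q i))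
        rw [blockPerm_castAdd]
      · rw [if_neg hS, if_neg (fun k => hS (h.2 k))]
        rfl
    · show Option.bind ((iterShapeMap p q fun i => t (β.symm i)).dir i) _ =
        (iterShapeMap p q t).dir ((blockPerm α β).symm i)
      induction i using Fin.addCases with
      | left i =>
        rw [iterShapeMap_dir_castAdd, blockPerm_symm_castAdd, iterShapeMap_dir_castAdd]
        rfl
      | right i =>
        rw [iterShapeMap_dir_natAdd, blockPerm_symm_natAdd, iterShapeMap_dir_natAdd]
        rfl

/-- The comparison of the two constructions. -/
noncomputable def compareHom : SymmetricSequence.Hom (segalSequence C) (multiSequence C) where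
  app p :=
    { app := fun A => compareFunctor C (fun _ : Fin p => A)
      naturality := fun A B f => System.pull_square
        (Shape.PMap.ofTotal (prodShapeMap fun _ : Fin p => B))
        (Shape.PMap.ofTotal (segShapeMap ((smash.pow p).map f)))
        (Shape.PMap.ofTotal (multiShapeMap ((constTuple p).map f)))
        (Shape.PMap.ofTotal (prodShapeMap fun _ : Fin p => A)) le_rfl le_top le_top le_rfl
        (fun S => Or.inl (congrArg some (smash.freeSet_ext fun a _ => by
          show (smash.map fun _ => f).toFun (smash.mk a) ∈
            ((prodShapeMap fun _ : Fin p => B).idx S).1 ↔ _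
          rw [smash.map_mk, mk_mem_prodShapeMap]
          exact (mk_mem_prodShapeMap (A := fun _ : Fin p => A)
            (fun i => FreeSet.preimage f (S i)) a).symm))) (fun _ => Or.inl rfl) }
  app_zero p A := System.pull_zero _ le_top
  app_perm p α := NatTrans.ext (funext fun A => System.pull_square
    (Shape.PMap.ofTotal (prodShapeMap fun _ : Fin p => A))
    (Shape.PMap.ofTotal (segShapeMap (smash.perm α)))
    (Shape.PMap.ofTotal (permShapeMap α fun _ => A))
    (Shape.PMap.ofTotal (prodShapeMap fun _ : Fin p => A)) le_rfl le_top le_top le_rfl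
    (fun S => Or.inl (congrArg some (smash.freeSet_ext fun a _ => by
      show (smash.perm α).toFun (smash.mk a) ∈ ((prodShapeMap fun _ : Fin p => A).idx S).1 ↔ _
      rw [smash.perm_mk, mk_mem_prodShapeMap, mk_mem_prodShapeMap]
      refine ⟨fun h i => ?_, fun h i => ?_⟩
      · have : a i ∈ (S (α i)).1 := by simpa using h (α i)
        exact this
      · have : a (α.symm i) ∈ (S (α (α.symm i))).1 := h (α.symm i)
        rwa [α.apply_symm_apply] at this))) (fun _ => Or.inl rfl))
  app_ext p A x := by
    have key : ∀ (S : Fin (p + 1) → FreeSet A) (a : Fin p → A),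
        smash.mk a ∈ (FreeSet.preimage (smash.ext x)
          ((prodShapeMap fun _ : Fin (p + 1) => A).idx S)).1 ↔
        (∀ i, a i ∈ (S i.castSucc).1) ∧ x ∈ (S (Fin.last p)).1 := by
      intro S a
      show (smash.ext x).toFun (smash.mk a) ∈
        ((prodShapeMap fun _ : Fin (p + 1) => A).idx S).1 ↔ _
      rw [smash.ext_mk, mk_mem_prodShapeMap, Fin.forall_fin_succ']
      simp
    have hempty : ∀ S : Fin (p + 1) → FreeSet A, x ∉ (S (Fin.last p)).1 →
        (FreeSet.preimage (smash.ext x)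
          ((prodShapeMap fun _ : Fin (p + 1) => A).idx S)).1 = ∅ := by
      intro S hS
      have := smash.freeSet_ext (S := FreeSet.preimage (smash.ext x)
        ((prodShapeMap fun _ : Fin (p + 1) => A).idx S))
        (T := (⟨∅, by simp⟩ : FreeSet (smash fun _ : Fin p => A)))
        (fun a _ => by
          rw [key]
          simp [hS])
      rw [this]
    refine System.pull_square
      (Shape.PMap.ofTotal (prodShapeMap fun _ : Fin (p + 1) => A))
      (Shape.PMap.ofTotal (segShapeMap (smash.ext x)))
      (extShapeMap (fun _ => A) x)
      (Shape.PMap.ofTotal (prodShapeMap fun _ : Fin p => A)) le_rfl le_top le_top le_rfl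
      (fun S => ?_) (fun i => ?_)
    · by_cases hS : x ∈ (S (Fin.last p)).1
      · left
        show _ = Option.bind ((extShapeMap (fun _ => A) x).idx S) _
        rw [extShapeMap_idx_of_mem _ _ _ hS]
        refine congrArg some (smash.freeSet_ext fun a _ => ?_)
        rw [mk_mem_prodShapeMap]
        refine (key S a).trans ?_
        simp [hS]
      · right
        constructor
        · rintro _ ⟨⟩
          exact hempty S hS
        · show ∀ k ∈ Option.bind ((extShapeMap (fun _ => A) x).idx S) _, _
          rw [extShapeMap_idx_of_notMem _ _ _ hS]
          rintro _ ⟨⟩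
    · induction i using Fin.lastCases with
      | last =>
        right
        intro S T U h
        by_cases hT : x ∈ (T (Fin.last p)).1
        · right
          rintro _ ⟨⟩
          refine hempty U fun hU => ?_
          have : x ∈ (T (Fin.last p)).1 ∩ (U (Fin.last p)).1 := ⟨hT, hU⟩
          rw [h.2.2] at this
          exact this
        · left
          rintro _ ⟨⟩
          exact hempty T hT
      | cast i =>
        left
        show _ = Option.bind ((extShapeMap (fun _ => A) x).dir i.castSucc) _
        rw [extShapeMap_dir_castSucc]
        rfl

/-- Segal's construction of the `K`-theory of a permutative category: the symmetric spectrum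
`{N C̄_{Sⁿ}}`. -/
noncomputable def segalK : SymmetricSpectrum.{u} := (segalSequence C).spectrum

/-- The new construction of the `K`-theory of a permutative category: the symmetric spectrum
`{N C̄_{(S¹, …, S¹)}}`. -/
noncomputable def newK : SymmetricSpectrum.{u} := (multiSequence C).spectrum

/-- The natural map of symmetric spectra from Segal's construction to the new one. -/
noncomputable def segalToNew : segalK C ⟶ newK C := (compareHom C).spectrumMap

end KTheory

/-!
Fix a simplicial degree. The comparison functor `L` has no adjoint in general, but there are a
functor `R` in the opposite direction and natural maps `ε : R ⋙ L ⟶ 𝟭` and `ε' : L ⋙ R ⟶ 𝟭` with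
`L ε' = ε L`. If all `Aᵢ` have only one element besides the basepoint, then a multivariable system
is an object of `C`, and `R` places this object at the only such point of the smash product. In
general `R` adds up the contributions of the tuples of points. To see that this is compatible with
the maps `ρ`, the subsets `Aᵢ` are split into two parts, one index `i` at a time, and `R` is the
objectwise tensor product of the two functors obtained from the parts.

Since `R` is chosen separately in every degree, it does not define a simplicial map. The comparison
is made through the collage of `L` instead, which is a mapping cylinder and is natural in the
simplicial degree. On nerves, the inclusions of both ends of the collage are deformation retracts
by way of `ε`, `ε'` and hence anodyne. A monomorphism of bisimplicial sets that is anodyne in each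
row induces an anodyne extension of the diagonals, and realizations of anodyne extensions are
homotopy equivalences, because the realization of such a map lifts against maps with the homotopy
lifting property.
-/

section Anodyne

open SSet Simplicial HomotopicalAlgebra modelCategoryQuillen CartesianMonoidalCategory

/-- The inclusion of the end `e` of the cylinder `X ⊗ Δ[1]`. The two ends are indexed by `Fin 2`
because deformations in both directions occur. -/
noncomputable def endIncl (e : Fin 2) {X : SSet.{u}} : X ⟶ X ⊗ Δ[1] :=
  lift (𝟙 X) (const (stdSimplex.obj₀Equiv.{u}.symm e))

lemma endIncl_whiskerRight_assoc (e : Fin 2) {X Y Z : SSet.{u}} (f : X ⟶ Y) (g : Y ⊗ Δ[1] ⟶ Z) :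
    endIncl e ≫ f ▷ _ ≫ g = f ≫ endIncl e ≫ g := rfl

lemma endIncl_fst_assoc (e : Fin 2) {X Y : SSet.{u}} (f : X ⟶ Y) :
    endIncl e ≫ fst X Δ[1] ≫ f = f := rfl

lemma endIncl_app_eq_of_const (e : Fin 2) {X : SSet.{u}} {m : SimplexCategoryᵒᵖ} (x : X.obj m)
    (d : (Δ[1] : SSet.{u}).obj m) (hd : ∀ k, stdSimplex.asOrderHom d k = e) :
    (endIncl e).app m x = ((x, d) : (X ⊗ Δ[1]).obj m) :=
  Prod.ext rfl (stdSimplex.objEquiv.injective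
    (SimplexCategory.Hom.ext _ _ (OrderHom.ext _ _ (funext fun k => (hd k).symm))))

/-- The end `e` of the part `X ⊗ T` of the cylinder, for a subcomplex `T` of `Δ[1]` that contains
the vertex `e`. -/
noncomputable def subEndIncl (e : Fin 2) {X : SSet.{u}} (T : (Δ[1] : SSet.{u}).Subcomplex)
    (he : stdSimplex.obj₀Equiv.{u}.symm e ∈ T.obj _) : X ⟶ X ⊗ (T : SSet.{u}) :=
  lift (𝟙 X) (const ⟨stdSimplex.obj₀Equiv.{u}.symm e, he⟩)

lemma subEndIncl_whiskerLeft_assoc (e : Fin 2) {X Z : SSet.{u}}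
    (T : (Δ[1] : SSet.{u}).Subcomplex) (he : stdSimplex.obj₀Equiv.{u}.symm e ∈ T.obj _)
    (g : X ⊗ Δ[1] ⟶ Z) : subEndIncl e T he ≫ X ◁ T.ι ≫ g = endIncl e ≫ g := rfl

lemma vertex_mem_horn_one (e : Fin 2) :
    stdSimplex.obj₀Equiv.{u}.symm e ∈ (horn.{u} 1 e).obj _ := by
  rw [mem_horn_iff]
  intro h
  obtain ⟨j, hj⟩ := exists_ne e
  rcases Set.eq_univ_iff_forall.1 h j with ⟨k, hk⟩ | hk
  exacts [hj hk.symm, hj hk]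

lemma vertex_mem_boundary_one (e : Fin 2) :
    stdSimplex.obj₀Equiv.{u}.symm e ∈ (boundary.{u} 1).obj _ := by
  intro h
  obtain ⟨j, hj⟩ := exists_ne e
  obtain ⟨k, hk⟩ := h j
  exact hj hk.symm

lemma asOrderHom_eq_of_mem_horn_one (e : Fin 2) {m : SimplexCategoryᵒᵖ}
    (d : (Δ[1] : SSet.{u}).obj m) (hd : d ∈ (horn 1 e).obj m) (k) :
    stdSimplex.asOrderHom d k = e := by
  by_contra hk
  refine (mem_horn_iff _ _).1 hd (Set.eq_univ_of_forall fun j => ?_)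
  by_cases hj : j = e
  · exact Or.inr hj
  · exact Or.inl ⟨k, by omega⟩

lemma asOrderHom_eq_of_mem_boundary_one {m : SimplexCategoryᵒᵖ}
    (d : (Δ[1] : SSet.{u}).obj m) (hd : d ∈ (boundary.{u} 1).obj m) (k l) :
    stdSimplex.asOrderHom d k = stdSimplex.asOrderHom d l := by
  by_contra hkl
  refine hd fun b => ?_
  by_cases hb : b = stdSimplex.asOrderHom d k
  exacts [⟨k, hb.symm⟩, ⟨l, by omega⟩]

lemma whiskerLeft_horn_one_ι_comp (e : Fin 2) {X Z : SSet.{u}} (g : X ⊗ Δ[1] ⟶ Z) :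
    X ◁ (horn.{u} 1 e).ι ≫ g = fst _ _ ≫ endIncl e ≫ g := by
  ext m ⟨x, d⟩
  exact congrArg (g.app m)
    (endIncl_app_eq_of_const e x d.1 (asOrderHom_eq_of_mem_horn_one e d.1 d.2)).symm

/-- The map on the two ends `X ⊗ ∂Δ[1]` of the cylinder which is `f e` on the end `e`. -/
noncomputable def boundaryDesc {X Z : SSet.{u}} (f : Fin 2 → (X ⟶ Z)) :
    X ⊗ (boundary.{u} 1 : SSet) ⟶ Z where
  app m := ↾fun x => (f (stdSimplex.asOrderHom x.2.1 0)).app m x.1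
  naturality m n θ := by
    ext ⟨x, d⟩
    have h : stdSimplex.asOrderHom ((boundary.{u} 1 : SSet).map θ d).1 0 =
      stdSimplex.asOrderHom d.1 0 := asOrderHom_eq_of_mem_boundary_one d.1 d.2 _ _
    exact (congrArg (fun e => (f e).app n (X.map θ x)) h).trans
      (NatTrans.naturality_apply (f (stdSimplex.asOrderHom d.1 0)) θ x)

lemma subEndIncl_boundaryDesc {X Z : SSet.{u}} (f : Fin 2 → (X ⟶ Z)) (e : Fin 2) :
    subEndIncl e _ (vertex_mem_boundary_one e) ≫ boundaryDesc f = f e := rfl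

lemma whiskerRight_boundaryDesc {W X Z : SSet.{u}} (g : W ⟶ X) (f : Fin 2 → (X ⟶ Z)) :
    g ▷ _ ≫ boundaryDesc f = boundaryDesc fun e => g ≫ f e := rfl

lemma boundaryDesc_comp {X Y Z : SSet.{u}} (f : Fin 2 → (X ⟶ Y)) (g : Y ⟶ Z) :
    boundaryDesc f ≫ g = boundaryDesc fun e => f e ≫ g := rfl

section Lifting

variable {X Y E S : SSet.{u}} {p : E ⟶ S} (hp : fibrations SSet p)

include hp

lemma exists_lift_of_anodyne_unionProd (A : X.Subcomplex) (T : Y.Subcomplex)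
    (hAT : anodyneExtensions (A.unionProd T).ι) (f : X ⊗ (T : SSet) ⟶ E) (g : (A : SSet) ⊗ Y ⟶ E)
    (b : X ⊗ Y ⟶ S) (hfg : A.ι ▷ _ ≫ f = _ ◁ T.ι ≫ g) (hf : f ≫ p = _ ◁ T.ι ≫ b)
    (hg : g ≫ p = A.ι ▷ _ ≫ b) :
    ∃ H : X ⊗ Y ⟶ E, _ ◁ T.ι ≫ H = f ∧ A.ι ▷ _ ≫ H = g ∧ H ≫ p = b := by
  have hpo := Subcomplex.unionProd.isPushout A T
  have sq : CommSq (hpo.desc f g hfg) (A.unionProd T).ι p b := ⟨by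
    apply hpo.hom_ext
    · rw [hpo.inl_desc_assoc, Subcomplex.unionProd.ι₁_ι_assoc, hf]
    · rw [hpo.inr_desc_assoc, Subcomplex.unionProd.ι₂_ι_assoc, hg]⟩
  have := hAT _ hp
  refine ⟨sq.lift, ?_, ?_, sq.fac_right⟩
  · rw [← Subcomplex.unionProd.ι₁_ι A T, Category.assoc, sq.fac_left, hpo.inl_desc]
  · rw [← Subcomplex.unionProd.ι₂_ι A T, Category.assoc, sq.fac_left, hpo.inr_desc]

lemma exists_homotopy_lift (e : Fin 2) (A : X.Subcomplex) (c : X ⟶ E)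
    (h : (A : SSet) ⊗ Δ[1] ⟶ E) (b : X ⊗ Δ[1] ⟶ S) (hc : endIncl e ≫ h = A.ι ≫ c)
    (hb : A.ι ▷ _ ≫ b = h ≫ p) (hcb : endIncl e ≫ b = c ≫ p) :
    ∃ H : X ⊗ Δ[1] ⟶ E, endIncl e ≫ H = c ∧ A.ι ▷ _ ≫ H = h ∧ H ≫ p = b := by
  obtain ⟨H, hHc, hHh, hHb⟩ := exists_lift_of_anodyne_unionProd hp A (horn.{u} 1 e)
    (anodyneExtensions_unionProd_ι A _ (anodyneExtensions.horn_ι e)) (fst _ _ ≫ c) h b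
    (by rw [whiskerLeft_horn_one_ι_comp, hc, whiskerRight_fst_assoc])
    (by rw [whiskerLeft_horn_one_ι_comp, hcb, Category.assoc]) hb.symm
  refine ⟨H, ?_, hHh, hHb⟩
  rw [← subEndIncl_whiskerLeft_assoc e _ (vertex_mem_horn_one e), hHc]
  rfl

lemma exists_homotopy_of_anodyne (A : X.Subcomplex) (hA : anodyneExtensions A.ι) (f g : X ⟶ E)
    (hfg : A.ι ≫ f = A.ι ≫ g) (hfgp : f ≫ p = g ≫ p) :
    ∃ h : X ⊗ Δ[1] ⟶ E, endIncl 0 ≫ h = f ∧ endIncl 1 ≫ h = g ∧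
      A.ι ▷ _ ≫ h = fst _ _ ≫ A.ι ≫ f ∧ h ≫ p = fst _ _ ≫ f ≫ p := by
  have hA' : ∀ e, A.ι ≫ ![f, g] e = A.ι ≫ f := Fin.forall_fin_two.2 ⟨rfl, hfg.symm⟩
  have hp' : ∀ e, ![f, g] e ≫ p = f ≫ p := Fin.forall_fin_two.2 ⟨rfl, hfgp.symm⟩
  obtain ⟨h, hends, hA, hb⟩ := exists_lift_of_anodyne_unionProd hp A (boundary.{u} 1)
    (anodyneExtensions_unionProd_ι' A _ hA) (boundaryDesc ![f, g]) (fst _ _ ≫ A.ι ≫ f)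
    (fst _ _ ≫ f ≫ p) (by simp only [whiskerRight_boundaryDesc, hA']; rfl)
    (by simp only [boundaryDesc_comp, hp']; rfl) rfl
  have hend (e : Fin 2) : endIncl e ≫ h = ![f, g] e := by
    rw [← subEndIncl_whiskerLeft_assoc e _ (vertex_mem_boundary_one e), hends,
      subEndIncl_boundaryDesc]
  exact ⟨h, hend 0, hend 1, hA, hb⟩

end Lifting

lemma anodyneExtensions_of_deformation (e e' : Fin 2) {X : SSet.{u}} (A : X.Subcomplex)
    (h : X ⊗ Δ[1] ⟶ X) (hA : (A : SSet) ⊗ Δ[1] ⟶ (A : SSet)) (r : X ⟶ (A : SSet))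
    (he : endIncl e ≫ h = r ≫ A.ι) (he' : endIncl e' ≫ h = 𝟙 X)
    (hhA : A.ι ▷ _ ≫ h = hA ≫ A.ι) : anodyneExtensions A.ι := by
  intro E S p hp
  refine ⟨fun {a b} sq => ?_⟩
  have hAe' : endIncl e' ≫ hA = 𝟙 _ := by
    rw [← cancel_mono A.ι, Category.assoc, ← hhA, endIncl_whiskerRight_assoc, he',
      Category.comp_id, Category.id_comp]
  have hAe : endIncl e ≫ hA = A.ι ≫ r := by
    rw [← cancel_mono A.ι, Category.assoc, ← hhA, endIncl_whiskerRight_assoc, he, Category.assoc]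
  obtain ⟨H, -, hHA, hHb⟩ := exists_homotopy_lift hp e A (r ≫ a) (hA ≫ a) (h ≫ b)
    (by rw [reassoc_of% hAe]) (by rw [reassoc_of% hhA, Category.assoc, sq.w])
    (by rw [reassoc_of% he, Category.assoc, sq.w])
  exact ⟨⟨⟨endIncl e' ≫ H,
    by rw [← endIncl_whiskerRight_assoc, hHA, reassoc_of% hAe'],
    by rw [Category.assoc, hHb, reassoc_of% he']⟩⟩⟩

/-- The homotopy exists because a lift for `P ⟶ X` and the given map on `Q` agree on `P`; moving
the lift along it makes it agree with the given map on all of `Q`. -/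
lemma anodyneExtensions_ι_of_comp {X : SSet.{u}} (Q : X.Subcomplex)
    (P : (Q : SSet).Subcomplex) (hP : anodyneExtensions P.ι)
    (hPQ : anodyneExtensions (P.ι ≫ Q.ι)) : anodyneExtensions Q.ι := by
  intro E S p hp
  refine ⟨fun {a b} sq => ?_⟩
  have := hPQ _ hp
  have sq' : CommSq (P.ι ≫ a) (P.ι ≫ Q.ι) p b := ⟨by rw [Category.assoc, sq.w, Category.assoc]⟩
  obtain ⟨h, h₀, h₁, -, hhp⟩ := exists_homotopy_of_anodyne hp P hP (Q.ι ≫ sq'.lift) a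
    (by rw [← Category.assoc, sq'.fac_left]) (by rw [Category.assoc, sq'.fac_right, sq.w])
  obtain ⟨H, -, hHQ, hHb⟩ := exists_homotopy_lift hp 0 Q sq'.lift h (fst _ _ ≫ b) h₀
    (by rw [hhp, Category.assoc, sq'.fac_right, whiskerRight_fst_assoc])
    (by rw [sq'.fac_right, endIncl_fst_assoc])
  exact ⟨⟨⟨endIncl 1 ≫ H,
    by rw [← endIncl_whiskerRight_assoc, hHQ, h₁],
    by rw [Category.assoc, hHb, endIncl_fst_assoc]⟩⟩⟩

lemma anodyneExtensions_of_comp {X Y Z : SSet.{u}} (i : X ⟶ Y) (k : Y ⟶ Z) [Mono i] [Mono k]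
    (hi : anodyneExtensions i) (hik : anodyneExtensions (i ≫ k)) : anodyneExtensions k := by
  let j := i ≫ Subcomplex.toRange k
  let P : (Subcomplex.range k : SSet).Subcomplex := Subcomplex.range j
  have hj : Subcomplex.toRange j ≫ P.ι = j := rfl
  have hP : anodyneExtensions P.ι := by
    rw [← MorphismProperty.cancel_left_of_respectsIso anodyneExtensions (Subcomplex.toRange j), hj,
      MorphismProperty.cancel_right_of_respectsIso anodyneExtensions]
    exact hi
  have hPk : anodyneExtensions (P.ι ≫ (Subcomplex.range k).ι) := by
    rw [← MorphismProperty.cancel_left_of_respectsIso anodyneExtensions (Subcomplex.toRange j),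
      reassoc_of% hj, Category.assoc, Subcomplex.toRange_ι]
    exact hik
  rw [← Subcomplex.toRange_ι k, MorphismProperty.cancel_left_of_respectsIso anodyneExtensions]
  exact anodyneExtensions_ι_of_comp _ _ hP hPk

end Anodyne

section Subcomplexes

open SSet HomotopicalAlgebra modelCategoryQuillen

variable {T : SSet.{u}}

/-- The subcomplex `P` is contained in `Q` and the inclusion is an anodyne extension. -/
def IsAnodyneInclusion (P Q : T.Subcomplex) : Prop :=
  ∃ h : P ≤ Q, anodyneExtensions (Subcomplex.homOfLE h)

lemma sup_inf_right_subcomplex (P Q R : T.Subcomplex) : (P ⊔ Q) ⊓ R = (P ⊓ R) ⊔ (Q ⊓ R) :=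
  Subfunctor.ext (funext fun _ => Set.union_inter_distrib_right _ _ _)

lemma isIso_toImage {T' : SSet.{u}} (f : T ⟶ T') [Mono f] (P : T.Subcomplex) :
    IsIso (P.toImage f) := by
  have : Mono (P.toImage f ≫ (P.image f).ι) := by
    rw [Subcomplex.toImage_ι]
    infer_instance
  have := mono_of_mono (P.toImage f) (P.image f).ι
  exact isIso_of_mono_of_epi _

namespace IsAnodyneInclusion

lemma refl (P : T.Subcomplex) : IsAnodyneInclusion P P :=
  ⟨le_rfl, MorphismProperty.id_mem anodyneExtensions _⟩

lemma trans {P Q R : T.Subcomplex} (hPQ : IsAnodyneInclusion P Q)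
    (hQR : IsAnodyneInclusion Q R) : IsAnodyneInclusion P R :=
  ⟨hPQ.1.trans hQR.1, MorphismProperty.comp_mem _ _ _ hPQ.2 hQR.2⟩

lemma cancel_left {P Q R : T.Subcomplex} (hPQ : IsAnodyneInclusion P Q)
    (hPR : IsAnodyneInclusion P R) (hQR : Q ≤ R) : IsAnodyneInclusion Q R :=
  ⟨hQR, anodyneExtensions_of_comp (Subcomplex.homOfLE hPQ.1) (Subcomplex.homOfLE hQR) hPQ.2 hPR.2⟩

lemma sup_of_inf {P Q : T.Subcomplex} (h : IsAnodyneInclusion (P ⊓ Q) Q) :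
    IsAnodyneInclusion P (P ⊔ Q) := by
  have sq : Subcomplex.BicartSq (P ⊓ Q) P Q (P ⊔ Q) := ⟨rfl, rfl⟩
  exact ⟨le_sup_left, MorphismProperty.of_isPushout (P := anodyneExtensions) sq.isPushout h.2⟩

lemma inf_sup {X A B : T.Subcomplex} (hA : IsAnodyneInclusion (X ⊓ A) A)
    (hB : IsAnodyneInclusion (X ⊓ B) B) (hAB : IsAnodyneInclusion (X ⊓ (A ⊓ B)) (A ⊓ B)) :
    IsAnodyneInclusion (X ⊓ (A ⊔ B)) (A ⊔ B) := by
  have hXA : IsAnodyneInclusion (X ⊓ (A ⊔ B)) (X ⊓ (A ⊔ B) ⊔ A) := by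
    refine sup_of_inf ?_
    rwa [inf_assoc, inf_eq_right.2 (le_sup_left : A ≤ A ⊔ B)]
  have hXB : IsAnodyneInclusion (X ⊓ B ⊔ A ⊓ B) B := by
    refine cancel_left (sup_of_inf ?_) hB (sup_le inf_le_right inf_le_right)
    rwa [inf_assoc, inf_eq_right.2 (inf_le_right : A ⊓ B ≤ B)]
  have hXAB : IsAnodyneInclusion (X ⊓ (A ⊔ B) ⊔ A) (X ⊓ (A ⊔ B) ⊔ A ⊔ B) := by
    refine sup_of_inf ?_
    rwa [sup_inf_right_subcomplex, inf_assoc, inf_eq_right.2 (le_sup_right : B ≤ A ⊔ B)]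
  have hsup : X ⊓ (A ⊔ B) ⊔ A ⊔ B = A ⊔ B := by rw [sup_assoc, sup_eq_right.2 inf_le_right]
  rw [hsup] at hXAB
  exact hXA.trans hXAB

lemma image {T' : SSet.{u}} (f : T ⟶ T') [Mono f] {P Q : T.Subcomplex}
    (h : IsAnodyneInclusion P Q) : IsAnodyneInclusion (P.image f) (Q.image f) := by
  have := isIso_toImage f P
  have := isIso_toImage f Q
  have hcomm : P.toImage f ≫ Subcomplex.homOfLE (Subcomplex.image_monotone f h.1) =
    Subcomplex.homOfLE h.1 ≫ Q.toImage f := rfl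
  refine ⟨Subcomplex.image_monotone f h.1, ?_⟩
  rw [← MorphismProperty.cancel_left_of_respectsIso anodyneExtensions (P.toImage f), hcomm,
    MorphismProperty.cancel_right_of_respectsIso anodyneExtensions]
  exact h.2

end IsAnodyneInclusion

lemma isAnodyneInclusion_top_iff (P : T.Subcomplex) :
    IsAnodyneInclusion P ⊤ ↔ anodyneExtensions P.ι := by
  have h : Subcomplex.homOfLE (le_top : P ≤ ⊤) ≫ (Subcomplex.topIso T).hom = P.ι := rfl
  rw [← h, MorphismProperty.cancel_right_of_respectsIso anodyneExtensions]
  exact ⟨fun h => h.2, fun h => ⟨le_top, h⟩⟩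

lemma isPushout_sup_range {N : SSet.{u}} (c : N ⟶ T) (F : T.Subcomplex)
    (hc : ∀ n (x y : N.obj n), c.app n x ∉ F.obj n → c.app n x = c.app n y → x = y) :
    IsPushout (F.fromPreimage c) (F.preimage c).ι
      (Subcomplex.homOfLE (le_sup_left : F ≤ F ⊔ Subcomplex.range c))
      (Subcomplex.lift c (le_sup_right : Subcomplex.range c ≤ F ⊔ Subcomplex.range c)) where
  w := rfl
  isColimit' := ⟨Limits.evaluationJointlyReflectsColimits _ (fun n ↦ by
    refine (Limits.isColimitMapCoconePushoutCoconeEquiv _ _).2 (IsPushout.isColimit ?_)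
    have hm : Mono (((CategoryTheory.evaluation _ _).obj n).map
        (Subcomplex.homOfLE (le_sup_left : F ≤ F ⊔ Subcomplex.range c))) := by
      rw [mono_iff_injective]
      intro x y h
      exact Subtype.ext (Subtype.ext_iff.1 h :)
    refine Limits.Types.isPushout_of_isPullback_of_mono' ?_ ?_ ?_
    · rw [Limits.Types.isPullback_iff]
      refine ⟨rfl, fun x y h => Subtype.ext h.2, fun x y h => ?_⟩
      have hxy : x.1 = c.app n y := congrArg Subtype.val h
      have hy : c.app n y ∈ F.obj n := hxy ▸ x.2
      exact ⟨⟨y, hy⟩, Subtype.ext hxy.symm, rfl⟩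
    · refine Set.eq_univ_of_forall fun x => ?_
      rcases x.2 with h | ⟨y, h⟩
      · exact Or.inl ⟨⟨x.1, h⟩, rfl⟩
      · exact Or.inr ⟨y, Subtype.ext h⟩
    · intro x y hx _ h
      exact hc n x y (fun hF => hx ⟨⟨x, hF⟩, rfl⟩) (congrArg Subtype.val h))⟩

lemma isAnodyneInclusion_sup_range {N : SSet.{u}} (c : N ⟶ T) (F : T.Subcomplex)
    (hc : ∀ n (x y : N.obj n), c.app n x ∉ F.obj n → c.app n x = c.app n y → x = y)
    (h : anodyneExtensions (F.preimage c).ι) : IsAnodyneInclusion F (F ⊔ Subcomplex.range c) :=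
  ⟨le_sup_left, MorphismProperty.of_isPushout (isPushout_sup_range c F hc) h⟩

end Subcomplexes

section Latching

open SSet Simplicial

variable (M : SimplicialObject SSet.{u})

/-- The simplicial set formed by the `n`-simplices of the rows of a bisimplicial set. -/
abbrev columnSSet (n : SimplexCategoryᵒᵖ) : SSet.{u} :=
  M ⋙ (CategoryTheory.evaluation SimplexCategoryᵒᵖ (Type u)).obj n

/-- The subcomplex of `M _⦋n + 1⦌` generated by the degeneracies with index less than `k`; these
interpolate between the empty subcomplex and the latching subcomplex. -/
def degeneracySup (n k : ℕ) : (M _⦋n + 1⦌).Subcomplex :=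
  ⨆ (i : Fin (n + 1)) (_ : i.1 < k), Subcomplex.range (M.σ i)

/-- The latching subcomplex of `M _⦋m⦌`, formed by the simplices that are degenerate in the
simplicial direction of `M`. -/
def latching (m : ℕ) : (M _⦋m⦌).Subcomplex where
  obj n := (columnSSet M n).degenerate m
  map {n n'} g := by
    rintro _ ⟨k, hk, f, z, rfl⟩
    exact ⟨k, hk, f, (M _⦋k⦌).map g z, ConcreteCategory.congr_hom ((M.map f.op).naturality g) z⟩

variable {M}

lemma map_comp_app_apply {a b c : SimplexCategoryᵒᵖ} (f : a ⟶ b) (g : b ⟶ c)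
    {m : SimplexCategoryᵒᵖ} (x : (M.obj a).obj m) :
    (M.map (f ≫ g)).app m x = (M.map g).app m ((M.map f).app m x) :=
  ConcreteCategory.congr_hom (NatTrans.congr_app (M.map_comp f g) m) x

lemma mem_degeneracySup {n k : ℕ} {m : SimplexCategoryᵒᵖ} {x : (M _⦋n + 1⦌).obj m} :
    x ∈ (degeneracySup M n k).obj m ↔ ∃ i : Fin (n + 1), i.1 < k ∧ ∃ y, (M.σ i).app m y = x := by
  simp [degeneracySup]

lemma degeneracySup_zero (n : ℕ) : degeneracySup M n 0 = ⊥ := by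
  simp [degeneracySup]

lemma degeneracySup_succ (n k : ℕ) (hk : k < n + 1) :
    degeneracySup M n (k + 1) = degeneracySup M n k ⊔ Subcomplex.range (M.σ ⟨k, hk⟩) := by
  refine Subfunctor.ext (funext fun m => Set.ext fun x => ?_)
  refine mem_degeneracySup.trans ⟨?_, ?_⟩
  · rintro ⟨i, hi, y, rfl⟩
    rcases Nat.lt_succ_iff_lt_or_eq.1 hi with hi | rfl
    · exact Or.inl (mem_degeneracySup.2 ⟨i, hi, y, rfl⟩)
    · exact Or.inr ⟨y, rfl⟩
  · rintro (h | ⟨y, rfl⟩)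
    · obtain ⟨i, hi, y, rfl⟩ := mem_degeneracySup.1 h
      exact ⟨i, by omega, y, rfl⟩
    · exact ⟨_, by simp, y, rfl⟩

lemma degeneracySup_of_le (n k : ℕ) (hk : n + 1 ≤ k) :
    degeneracySup M n (k + 1) = degeneracySup M n k := by
  refine Subfunctor.ext (funext fun m => Set.ext fun x => ?_)
  refine mem_degeneracySup.trans (Iff.trans ?_ mem_degeneracySup.symm)
  exact exists_congr fun i => and_congr_left fun _ => by omega

lemma latching_zero : latching M 0 = ⊥ := by
  refine Subfunctor.ext (funext fun n => Set.ext fun x => ⟨?_, False.elim⟩)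
  rintro ⟨k, hk, _⟩
  omega

lemma latching_succ (m : ℕ) : latching M (m + 1) = degeneracySup M m (m + 1) := by
  refine Subfunctor.ext (funext fun n => Set.ext fun x => ?_)
  have hx := Set.ext_iff.1 ((columnSSet M n).degenerate_eq_iUnion_range_σ (n := m)) x
  rw [mem_degeneracySup]
  refine (hx.trans Set.mem_iUnion).trans (exists_congr fun i => ?_)
  exact ⟨fun ⟨y, hy⟩ => ⟨i.2, y, hy⟩, fun ⟨_, y, hy⟩ => ⟨y, hy⟩⟩

lemma δ_succ_app_σ_app {n : ℕ} (i : Fin (n + 1)) {m : SimplexCategoryᵒᵖ}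
    (x : (M _⦋n⦌).obj m) : (M.δ i.succ).app m ((M.σ i).app m x) = x :=
  ConcreteCategory.congr_hom (NatTrans.congr_app (M.δ_comp_σ_succ (i := i)) m) x

instance mono_σ {n : ℕ} (i : Fin (n + 1)) : Mono (M.σ i) := by
  have : Mono (M.σ i ≫ M.δ i.succ) := by
    rw [M.δ_comp_σ_succ]
    infer_instance
  exact mono_of_mono _ (M.δ i.succ)

lemma degeneracySup_inf_range (n k : ℕ) (hk : k < n + 2) :
    degeneracySup M (n + 1) k ⊓ Subcomplex.range (M.σ ⟨k, hk⟩) =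
      (degeneracySup M n k).image (M.σ ⟨k, hk⟩) := by
  refine Subfunctor.ext (funext fun m => Set.ext fun x => ⟨?_, ?_⟩)
  · rintro ⟨h, b, rfl⟩
    obtain ⟨i, hi, a, ha⟩ := mem_degeneracySup.1 h
    refine ⟨b, mem_degeneracySup.2 ⟨⟨i, by omega⟩, hi, (M.δ ⟨k, hk⟩).app m a, ?_⟩, rfl⟩
    have hδσ := ConcreteCategory.congr_hom (NatTrans.congr_app
      (M.δ_comp_σ_of_gt (i := ⟨k, hk⟩) (j := ⟨i, by omega⟩) hi) m) a
    exact hδσ.symm.trans ((congrArg ((M.δ (Fin.succ ⟨k, hk⟩)).app m) ha).trans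
      (δ_succ_app_σ_app ⟨k, hk⟩ b))
  · rintro ⟨b, h, rfl⟩
    obtain ⟨i, hi, a, rfl⟩ := mem_degeneracySup.1 h
    refine ⟨mem_degeneracySup.2 ⟨i.castSucc, hi, (M.σ ⟨k - 1, by omega⟩).app m a, ?_⟩, _, rfl⟩
    have hle : i ≤ ⟨k - 1, by omega⟩ := by
      rw [Fin.le_def]
      exact Nat.le_sub_one_of_lt hi
    have hk' : Fin.succ ⟨k - 1, by omega⟩ = (⟨k, hk⟩ : Fin (n + 2)) :=
      Fin.ext (Nat.sub_add_cancel (Nat.one_le_of_lt hi))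
    have hσσ := ConcreteCategory.congr_hom (NatTrans.congr_app (M.σ_comp_σ hle) m) a
    rwa [hk'] at hσσ

end Latching

/-- A bisimplicial subset of `M`, given by its rows. -/
structure BisimplicialSubset (M : SimplicialObject SSet.{u}) where
  row (n : SimplexCategoryᵒᵖ) : (M.obj n).Subcomplex
  row_le_preimage {m n : SimplexCategoryᵒᵖ} (f : m ⟶ n) : row m ≤ (row n).preimage (M.map f)

namespace BisimplicialSubset

open SSet Simplicial HomotopicalAlgebra modelCategoryQuillen CartesianMonoidalCategory

variable {M : SimplicialObject SSet.{u}} (A : BisimplicialSubset M)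

section Rows

lemma row_inf_image_σ {n : ℕ} (i : Fin (n + 1)) (P : (M _⦋n⦌).Subcomplex) :
    A.row (op ⦋n + 1⦌) ⊓ P.image (M.σ i) = (A.row (op ⦋n⦌) ⊓ P).image (M.σ i) := by
  refine Subfunctor.ext (funext fun m => Set.ext fun x => ⟨?_, ?_⟩)
  · rintro ⟨h, b, hb, rfl⟩
    have hδ := A.row_le_preimage (SimplexCategory.δ i.succ).op m h
    exact ⟨b, ⟨(Set.mem_of_eq_of_mem (δ_succ_app_σ_app i b).symm hδ :), hb⟩, rfl⟩
  · rintro ⟨b, ⟨h, hb⟩, rfl⟩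
    exact ⟨A.row_le_preimage (SimplexCategory.σ i).op m h, b, hb, rfl⟩

variable (hA : ∀ n, IsAnodyneInclusion (A.row n) ⊤)

include hA

lemma isAnodyneInclusion_inf_degeneracySup (n k : ℕ) :
    IsAnodyneInclusion (A.row (op ⦋n + 1⦌) ⊓ degeneracySup M n k) (degeneracySup M n k) := by
  induction k generalizing n with
  | zero =>
    rw [degeneracySup_zero, inf_bot_eq]
    exact .refl _
  | succ k ih =>
    rcases Nat.lt_or_ge k (n + 1) with hk | hk
    · rw [degeneracySup_succ _ _ hk]
      refine .inf_sup (ih n) ?_ ?_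
      · rw [← Subcomplex.image_top, row_inf_image_σ, inf_top_eq]
        exact (hA _).image _
      · cases n with
        | zero =>
          obtain rfl : k = 0 := by omega
          rw [degeneracySup_zero, bot_inf_eq, inf_bot_eq]
          exact .refl _
        | succ n =>
          rw [degeneracySup_inf_range, row_inf_image_σ]
          exact (ih n).image _
    · rw [degeneracySup_of_le _ _ hk]
      exact ih n

lemma isAnodyneInclusion_sup_latching (m : ℕ) :
    IsAnodyneInclusion (A.row (op ⦋m⦌) ⊔ latching M m) ⊤ := by
  cases m with
  | zero =>
    rw [latching_zero, sup_bot_eq]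
    exact hA _
  | succ m =>
    rw [latching_succ]
    exact .cancel_left (.sup_of_inf (A.isAnodyneInclusion_inf_degeneracySup hA m (m + 1))) (hA _)
      le_top

end Rows

/-- The filtration of the diagonal of `M` by the simplices that lie in `A` or come from the rows
with index less than `m`. -/
def diagonalFiltration (m : ℕ) : (diagonal.obj M).Subcomplex where
  obj n := {x | x ∈ (A.row n).obj n ∨ ∃ k, k < m ∧ ∃ (f : n.unop ⟶ ⦋k⦌) (y : (M _⦋k⦌).obj n),
    (M.map f.op).app n y = x}
  map {n n'} g := by
    rintro x (h | ⟨k, hk, f, y, rfl⟩)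
    · exact Or.inl (A.row_le_preimage g _ ((A.row n).map g h))
    · exact Or.inr ⟨k, hk, g.unop ≫ f, (M _⦋k⦌).map g y, (map_comp_app_apply f.op g _).trans
        (congrArg ((M.map g).app n') (ConcreteCategory.congr_hom ((M.map f.op).naturality g) y))⟩

variable (M) in
/-- The map `M _⦋m⦌ ⊗ Δ[m] ⟶ diagonal.obj M` that sends `(y, θ)` to `θ^* y`. -/
def diagonalCell (m : ℕ) : (M _⦋m⦌) ⊗ Δ[m] ⟶ diagonal.obj M where
  app n := ↾fun z => (M.map (stdSimplex.objEquiv z.2).op).app n z.1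
  naturality n n' g := by
    ext ⟨y, θ⟩
    obtain ⟨θ, rfl⟩ := stdSimplex.objEquiv.symm.surjective θ
    exact (map_comp_app_apply θ.op g _).trans
      (congrArg ((M.map g).app n') (ConcreteCategory.congr_hom ((M.map θ.op).naturality g) y))

lemma diagonalCell_app {m : ℕ} {n : SimplexCategoryᵒᵖ} (y : (M _⦋m⦌).obj n) (θ : n.unop ⟶ ⦋m⦌) :
    (diagonalCell M m).app n (y, stdSimplex.objEquiv.symm θ) = (M.map θ.op).app n y := rfl

lemma diagonalFiltration_zero_obj (n : SimplexCategoryᵒᵖ) :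
    (A.diagonalFiltration 0).obj n = (A.row n).obj n :=
  Set.ext fun _ => ⟨fun h => h.resolve_right fun ⟨_, hk, _⟩ => Nat.not_lt_zero _ hk, Or.inl⟩

lemma diagonalFiltration_succ (m : ℕ) :
    A.diagonalFiltration (m + 1) =
      A.diagonalFiltration m ⊔ Subcomplex.range (diagonalCell M m) := by
  refine Subfunctor.ext (funext fun n => Set.ext fun x => ⟨?_, ?_⟩)
  · rintro (h | ⟨k, hk, f, y, rfl⟩)
    · exact Or.inl (Or.inl h)
    · rcases Nat.lt_succ_iff_lt_or_eq.1 hk with hk | rfl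
      · exact Or.inl (Or.inr ⟨k, hk, f, y, rfl⟩)
      · exact Or.inr ⟨(y, stdSimplex.objEquiv.symm f), rfl⟩
  · rintro ((h | ⟨k, hk, f, y, rfl⟩) | ⟨⟨y, f⟩, rfl⟩)
    · exact Or.inl h
    · exact Or.inr ⟨k, by omega, f, y, rfl⟩
    · exact Or.inr ⟨m, by omega, stdSimplex.objEquiv f, y, rfl⟩

lemma diagonalFiltration_monotone : Monotone A.diagonalFiltration := by
  intro m m' h n x
  rintro (hx | ⟨k, hk, f, y, rfl⟩)
  · exact Or.inl hx
  · exact Or.inr ⟨k, by omega, f, y, rfl⟩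

lemma iSup_diagonalFiltration : ⨆ m, A.diagonalFiltration m = ⊤ := by
  refine Subfunctor.ext (funext fun n => Set.eq_univ_of_forall fun x => ?_)
  simp only [Subfunctor.iSup_obj, Set.mem_iUnion]
  exact ⟨n.unop.len + 1, Or.inr ⟨n.unop.len, by omega, 𝟙 _, x,
    ConcreteCategory.congr_hom (NatTrans.congr_app (M.map_id n) n) x⟩⟩

lemma mem_diagonalFiltration_of_not_surjective {m : ℕ} {n : SimplexCategoryᵒᵖ}
    (y : (M _⦋m⦌).obj n) (θ : n.unop ⟶ ⦋m⦌) (hθ : ¬ Function.Surjective θ.toOrderHom) :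
    (M.map θ.op).app n y ∈ (A.diagonalFiltration m).obj n := by
  cases m with
  | zero => exact (hθ fun j => ⟨0, Subsingleton.elim (α := Fin 1) _ _⟩).elim
  | succ m =>
    obtain ⟨i, θ', rfl⟩ := SimplexCategory.eq_comp_δ_of_not_surjective θ hθ
    exact Or.inr ⟨m, by omega, θ', (M.δ i).app n y,
      (map_comp_app_apply (SimplexCategory.δ i).op θ'.op y).symm⟩

lemma mem_diagonalFiltration_of_mem_latching {m : ℕ} {n : SimplexCategoryᵒᵖ}
    (y : (M _⦋m⦌).obj n) (θ : n.unop ⟶ ⦋m⦌) (hy : y ∈ (latching M m).obj n) :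
    (M.map θ.op).app n y ∈ (A.diagonalFiltration m).obj n := by
  obtain ⟨k, hk, f, z, rfl⟩ := hy
  exact Or.inr ⟨k, hk, θ ≫ f, z, map_comp_app_apply f.op θ.op z⟩

/-- A section of `θ` recovers `y` from `θ^* y`. -/
lemma mem_row_or_mem_latching_of_epi {m : ℕ} {n : SimplexCategoryᵒᵖ} (y : (M _⦋m⦌).obj n)
    (θ : n.unop ⟶ ⦋m⦌) [Epi θ] (hy : (M.map θ.op).app n y ∈ (A.diagonalFiltration m).obj n) :
    y ∈ (A.row (op ⦋m⦌)).obj n ∨ y ∈ (latching M m).obj n := by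
  have := isSplitEpi_of_epi θ
  have hsection : (M.map (section_ θ).op).app n ((M.map θ.op).app n y) = y := by
    have hid : M.map (θ.op ≫ (section_ θ).op) = 𝟙 _ := by
      rw [← op_comp, IsSplitEpi.id]
      exact M.map_id _
    exact (map_comp_app_apply _ _ y).symm.trans
      (ConcreteCategory.congr_hom (NatTrans.congr_app hid n) y)
  rcases hy with h | ⟨k, hk, f, z, h⟩
  · exact Or.inl (Set.mem_of_eq_of_mem hsection.symm (A.row_le_preimage (section_ θ).op n h) :)
  · exact Or.inr ⟨k, hk, section_ θ ≫ f, z, (map_comp_app_apply f.op (section_ θ).op z).trans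
      ((congrArg ((M.map (section_ θ).op).app n) h).trans hsection)⟩

lemma preimage_diagonalCell (m : ℕ) :
    (A.diagonalFiltration m).preimage (diagonalCell M m) =
      (A.row (op ⦋m⦌) ⊔ latching M m).unionProd (boundary m) := by
  refine Subfunctor.ext (funext fun n => Set.ext fun ⟨y, θ⟩ => ?_)
  obtain ⟨θ, rfl⟩ := stdSimplex.objEquiv.symm.surjective θ
  have hmem : ((y, stdSimplex.objEquiv.symm θ) : ((M _⦋m⦌) ⊗ Δ[m] : SSet.{u}).obj n) ∈
      ((A.row (op ⦋m⦌) ⊔ latching M m).unionProd (boundary m)).obj n ↔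
      ¬ Function.Surjective θ.toOrderHom ∨ (y ∈ (A.row (op ⦋m⦌)).obj n ∨
        y ∈ (latching M m).obj n) :=
    Subcomplex.mem_unionProd_iff _ _ _
  refine Iff.trans ⟨fun h => ?_, ?_⟩ hmem.symm
  · by_cases hθ : Function.Surjective θ.toOrderHom
    · have : Epi θ := SimplexCategory.epi_iff_surjective.2 hθ
      exact Or.inr (A.mem_row_or_mem_latching_of_epi y θ h)
    · exact Or.inl hθ
  · rintro (h | h | h)
    · exact A.mem_diagonalFiltration_of_not_surjective y θ h
    · exact Or.inl (A.row_le_preimage θ.op n h)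
    · exact A.mem_diagonalFiltration_of_mem_latching y θ h

lemma eq_of_diagonalCell_app_eq (m : ℕ) (n : SimplexCategoryᵒᵖ) (x y : ((M _⦋m⦌) ⊗ Δ[m]).obj n)
    (hx : (diagonalCell M m).app n x ∉ (A.diagonalFiltration m).obj n)
    (hxy : (diagonalCell M m).app n x = (diagonalCell M m).app n y) : x = y := by
  obtain ⟨y₁, θ₁⟩ := x
  obtain ⟨y₂, θ₂⟩ := y
  obtain ⟨θ₁, rfl⟩ := stdSimplex.objEquiv.symm.surjective θ₁
  obtain ⟨θ₂, rfl⟩ := stdSimplex.objEquiv.symm.surjective θ₂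
  have hy := hx
  rw [hxy] at hy
  rw [diagonalCell_app] at hx hy hxy
  have : Epi θ₁ := SimplexCategory.epi_iff_surjective.2
    (by_contra fun h => hx (A.mem_diagonalFiltration_of_not_surjective y₁ θ₁ h))
  have hy₁ : y₁ ∈ (columnSSet M n).nonDegenerate m :=
    fun h => hx (A.mem_diagonalFiltration_of_mem_latching y₁ θ₁ h)
  have hy₂ : y₂ ∈ (columnSSet M n).nonDegenerate m :=
    fun h => hy (A.mem_diagonalFiltration_of_mem_latching y₂ θ₂ h)
  have hyy := (columnSSet M n).unique_nonDegenerate_simplex (n := n.unop.len) _ θ₁ ⟨y₁, hy₁⟩ rfl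
    θ₂ ⟨y₂, hy₂⟩ hxy
  obtain rfl := (columnSSet M n).unique_nonDegenerate_map (n := n.unop.len) _ θ₁ ⟨y₁, hy₁⟩ rfl
    θ₂ ⟨y₂, hy₂⟩ hxy
  exact Prod.ext (congrArg Subtype.val hyy) rfl

section Anodyne

variable (hA : ∀ n, IsAnodyneInclusion (A.row n) ⊤)

include hA

lemma isAnodyneInclusion_diagonalFiltration_succ (m : ℕ) :
    IsAnodyneInclusion (A.diagonalFiltration m) (A.diagonalFiltration (m + 1)) := by
  rw [diagonalFiltration_succ]
  refine isAnodyneInclusion_sup_range _ _ (A.eq_of_diagonalCell_app_eq m) ?_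
  rw [preimage_diagonalCell]
  exact anodyneExtensions_unionProd_ι' _ _ ((isAnodyneInclusion_top_iff _).1
    (A.isAnodyneInclusion_sup_latching hA m))

lemma anodyneExtensions_diagonalFiltration_zero :
    anodyneExtensions (A.diagonalFiltration 0).ι := by
  let t : anodyneExtensions.{u}.TransfiniteCompositionOfShape ℕ (A.diagonalFiltration 0).ι :=
    { F := A.diagonalFiltration_monotone.functor ⋙ Subcomplex.toSSetFunctor
      isoBot := Iso.refl _
      incl := { app := fun _ => Subcomplex.ι _ }
      isColimit := Limits.IsColimit.ofIsoColimit
        (Limits.isColimitOfPreserves Subcomplex.toSSetFunctor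
          (Limits.CompleteLattice.colimitCocone
            A.diagonalFiltration_monotone.functor).isColimit)
        (Limits.Cocone.ext (Subcomplex.eqToIso A.iSup_diagonalFiltration ≪≫
          Subcomplex.topIso _))
      map_mem := fun m _ => (A.isAnodyneInclusion_diagonalFiltration_succ hA m).2 }
  exact anodyneExtensions.transfiniteCompositionsOfShape_le ℕ _ t.mem

end Anodyne

/-- The image of a map of bisimplicial sets. -/
def range {X : SimplicialObject SSet.{u}} (j : X ⟶ M) : BisimplicialSubset M where
  row n := Subcomplex.range (j.app n)
  row_le_preimage f k := by
    rintro _ ⟨x, rfl⟩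
    exact ⟨(X.map f).app k x,
      ConcreteCategory.congr_hom (NatTrans.congr_app (j.naturality f) k) x⟩

lemma diagonalFiltration_range_zero {X : SimplicialObject SSet.{u}} (j : X ⟶ M) :
    (range j).diagonalFiltration 0 = Subcomplex.range (diagonal.map j) :=
  Subfunctor.ext (funext fun n => (range j).diagonalFiltration_zero_obj n)

end BisimplicialSubset

open SSet modelCategoryQuillen in
lemma anodyneExtensions_diagonal_map {X M : SimplicialObject SSet.{u}} (j : X ⟶ M)
    [∀ n, Mono (j.app n)] (hj : ∀ n, anodyneExtensions (j.app n)) :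
    anodyneExtensions (diagonal.map j) := by
  have hrow (n) : IsAnodyneInclusion ((BisimplicialSubset.range j).row n) ⊤ := by
    rw [isAnodyneInclusion_top_iff]
    change anodyneExtensions (Subcomplex.range (j.app n)).ι
    rw [← MorphismProperty.cancel_left_of_respectsIso anodyneExtensions
      (Subcomplex.toRange (j.app n))]
    exact hj n
  have hm : Mono (diagonal.map j) := by
    rw [NatTrans.mono_iff_mono_app]
    exact fun n => inferInstanceAs (Mono ((j.app n).app n))
  have h := (BisimplicialSubset.range j).anodyneExtensions_diagonalFiltration_zero hrow
  rw [BisimplicialSubset.diagonalFiltration_range_zero] at h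
  rwa [← Subcomplex.toRange_ι (diagonal.map j),
    MorphismProperty.cancel_left_of_respectsIso anodyneExtensions]

section HomotopyLifting

lemma exists_monotone_retraction {α : Type*} [LinearOrder α] (S : Finset α) (hS : S.Nonempty) :
    ∃ e : α →o α, (∀ l ∈ S, e l = l) ∧ ∀ l, e l ∈ S := by
  refine ⟨⟨fun l => S.sup' hS fun s => if s ≤ l then s else S.min' hS, fun l l' hll' => ?_⟩,
    fun l hl => ?_, fun l => ?_⟩
  · refine Finset.sup'_mono_fun fun s hs => ?_
    by_cases hsl : s ≤ l
    · simp [hsl, hsl.trans hll']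
    · by_cases hsl' : s ≤ l'
      · simpa [hsl, hsl'] using S.min'_le s hs
      · simp [hsl, hsl']
  · refine le_antisymm (Finset.sup'_le hS _ fun s _ => ?_) ?_
    · by_cases hsl : s ≤ l
      · simp [hsl]
      · simpa [hsl] using S.min'_le l hl
    · exact (by simp : l ≤ if l ≤ l then l else S.min' hS).trans
        (Finset.le_sup' (fun s => if s ≤ l then s else S.min' hS) hl)
  · obtain ⟨s, hs, hsup⟩ := Finset.exists_mem_eq_sup' hS fun s => if s ≤ l then s else S.min' hS
    change S.sup' hS (fun s => if s ≤ l then s else S.min' hS) ∈ S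
    rw [hsup]
    split_ifs
    · exact hs
    · exact S.min'_mem hS

lemma stdSimplex_map_eq_self {ι : Type*} [Fintype ι] (e : ι → ι) (x : stdSimplex ℝ ι)
    (hfix : ∀ l, x l ≠ 0 → e l = l) : stdSimplex.map e x = x := by
  classical
  ext l
  rw [stdSimplex.map_coe, FunOnFinite.linearMap_apply_apply]
  have vanish : ∀ k ∈ Finset.univ.filter (fun k => e k = l), k ≠ l → x k = 0 := fun k hk hkl => by
    by_contra hxk
    exact hkl ((hfix k hxk).symm.trans (Finset.mem_filter.1 hk).2)
  by_cases hl : e l = l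
  · rw [Finset.sum_eq_single_of_mem l (by simp [hl]) vanish]
  · rw [show x l = 0 from by_contra fun hxl => hl (hfix l hxl)]
    refine Finset.sum_eq_zero fun k hk => vanish k hk ?_
    rintro rfl
    exact hl (Finset.mem_filter.1 hk).2

lemma stdSimplex_map_apply_eq_zero {ι κ : Type*} [Fintype ι] [Fintype κ] (f : ι → κ)
    (x : stdSimplex ℝ ι) (j : κ) (hj : ∀ l, f l ≠ j) : stdSimplex.map f x j = 0 := by
  classical
  rw [stdSimplex.map_coe, FunOnFinite.linearMap_apply_apply]
  exact Finset.sum_eq_zero fun k hk => (hj k (Finset.mem_filter.1 hk).2).elim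

section Slide

variable {ι : Type*} [Fintype ι] [DecidableEq ι] [Nontrivial ι] (i : ι)

/-- The least of the barycentric coordinates other than the `i`-th one. -/
noncomputable def minCoord (x : stdSimplex ℝ ι) : ℝ :=
  (Finset.univ.erase i).inf' Finset.univ_nontrivial.erase_nonempty fun j => x j

lemma continuous_minCoord : Continuous (minCoord i) :=
  Continuous.finset_inf'_apply _ fun j _ => (continuous_apply j).comp continuous_subtype_val

lemma minCoord_le (x : stdSimplex ℝ ι) {j : ι} (hj : j ≠ i) : minCoord i x ≤ x j :=
  Finset.inf'_le _ (by simp [hj])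

lemma exists_minCoord_eq (x : stdSimplex ℝ ι) : ∃ j, j ≠ i ∧ minCoord i x = x j := by
  obtain ⟨j, hj, hjx⟩ :=
    Finset.exists_mem_eq_inf' (Finset.univ_nontrivial.erase_nonempty (a := i)) fun j => x j
  exact ⟨j, (Finset.mem_erase.1 hj).1, hjx⟩

lemma minCoord_mem_unitInterval (x : stdSimplex ℝ ι) : minCoord i x ∈ unitInterval := by
  obtain ⟨j, -, hj⟩ := exists_minCoord_eq i x
  exact hj ▸ ⟨stdSimplex.zero_le x j, stdSimplex.le_one x j⟩

lemma minCoord_eq_zero {x : stdSimplex ℝ ι} {j : ι} (hj : j ≠ i) (hx : x j = 0) :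
    minCoord i x = 0 :=
  le_antisymm ((minCoord_le i x hj).trans hx.le) (minCoord_mem_unitInterval i x).1

/-- Move a point of the simplex towards the `i`-th vertex by decreasing all the other coordinates
by `c`, stopping when a face that contains this vertex is reached. -/
noncomputable def slide (x : stdSimplex ℝ ι) (c : ℝ) : stdSimplex ℝ ι :=
  ⟨fun j => x j +
      max 0 (min c (minCoord i x)) * if j = i then (Fintype.card ι - 1 : ℝ) else -1, by
    have slide_nonneg : 0 ≤ max 0 (min c (minCoord i x)) := le_max_left _ _
    constructor
    · intro j
      dsimp only
      split_ifs with hj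
      · have card_pos : (1 : ℝ) ≤ Fintype.card ι := by exact_mod_cast Fintype.card_pos (α := ι)
        exact add_nonneg (stdSimplex.zero_le x j) (mul_nonneg slide_nonneg (by linarith))
      · have : max 0 (min c (minCoord i x)) ≤ x j :=
          max_le (stdSimplex.zero_le x j) ((min_le_right _ _).trans (minCoord_le i x hj))
        linarith
    · have sum_eq_zero : ∑ j : ι, (if j = i then (Fintype.card ι - 1 : ℝ) else -1) = 0 := by
        rw [Finset.sum_ite, Finset.filter_eq' Finset.univ i, Finset.filter_ne' Finset.univ i]
        simp [Nat.cast_pred (R := ℝ) (Fintype.card_pos (α := ι))]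
      rw [Finset.sum_add_distrib, ← Finset.mul_sum, sum_eq_zero, mul_zero, add_zero]
      exact x.2.2⟩

lemma slide_apply (x : stdSimplex ℝ ι) (c : ℝ) (j : ι) :
    slide i x c j = x j +
      max 0 (min c (minCoord i x)) * if j = i then (Fintype.card ι - 1 : ℝ) else -1 := rfl

lemma continuous_slide : Continuous fun z : stdSimplex ℝ ι × ℝ => slide i z.1 z.2 := by
  refine Continuous.subtype_mk (continuous_pi fun j => ?_) _
  have continuous_coord : Continuous fun z : stdSimplex ℝ ι × ℝ => z.1 j :=
    (continuous_apply j).comp (continuous_subtype_val.comp continuous_fst)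
  have continuous_min : Continuous fun z : stdSimplex ℝ ι × ℝ => minCoord i z.1 :=
    (continuous_minCoord i).comp continuous_fst
  exact continuous_coord.add
    ((continuous_const.max (continuous_snd.min continuous_min)).mul continuous_const)

lemma slide_zero (x : stdSimplex ℝ ι) : slide i x 0 = x := by
  ext j
  rw [slide_apply, max_eq_left (min_le_left _ _), zero_mul, add_zero]

/-- The retraction of a simplex onto its horn consisting of the faces that contain the `i`-th
vertex. -/
noncomputable def hornRetraction : C(stdSimplex ℝ ι, stdSimplex ℝ ι) :=
  ⟨fun x => slide i x (minCoord i x),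
    (continuous_slide i).comp (continuous_id.prodMk (continuous_minCoord i))⟩

lemma exists_hornRetraction_apply_eq_zero (x : stdSimplex ℝ ι) :
    ∃ j, j ≠ i ∧ hornRetraction i x j = 0 := by
  obtain ⟨j, hj, hjx⟩ := exists_minCoord_eq i x
  refine ⟨j, hj, ?_⟩
  change slide i x (minCoord i x) j = 0
  rw [slide_apply, min_self, max_eq_right (minCoord_mem_unitInterval i x).1, if_neg hj, hjx]
  ring

lemma hornRetraction_eq_self {x : stdSimplex ℝ ι} (hx : minCoord i x = 0) :
    hornRetraction i x = x := by
  change slide i x (minCoord i x) = x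
  rw [hx, slide_zero]

lemma exists_extension_comp_hornRetraction {P : Type*} [TopologicalSpace P]
    (g : {j // j ≠ i} → C(stdSimplex ℝ ι, P))
    (hg : ∀ j k x, x j.1 = 0 → x k.1 = 0 → g j x = g k x) :
    ∃ f : C(stdSimplex ℝ ι, P),
      ∀ j x, hornRetraction i x j.1 = 0 → f x = g j (hornRetraction i x) := by
  choose J hJ hJx using exists_hornRetraction_apply_eq_zero i
  have eq_of_apply_eq_zero : ∀ (j : {j // j ≠ i}) x, hornRetraction i x j.1 = 0 →
      g ⟨J x, hJ x⟩ (hornRetraction i x) = g j (hornRetraction i x) :=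
    fun j x hx => hg _ _ _ (hJx x) hx
  refine ⟨⟨fun x => g ⟨J x, hJ x⟩ (hornRetraction i x), ?_⟩, eq_of_apply_eq_zero⟩
  refine (locallyFinite_of_finite fun j : {j // j ≠ i} =>
    {x | hornRetraction i x j = 0}).continuous ?_ ?_ ?_
  · exact Set.eq_univ_of_forall fun x => Set.mem_iUnion.2 ⟨⟨J x, hJ x⟩, hJx x⟩
  · exact fun j => isClosed_eq ((continuous_apply j.1).comp
      (continuous_subtype_val.comp (hornRetraction i).continuous)) continuous_const
  · exact fun j => ((g j).comp (hornRetraction i)).continuous.continuousOn.congr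
      (eq_of_apply_eq_zero j)

end Slide

/-- The homotopy lifting property of a continuous map. The test spaces `W` are restricted to the
lowest universe, which contains all standard simplices. -/
def HasHomotopyLifting {P B : Type*} [TopologicalSpace P] [TopologicalSpace B] (q : C(P, B)) :
    Prop :=
  ∀ (W : Type) [TopologicalSpace W] (H : C(W × unitInterval, B)) (f : C(W, P)),
    (∀ w, H (w, 0) = q (f w)) →
      ∃ F : C(W × unitInterval, P), (∀ w, F (w, 0) = f w) ∧ ∀ z, q (F z) = H z

lemma HasHomotopyLifting.exists_lift_horn {P B : Type*} [TopologicalSpace P] [TopologicalSpace B]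
    {q : C(P, B)} (hq : HasHomotopyLifting q) {ι : Type} [Fintype ι]
    [Nontrivial ι] (i : ι) (g : {j // j ≠ i} → C(stdSimplex ℝ ι, P)) (b : C(stdSimplex ℝ ι, B))
    (hg : ∀ j k x, x j.1 = 0 → x k.1 = 0 → g j x = g k x)
    (hb : ∀ j x, x j.1 = 0 → q (g j x) = b x) :
    ∃ φ : C(stdSimplex ℝ ι, P), (∀ j x, x j.1 = 0 → φ x = g j x) ∧ ∀ x, q (φ x) = b x := by
  classical
  obtain ⟨f, hf⟩ := exists_extension_comp_hornRetraction i g hg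
  -- At time `s` the point `x` still has to slide by `minCoord i x - s`; it is at rest at time
  -- `minCoord i x`, where the lifted homotopy is evaluated.
  let H : C(stdSimplex ℝ ι × unitInterval, B) :=
    ⟨fun z => b (slide i z.1 (minCoord i z.1 - z.2)),
      b.continuous.comp ((continuous_slide i).comp (continuous_fst.prodMk
        (((continuous_minCoord i).comp continuous_fst).sub
          (continuous_subtype_val.comp continuous_snd))))⟩
  have H_zero : ∀ x, H (x, 0) = q (f x) := fun x => by
    obtain ⟨j, hj, hx⟩ := exists_hornRetraction_apply_eq_zero i x
    rw [hf ⟨j, hj⟩ x hx, hb ⟨j, hj⟩ _ hx]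
    change b (slide i x (minCoord i x - 0)) = _
    rw [sub_zero]
    rfl
  obtain ⟨F, hF_zero, hF⟩ := hq _ H f H_zero
  refine ⟨⟨fun x => F (x, ⟨minCoord i x, minCoord_mem_unitInterval i x⟩),
    F.continuous.comp (continuous_id.prodMk ((continuous_minCoord i).subtype_mk _))⟩,
    fun j x hx => ?_, fun x => ?_⟩
  · have hmin := minCoord_eq_zero i j.2 hx
    have retraction_eq := hornRetraction_eq_self i hmin
    have rest : (⟨minCoord i x, minCoord_mem_unitInterval i x⟩ : unitInterval) = 0 :=
      Subtype.ext hmin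
    change F (x, _) = _
    rw [rest, hF_zero, hf j x (by rwa [retraction_eq]), retraction_eq]
  · refine (hF _).trans ?_
    change b (slide i x (minCoord i x - minCoord i x)) = b x
    rw [sub_self, slide_zero]

lemma hasHomotopyLifting_const {P : Type*} [TopologicalSpace P] :
    HasHomotopyLifting (ContinuousMap.const P PUnit.unit) :=
  fun _ _ _ f _ => ⟨f.comp ⟨Prod.fst, continuous_fst⟩, fun _ => rfl, fun _ => rfl⟩

/-- The evaluation of paths at both ends. -/
def pathEnds (T : Type*) [TopologicalSpace T] : C(C(unitInterval, T), T × T) :=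
  ⟨fun γ => (γ 0, γ 1),
    (ContinuousEvalConst.continuous_eval_const 0).prodMk
      (ContinuousEvalConst.continuous_eval_const 1)⟩

section ProlongedPath

variable {W T : Type*} [TopologicalSpace W] [TopologicalSpace T]
  (H : C(W × unitInterval, T × T)) (f : C(W, C(unitInterval, T)))

/-- The path `f w` prolonged beyond its ends along the two components of the homotopy `H` of end
points. -/
noncomputable def prolongedPath (z : W × ℝ) : T :=
  if z.2 ≤ 0 then (H (z.1, Set.projIcc 0 1 zero_le_one (-z.2))).1
  else if 1 ≤ z.2 then (H (z.1, Set.projIcc 0 1 zero_le_one (z.2 - 1))).2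
  else f z.1 (Set.projIcc 0 1 zero_le_one z.2)

variable {H f} (hf : ∀ w, H (w, 0) = pathEnds T (f w))

include hf in
lemma continuous_prolongedPath : Continuous (prolongedPath H f) := by
  refine Continuous.if_le ?_ (Continuous.if_le ?_ ?_ continuous_const continuous_snd ?_)
    continuous_snd continuous_const ?_
  · exact continuous_fst.comp (H.continuous.comp
      (continuous_fst.prodMk (continuous_projIcc.comp continuous_snd.neg)))
  · exact continuous_snd.comp (H.continuous.comp
      (continuous_fst.prodMk (continuous_projIcc.comp (continuous_snd.sub continuous_const))))
  · exact (ContinuousMap.uncurry f).continuous.comp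
      (continuous_fst.prodMk ((continuous_projIcc (h := zero_le_one)).comp continuous_snd))
  · intro z hz
    rw [← hz, sub_self, Set.projIcc_left, Set.projIcc_right]
    exact congrArg Prod.snd (hf z.1)
  · intro z hz
    rw [hz, neg_zero, if_neg (by norm_num), Set.projIcc_left]
    exact congrArg Prod.fst (hf z.1)

include hf in
lemma prolongedPath_coe (w : W) (t : unitInterval) : prolongedPath H f (w, t) = f w t := by
  dsimp only [prolongedPath]
  split_ifs with t_le t_ge
  · obtain rfl : t = 0 := le_antisymm t_le t.2.1
    simp only [Set.Icc.coe_zero, neg_zero, Set.projIcc_left]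
    exact congrArg Prod.fst (hf w)
  · obtain rfl : t = 1 := le_antisymm t.2.2 t_ge
    simp only [Set.Icc.coe_one, sub_self, Set.projIcc_left]
    exact congrArg Prod.snd (hf w)
  · rw [Set.projIcc_val]

lemma prolongedPath_neg (w : W) (s : unitInterval) :
    prolongedPath H f (w, -s) = (H (w, s)).1 := by
  dsimp only [prolongedPath]
  rw [if_pos (neg_nonpos.2 s.2.1), neg_neg, Set.projIcc_val]

lemma prolongedPath_one_add (w : W) (s : unitInterval) :
    prolongedPath H f (w, 1 + s) = (H (w, s)).2 := by
  have s_nonneg := s.2.1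
  dsimp only [prolongedPath]
  rw [if_neg (by linarith), if_pos (by linarith), add_sub_cancel_left, Set.projIcc_val]

end ProlongedPath

lemma hasHomotopyLifting_pathEnds (T : Type*) [TopologicalSpace T] :
    HasHomotopyLifting (pathEnds T) := by
  intro W _ H f hf
  let F : C(W × unitInterval, C(unitInterval, T)) := ContinuousMap.curry
    ⟨fun z => prolongedPath H f (z.1.1, (1 + 2 * z.1.2) * z.2 - z.1.2),
      (continuous_prolongedPath hf).comp (by fun_prop)⟩
  have F_apply : ∀ z t, F z t = prolongedPath H f (z.1, (1 + 2 * z.2) * t - z.2) :=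
    fun _ _ => rfl
  refine ⟨F, fun w => ContinuousMap.ext fun t => ?_, fun z => Prod.ext ?_ ?_⟩
  · rw [F_apply, ← prolongedPath_coe hf w t]
    simp
  · refine (F_apply z 0).trans ((congrArg _ ?_).trans (prolongedPath_neg z.1 z.2))
    simp
  · refine (F_apply z 1).trans ((congrArg _ ?_).trans (prolongedPath_one_add z.1 z.2))
    refine Prod.ext rfl ?_
    change (1 + 2 * (z.2 : ℝ)) * 1 - z.2 = 1 + z.2
    ring

end HomotopyLifting

section Realization

open SSet Simplicial HomotopicalAlgebra modelCategoryQuillen CartesianMonoidalCategory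

lemma objEquiv_symm_mem_horn_iff {n m : ℕ} {i : Fin (n + 1)} (s : ⦋m⦌ ⟶ ⦋n⦌) :
    stdSimplex.objEquiv.symm s ∈ (horn.{u} n i).obj (op ⦋m⦌) ↔
      ∃ j, j ≠ i ∧ ∀ l, s.toOrderHom l ≠ j := by
  rw [mem_horn_iff, Ne, Set.eq_univ_iff_forall]
  push Not
  refine exists_congr fun j => ?_
  rw [Set.mem_union, Set.mem_range, Set.mem_singleton_iff]
  push Not
  exact and_comm

section HornEval

variable {n : ℕ} {i : Fin (n + 1)} {P : TopCat.{u}} (t : (Λ[n, i] : SSet.{u}) ⟶ TopCat.toSSet.obj P)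

/-- The value of a map from a horn to a singular simplicial set on a simplex of the horn, as a map
of spaces. -/
noncomputable def hornEval {m : ℕ} (s : ⦋m⦌ ⟶ ⦋n⦌)
    (hs : stdSimplex.objEquiv.symm s ∈ (horn.{u} n i).obj (op ⦋m⦌)) :
    C(_root_.stdSimplex ℝ (Fin (m + 1)), P) :=
  P.toSSetObjEquiv (op ⦋m⦌) (t.app (op ⦋m⦌) ⟨_, hs⟩)

lemma hornEval_comp {m k : ℕ} (f : ⦋k⦌ ⟶ ⦋m⦌) (s : ⦋m⦌ ⟶ ⦋n⦌) (hs hfs)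
    (x : _root_.stdSimplex ℝ (Fin (k + 1))) :
    hornEval t (f ≫ s) hfs x = hornEval t s hs (stdSimplex.map f.toOrderHom x) := by
  have naturality := ConcreteCategory.congr_hom (t.naturality f.op) ⟨_, hs⟩
  exact DFunLike.congr_fun (congrArg (P.toSSetObjEquiv (op ⦋k⦌)) naturality) x

lemma hornEval_map_of_fixed {m : ℕ} (s : ⦋m⦌ ⟶ ⦋n⦌) (hs) {e : ⦋n⦌ ⟶ ⦋n⦌} (he) {j : Fin (n + 1)}
    (he_fix : ∀ l, l ≠ j → e.toOrderHom l = l) (hj : ∀ l, s.toOrderHom l ≠ j)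
    (x : _root_.stdSimplex ℝ (Fin (m + 1))) :
    hornEval t e he (stdSimplex.map s.toOrderHom x) = hornEval t s hs x := by
  have s_comp : s ≫ e = s := by
    ext l : 3
    exact he_fix _ (hj l)
  rw [← hornEval_comp t s e he (by rwa [s_comp])]
  congr!

lemma hornEval_eq_of_apply_eq_zero {j k : Fin (n + 1)} (hj : j ≠ i) (hk : k ≠ i)
    {e d : ⦋n⦌ ⟶ ⦋n⦌} (he hd) (he_fix : ∀ l, l ≠ j → e.toOrderHom l = l)
    (hd_fix : ∀ l, l ≠ k → d.toOrderHom l = l) {x : _root_.stdSimplex ℝ (Fin (n + 1))}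
    (hxj : x j = 0) (hxk : x k = 0) : hornEval t e he x = hornEval t d hd x := by
  obtain ⟨c, hc_fix, hc⟩ := exists_monotone_retraction ((Finset.univ.erase j).erase k)
    ⟨i, by simp [hj.symm, hk.symm]⟩
  simp only [Finset.mem_erase, Finset.mem_univ, and_true] at hc_fix hc
  have map_x : stdSimplex.map c x = x := stdSimplex_map_eq_self _ x fun l hl =>
    hc_fix l ⟨fun h => hl (h ▸ hxk), fun h => hl (h ▸ hxj)⟩
  let s : ⦋n⦌ ⟶ ⦋n⦌ := SimplexCategory.Hom.mk c
  have hs := (objEquiv_symm_mem_horn_iff.{u} (i := i) s).2 ⟨j, hj, fun l => (hc l).2⟩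
  have eval_e := hornEval_map_of_fixed t s hs he he_fix (fun l => (hc l).2) x
  have eval_d := hornEval_map_of_fixed t s hs hd hd_fix (fun l => (hc l).1) x
  change hornEval t e he (stdSimplex.map c x) = _ at eval_e
  change hornEval t d hd (stdSimplex.map c x) = _ at eval_d
  rw [map_x] at eval_e eval_d
  exact eval_e.trans eval_d.symm

lemma map_hornEval {B : TopCat.{u}} {q : P ⟶ B} {b : Δ[n] ⟶ TopCat.toSSet.obj B}
    (sq : t ≫ TopCat.toSSet.map q = Λ[n, i].ι ≫ b) {m : ℕ} (s : ⦋m⦌ ⟶ ⦋n⦌) (hs)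
    (x : _root_.stdSimplex ℝ (Fin (m + 1))) :
    q.hom (hornEval t s hs x) =
      B.toSSetObjEquiv (op ⦋n⦌) (yonedaEquiv b) (stdSimplex.map s.toOrderHom x) := by
  have b_app : b.app (op ⦋m⦌) (stdSimplex.objEquiv.symm s) =
      (TopCat.toSSet.obj B).map s.op (yonedaEquiv b) := by
    rw [← yonedaEquiv_symm_app_objEquiv_symm, Equiv.symm_apply_apply]
  have square_app := ConcreteCategory.congr_hom (NatTrans.congr_app sq (op ⦋m⦌)) ⟨_, hs⟩
  exact DFunLike.congr_fun (congrArg (B.toSSetObjEquiv (op ⦋m⦌)) (square_app.trans b_app)) x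

end HornEval

lemma fibrations_toSSet_map {P B : TopCat.{u}} (q : P ⟶ B) (hq : HasHomotopyLifting q.hom) :
    fibrations SSet (TopCat.toSSet.map q) := by
  rw [fibrations_eq]
  intro _ _ _ hf
  simp only [J, MorphismProperty.iSup_iff] at hf
  obtain ⟨n, ⟨i⟩⟩ := hf
  refine ⟨fun {t b} sq => ?_⟩
  have exists_retraction : ∀ j : Fin (n + 2), ∃ e : ⦋n + 1⦌ ⟶ ⦋n + 1⦌,
      (∀ l, l ≠ j → e.toOrderHom l = l) ∧ ∀ l, e.toOrderHom l ≠ j := fun j => by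
    obtain ⟨e, he_fix, he⟩ :=
      exists_monotone_retraction (Finset.univ.erase j) Finset.univ_nontrivial.erase_nonempty
    simp only [Finset.mem_erase, Finset.mem_univ, and_true] at he_fix he
    exact ⟨SimplexCategory.Hom.mk e, he_fix, he⟩
  choose e he_fix he using exists_retraction
  have he_mem : ∀ j : {j // j ≠ i}, stdSimplex.objEquiv.symm (e j) ∈
      (horn.{u} (n + 1) i).obj (op ⦋n + 1⦌) :=
    fun j => (objEquiv_symm_mem_horn_iff _).2 ⟨j.1, j.2, he j⟩
  obtain ⟨φ, hφ_face, hφ_base⟩ := hq.exists_lift_horn i (fun j => hornEval t (e j) (he_mem j))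
    (B.toSSetObjEquiv (op ⦋n + 1⦌) (yonedaEquiv b))
    (fun j k _ hxj hxk =>
      hornEval_eq_of_apply_eq_zero t j.2 k.2 _ _ (he_fix j) (he_fix k) hxj hxk)
    (fun j x hx => (map_hornEval t sq.w _ _ x).trans <| congrArg _ <|
      stdSimplex_map_eq_self _ x fun l hl => he_fix j l fun hlj => hl (hlj ▸ hx))
  refine ⟨⟨{ l := yonedaEquiv.symm ((P.toSSetObjEquiv (op ⦋n + 1⦌)).symm φ)
             fac_left := ?_
             fac_right := ?_ }⟩⟩
  · ext ⟨⟨m⟩⟩ ⟨s, hs⟩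
    obtain ⟨s, rfl⟩ := stdSimplex.objEquiv.symm.surjective s
    obtain ⟨j, hj, hsj⟩ := (objEquiv_symm_mem_horn_iff s).1 hs
    refine (P.toSSetObjEquiv (op ⦋m⦌)).injective (ContinuousMap.ext fun x => ?_)
    exact (hφ_face ⟨j, hj⟩ _ (stdSimplex_map_apply_eq_zero _ x j hsj)).trans
      (hornEval_map_of_fixed t s hs _ (he_fix j) hsj x)
  · refine yonedaEquiv.injective ((B.toSSetObjEquiv (op ⦋n + 1⦌)).injective
      (ContinuousMap.ext fun x => Eq.trans ?_ (hφ_base x)))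
    rw [yonedaEquiv_comp, Equiv.apply_symm_apply]
    rfl

lemma exists_lift_toTop_map {X Y : SSet.{u}} {j : X ⟶ Y} (hj : anodyneExtensions j)
    {P B : TopCat.{u}} {q : P ⟶ B} (hq : HasHomotopyLifting q.hom) {f : toTop.obj X ⟶ P}
    {g : toTop.obj Y ⟶ B} (w : f ≫ q = toTop.map j ≫ g) :
    ∃ l : toTop.obj Y ⟶ P, toTop.map j ≫ l = f ∧ l ≫ q = g := by
  have := hj _ (fibrations_toSSet_map q hq)
  have sq : CommSq (sSetTopAdj.homEquiv _ _ f) j (TopCat.toSSet.map q)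
      (sSetTopAdj.homEquiv _ _ g) := ⟨by
    rw [← Adjunction.homEquiv_naturality_right, ← Adjunction.homEquiv_naturality_left, w]⟩
  refine ⟨(sSetTopAdj.homEquiv _ _).symm sq.lift, ?_, ?_⟩
  · rw [← Adjunction.homEquiv_naturality_left_symm, sq.fac_left, Equiv.symm_apply_apply]
  · rw [← Adjunction.homEquiv_naturality_right_symm, sq.fac_right, Equiv.symm_apply_apply]

open SymmetricSpectrum in
lemma weakEquiv_of_anodyneExtensions {X Y : SSet.{u}} {j : X ⟶ Y} (hj : anodyneExtensions j) :
    WeakEquiv j := by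
  obtain ⟨r, hr, -⟩ := exists_lift_toTop_map hj
    (q := TopCat.ofHom (ContinuousMap.const (toTop.obj X) PUnit.unit.{u + 1}))
    hasHomotopyLifting_const (f := 𝟙 _)
    (g := TopCat.ofHom (ContinuousMap.const _ PUnit.unit)) rfl
  have map_r_map : toTop.map j ≫ r ≫ toTop.map j = toTop.map j := by
    rw [← Category.assoc, hr, Category.id_comp]
  -- Lifting the pair `(𝟙, r ≫ j)` through the path fibration gives a homotopy between the two.
  obtain ⟨l, -, hl⟩ := exists_lift_toTop_map hj
    (q := TopCat.ofHom (pathEnds (toTop.obj Y))) (hasHomotopyLifting_pathEnds _)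
    (f := toTop.map j ≫ TopCat.ofHom (ContinuousMap.curry ⟨Prod.fst, continuous_fst⟩))
    (g := TopCat.ofHom ((ContinuousMap.id _).prodMk ((r ≫ toTop.map j).hom)))
    (TopCat.hom_ext (ContinuousMap.ext fun x =>
      Prod.ext rfl (ConcreteCategory.congr_hom map_r_map x).symm))
  have l_ends : ∀ y, (l.hom y 0, l.hom y 1) = (y, (r ≫ toTop.map j).hom y) := fun y =>
    ConcreteCategory.congr_hom hl y
  refine ⟨⟨(toTop.map j).hom, r.hom, ?_, ?_⟩, rfl⟩
  · have : r.hom.comp (toTop.map j).hom = ContinuousMap.id _ := congrArg TopCat.Hom.hom hr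
    rw [this]
  · refine ContinuousMap.Homotopic.symm ⟨⟨⟨fun z => l.hom z.2 z.1, ?_⟩, ?_, ?_⟩⟩
    · exact (ContinuousMap.uncurry l.hom).continuous.comp continuous_swap
    · exact fun y => congrArg Prod.fst (l_ends y)
    · exact fun y => congrArg Prod.snd (l_ends y)

end Realization

section Nerve

open SSet Simplicial HomotopicalAlgebra modelCategoryQuillen CartesianMonoidalCategory

lemma anodyneExtensions_of_mono_deformation (e e' : Fin 2) {X Y : SSet.{u}} (j : X ⟶ Y) [Mono j]
    (h : Y ⊗ Δ[1] ⟶ Y) (hX : X ⊗ Δ[1] ⟶ X) (r : Y ⟶ X) (he : endIncl e ≫ h = r ≫ j)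
    (he' : endIncl e' ≫ h = 𝟙 Y) (hj : j ▷ _ ≫ h = hX ≫ j) : anodyneExtensions j := by
  rw [← Subcomplex.toRange_ι j, MorphismProperty.cancel_left_of_respectsIso anodyneExtensions]
  refine anodyneExtensions_of_deformation e e' (Subcomplex.range j) h
    (inv (Subcomplex.toRange j) ▷ _ ≫ hX ≫ Subcomplex.toRange j)
    (r ≫ Subcomplex.toRange j) ?_ he' ?_
  · rw [he, Category.assoc, Subcomplex.toRange_ι]
  · rw [Category.assoc, Category.assoc, Subcomplex.toRange_ι, ← hj, ← comp_whiskerRight_assoc,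
      IsIso.inv_comp_eq (Subcomplex.toRange j) |>.2 (Subcomplex.toRange_ι j).symm]

variable {C D : Type u} [Category.{u} C] [Category.{u} D]

/-- The homotopy between maps of nerves given by a natural transformation, which is encoded as a
functor from `{0 < 1}` to the functor category. -/
noncomputable def nerveHomotopy (T : ComposableArrows (C ⥤ D) 1) : nerve C ⊗ Δ[1] ⟶ nerve D where
  app n := ↾fun z => (Functor.prod' z.1 (stdSimplex.asOrderHom z.2).monotone.functor ⋙
    Functor.uncurry.obj (Functor.flip T) : Fin (n.unop.len + 1) ⥤ D)
  naturality _ _ _ := rfl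

lemma endIncl_nerveHomotopy (e : Fin 2) (T : ComposableArrows (C ⥤ D) 1) :
    endIncl e ≫ nerveHomotopy T = nerveMap (T.obj e) := by
  ext n (x : Fin (n.unop.len + 1) ⥤ C)
  refine CategoryTheory.Functor.hext (fun _ => rfl) fun a b f => heq_of_eq ?_
  change (T.obj e).map (x.map f) ≫ (T.map (𝟙 e)).app _ = (T.obj e).map (x.map f)
  rw [T.map_id, NatTrans.id_app, Category.comp_id]

lemma whiskerRight_nerveHomotopy {B : Type u} [Category.{u} B] (i : B ⥤ C)
    (T : ComposableArrows (C ⥤ D) 1) :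
    nerveMap i ▷ _ ≫ nerveHomotopy T =
      nerveHomotopy (T ⋙ (Functor.whiskeringLeft B C D).obj i) := rfl

lemma nerveHomotopy_comp {E : Type u} [Category.{u} E] (T : ComposableArrows (C ⥤ D) 1)
    (p : D ⥤ E) :
    nerveHomotopy T ≫ nerveMap p = nerveHomotopy (T ⋙ (Functor.whiskeringRight C D E).obj p) := by
  ext n z
  exact CategoryTheory.Functor.hext (fun _ => rfl) fun a b f => heq_of_eq (p.map_comp _ _)

lemma mono_nerveMap (i : C ⥤ D) [i.Faithful] (hi : Function.Injective i.obj) :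
    Mono (nerveMap i) := by
  rw [NatTrans.mono_iff_mono_app]
  intro n
  rw [mono_iff_injective]
  intro (x : Fin (n.unop.len + 1) ⥤ C) (y : Fin (n.unop.len + 1) ⥤ C) (hxy : x ⋙ i = y ⋙ i)
  refine CategoryTheory.Functor.ext (fun k => hi (Functor.congr_obj hxy k)) fun a b f => ?_
  refine i.map_injective ?_
  rw [i.map_comp, i.map_comp, eqToHom_map, eqToHom_map]
  exact Functor.congr_hom hxy f

lemma anodyneExtensions_nerveMap_of_homotopy (e e' : Fin 2) (i : C ⥤ D) [i.Faithful]
    (hi : Function.Injective i.obj) (r : D ⥤ C) (T : ComposableArrows (D ⥤ D) 1)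
    (TC : ComposableArrows (C ⥤ C) 1) (he : T.obj e = r ⋙ i) (he' : T.obj e' = 𝟭 D)
    (hT : T ⋙ (Functor.whiskeringLeft C D D).obj i = TC ⋙ (Functor.whiskeringRight C C D).obj i) :
    anodyneExtensions (nerveMap i) := by
  have := mono_nerveMap i hi
  refine anodyneExtensions_of_mono_deformation e e' (nerveMap i) (nerveHomotopy T)
    (nerveHomotopy TC) (nerveMap r) ?_ ?_ ?_
  · rw [endIncl_nerveHomotopy, he]
    rfl
  · rw [endIncl_nerveHomotopy, he']
    rfl
  · rw [whiskerRight_nerveHomotopy, nerveHomotopy_comp, hT]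

lemma anodyneExtensions_nerveMap_of_counit (i : C ⥤ D) [i.Faithful]
    (hi : Function.Injective i.obj) (r : D ⥤ C) (ε : r ⋙ i ⟶ 𝟭 D) (ε' : i ⋙ r ⟶ 𝟭 C)
    (hε : ∀ X, i.map (ε'.app X) = ε.app (i.obj X)) : anodyneExtensions (nerveMap i) := by
  have whisker_eq : Functor.whiskerLeft i ε = (Functor.whiskerRight ε' i :) :=
    NatTrans.ext (funext fun X => (hε X).symm)
  refine anodyneExtensions_nerveMap_of_homotopy 0 1 i hi r (.mk₁ ε) (.mk₁ ε') rfl rfl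
    (ComposableArrows.ext₁ rfl rfl (Eq.trans whisker_eq ?_))
  exact ((Category.id_comp _).trans (Category.comp_id _)).symm

lemma anodyneExtensions_nerveMap_of_unit (i : C ⥤ D) [i.Faithful]
    (hi : Function.Injective i.obj) (r : D ⥤ C) (η : 𝟭 D ⟶ r ⋙ i) (η' : 𝟭 C ⟶ i ⋙ r)
    (hη : ∀ X, i.map (η'.app X) = η.app (i.obj X)) : anodyneExtensions (nerveMap i) := by
  have whisker_eq : Functor.whiskerLeft i η = (Functor.whiskerRight η' i :) :=
    NatTrans.ext (funext fun X => (hη X).symm)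
  refine anodyneExtensions_nerveMap_of_homotopy 1 0 i hi r (.mk₁ η) (.mk₁ η') rfl rfl
    (ComposableArrows.ext₁ rfl rfl (Eq.trans whisker_eq ?_))
  exact ((Category.id_comp _).trans (Category.comp_id _)).symm

end Nerve

section Collages

variable {X Y Z X' Y' : Type u} [Category.{u} X] [Category.{u} Y] [Category.{u} Z]
  [Category.{u} X'] [Category.{u} Y'] {L' : X' ⥤ Y'} {L : X ⥤ Y}

/-- The collage of a functor `L : X ⥤ Y`: the disjoint union of `X` and `Y` with the morphisms
`L.obj x ⟶ y` adjoined as morphisms from `x` to `y`. Its nerve plays the role of a mapping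
cylinder. -/
def Collage (_ : X ⥤ Y) : Type u := X ⊕ Y

namespace Collage

/-- The morphisms of the collage. -/
def Hom : Collage L → Collage L → Type u
  | .inl x, .inl x' => x ⟶ x'
  | .inl x, .inr y => L.obj x ⟶ y
  | .inr _, .inl _ => PEmpty
  | .inr y₁, .inr y₂ => y₁ ⟶ y₂

/-- The composition of morphisms of the collage. -/
def comp : ∀ {a b c : Collage L}, Hom a b → Hom b c → Hom a c
  | .inl x, .inl x', .inl x'', f, g => (show x ⟶ x' from f) ≫ (show x' ⟶ x'' from g)
  | .inl x, .inl x', .inr y, f, g => L.map (show x ⟶ x' from f) ≫ (show L.obj x' ⟶ y from g)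
  | .inl x, .inr y, .inr y', f, g => (show L.obj x ⟶ y from f) ≫ (show y ⟶ y' from g)
  | .inr y, .inr y', .inr y'', f, g => (show y ⟶ y' from f) ≫ (show y' ⟶ y'' from g)
  | .inr _, .inl _, _, f, _ => PEmpty.elim f
  | _, .inr _, .inl _, _, g => PEmpty.elim g

instance : Category.{u} (Collage L) where
  Hom := Hom
  id
    | .inl x => 𝟙 x
    | .inr y => 𝟙 y
  comp := comp
  id_comp {a b} f := by
    match a, b, f with
    | .inl _, .inl _, f => exact Category.id_comp (obj := X) f
    | .inl _, .inr _, f =>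
      change L.map (𝟙 _) ≫ f = f
      rw [L.map_id]
      exact Category.id_comp (obj := Y) f
    | .inr _, .inr _, f => exact Category.id_comp (obj := Y) f
    | .inr _, .inl _, f => exact PEmpty.elim f
  comp_id {a b} f := by
    match a, b, f with
    | .inl _, .inl _, f => exact Category.comp_id (obj := X) f
    | .inl _, .inr _, f => exact Category.comp_id (obj := Y) f
    | .inr _, .inr _, f => exact Category.comp_id (obj := Y) f
    | .inr _, .inl _, f => exact PEmpty.elim f
  assoc {a b c d} f g h := by
    match a, b, c, d, f, g, h with
    | .inl _, .inl _, .inl _, .inl _, f, g, h => exact Category.assoc (obj := X) f g h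
    | .inl _, .inl _, .inl _, .inr _, f, g, h =>
      exact (congrArg (· ≫ (show L.obj _ ⟶ _ from h)) (L.map_comp f g)).trans
        (Category.assoc (obj := Y) _ _ _)
    | .inl _, .inl _, .inr _, .inr _, f, g, h => exact Category.assoc (obj := Y) _ g h
    | .inl _, .inr _, .inr _, .inr _, f, g, h => exact Category.assoc (obj := Y) f g h
    | .inr _, .inr _, .inr _, .inr _, f, g, h => exact Category.assoc (obj := Y) f g h
    | .inr _, .inl _, _, _, f, _, _ => exact PEmpty.elim f
    | _, .inr _, .inl _, _, _, g, _ => exact PEmpty.elim g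
    | _, _, .inr _, .inl _, _, _, h => exact PEmpty.elim h

variable (L) in
/-- The inclusion of the source of a functor in its collage. -/
def inlFunctor : X ⥤ Collage L where
  obj x := .inl x
  map f := f
  map_id _ := rfl
  map_comp _ _ := rfl

variable (L) in
/-- The inclusion of the target of a functor in its collage. -/
def inrFunctor : Y ⥤ Collage L where
  obj y := .inr y
  map f := f
  map_id _ := rfl
  map_comp _ _ := rfl

instance : (inlFunctor L).Faithful := ⟨fun h => h⟩

instance : (inrFunctor L).Faithful := ⟨fun h => h⟩

lemma inlFunctor_obj_injective : Function.Injective (inlFunctor L).obj := Sum.inl_injective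

lemma inrFunctor_obj_injective : Function.Injective (inrFunctor L).obj := Sum.inr_injective

/-- The morphism of the collage from the source to the target that is given by
`f : L.obj x ⟶ y`. -/
def cross {x : X} {y : Y} (f : L.obj x ⟶ y) : (inlFunctor L).obj x ⟶ (inrFunctor L).obj y := f

lemma cross_comp_inr {x : X} {y y' : Y} (f : L.obj x ⟶ y) (g : y ⟶ y') :
    cross f ≫ (inrFunctor L).map g = cross (f ≫ g) := rfl

lemma inl_comp_cross {x x' : X} {y : Y} (f : x ⟶ x') (g : L.obj x' ⟶ y) :
    (inlFunctor L).map f ≫ cross g = cross (L.map f ≫ g) := rfl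

lemma cross_eq_comp {x : X} {y : Y} (f : L.obj x ⟶ y) :
    cross f = cross (𝟙 (L.obj x)) ≫ (inrFunctor L).map f :=
  (Category.id_comp (obj := Y) f).symm

/-- The functor on the collage that is given by functors on both parts and the values `κ` on the
morphisms `cross (𝟙 (L.obj x))`. -/
def descFunctor (F : X ⥤ Z) (G : Y ⥤ Z) (κ : F ⟶ L ⋙ G) : Collage L ⥤ Z where
  obj
    | .inl x => F.obj x
    | .inr y => G.obj y
  map {a b} f := match a, b, f with
    | .inl x, .inl x', f => F.map (show x ⟶ x' from f)
    | .inl x, .inr y, f => κ.app x ≫ G.map (show L.obj x ⟶ y from f)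
    | .inr y, .inr y', f => G.map (show y ⟶ y' from f)
    | .inr _, .inl _, f => PEmpty.elim f
  map_id
    | .inl x => F.map_id x
    | .inr y => G.map_id y
  map_comp {a b c} f g := by
    match a, b, c, f, g with
    | .inl _, .inl _, .inl _, f, g => exact F.map_comp _ _
    | .inl x, .inl x', .inr y, f, g =>
      change κ.app x ≫ G.map (L.map (show x ⟶ x' from f) ≫ (show L.obj x' ⟶ y from g)) =
        F.map (show x ⟶ x' from f) ≫ κ.app x' ≫ G.map (show L.obj x' ⟶ y from g)
      rw [G.map_comp, κ.naturality_assoc]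
      rfl
    | .inl x, .inr y, .inr y', f, g =>
      change κ.app x ≫ G.map ((show L.obj x ⟶ y from f) ≫ (show y ⟶ y' from g)) =
        (κ.app x ≫ G.map (show L.obj x ⟶ y from f)) ≫ G.map (show y ⟶ y' from g)
      rw [G.map_comp, Category.assoc]
    | .inr _, .inr _, .inr _, f, g => exact G.map_comp _ _
    | .inr _, .inl _, _, f, _ => exact PEmpty.elim f
    | _, .inr _, .inl _, _, g => exact PEmpty.elim g

lemma functor_ext {F G : Collage L ⥤ Z} (hinl : inlFunctor L ⋙ F = inlFunctor L ⋙ G)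
    (hinr : inrFunctor L ⋙ F = inrFunctor L ⋙ G)
    (hcross : ∀ x, F.map (cross (𝟙 (L.obj x))) ≍ G.map (cross (𝟙 (L.obj x)))) : F = G := by
  have obj_eq : ∀ a, F.obj a = G.obj a
    | .inl x => Functor.congr_obj hinl x
    | .inr y => Functor.congr_obj hinr y
  have map_cross {x : X} {y : Y} (f : L.obj x ⟶ y) : F.map (cross f) ≍ G.map (cross f) := by
    rw [cross_eq_comp]
    exact Functor.map_comp_heq (obj_eq _) (obj_eq _) (obj_eq _) (hcross x)
      (congr_arg_heq (fun T : Y ⥤ Z => T.map f) hinr)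
  refine CategoryTheory.Functor.hext obj_eq fun a b f => ?_
  match a, b, f with
  | .inl x, .inl x', f => exact congr_arg_heq (fun T : X ⥤ Z => T.map (show x ⟶ x' from f)) hinl
  | .inr y, .inr y', f => exact congr_arg_heq (fun T : Y ⥤ Z => T.map (show y ⟶ y' from f)) hinr
  | .inr _, .inl _, f => exact PEmpty.elim f
  | .inl x, .inr y, f => exact map_cross (show L.obj x ⟶ y from f)

/-- The natural transformation between functors on the collage that is given by natural
transformations between their restrictions to both parts. -/
def descNatTrans {F G : Collage L ⥤ Z} (α : inlFunctor L ⋙ F ⟶ inlFunctor L ⋙ G)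
    (β : inrFunctor L ⋙ F ⟶ inrFunctor L ⋙ G)
    (h : ∀ x, F.map (cross (𝟙 (L.obj x))) ≫ β.app (L.obj x) =
      α.app x ≫ G.map (cross (𝟙 (L.obj x)))) : F ⟶ G where
  app
    | .inl x => α.app x
    | .inr y => β.app y
  naturality a b f := by
    have naturality_cross {x : X} {y : Y} (f : L.obj x ⟶ y) :
        F.map (cross f) ≫ β.app y = α.app x ≫ G.map (cross f) := by
      rw [cross_eq_comp, F.map_comp, G.map_comp, Category.assoc]
      exact (congrArg (F.map (cross (𝟙 (L.obj x))) ≫ ·) (β.naturality f)).trans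
        ((reassoc_of% (h x)) _)
    match a, b, f with
    | .inl _, .inl _, f => exact α.naturality f
    | .inr _, .inr _, f => exact β.naturality f
    | .inr _, .inl _, f => exact PEmpty.elim f
    | .inl x, .inr y, f => exact naturality_cross (show L.obj x ⟶ y from f)

/-- The projection of the collage to the target of the functor. -/
def proj (L : X ⥤ Y) : Collage L ⥤ Y := descFunctor L (𝟭 Y) (𝟙 L)

lemma proj_map_cross_id (x : X) : (proj L).map (cross (𝟙 (L.obj x))) = 𝟙 (L.obj x) :=
  Category.comp_id _

open SSet

lemma anodyneExtensions_nerveMap_inr (L : X ⥤ Y) : anodyneExtensions (nerveMap (inrFunctor L)) :=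
  anodyneExtensions_nerveMap_of_unit _ inrFunctor_obj_injective (proj L)
    (descNatTrans
      { app := fun x => cross (𝟙 (L.obj x))
        naturality := fun x x' f => by
          refine (inl_comp_cross f _).trans ((congrArg cross ?_).trans
            (cross_comp_inr _ (L.map f)).symm)
          exact (Category.comp_id _).trans (Category.id_comp _).symm }
      (𝟙 (inrFunctor L)) fun x => by
        change cross (𝟙 (L.obj x)) ≫ 𝟙 _ = cross (𝟙 (L.obj x)) ≫ (inrFunctor L).map (𝟙 _ ≫ 𝟙 _)
        simp)
    (𝟙 (𝟭 Y)) fun _ => rfl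

lemma anodyneExtensions_nerveMap_inl (L : X ⥤ Y) (R : Y ⥤ X) (ε : R ⋙ L ⟶ 𝟭 Y)
    (ε' : L ⋙ R ⟶ 𝟭 X) (hε : ∀ x, L.map (ε'.app x) = ε.app (L.obj x)) :
    anodyneExtensions (nerveMap (inlFunctor L)) :=
  anodyneExtensions_nerveMap_of_counit _ inlFunctor_obj_injective (descFunctor (L ⋙ R) R (𝟙 _))
    (descNatTrans
      { app := fun x => (inlFunctor L).map (ε'.app x)
        naturality := fun _ _ f => ε'.naturality f }
      { app := fun y => cross (ε.app y)
        naturality := fun y y' f => by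
          refine (inl_comp_cross (R.map f) _).trans ((congrArg cross ?_).trans
            (cross_comp_inr _ f).symm)
          exact ε.naturality f }
      fun x => by
        change (inlFunctor L).map (𝟙 _ ≫ R.map (𝟙 _)) ≫ cross (ε.app (L.obj x)) =
          (inlFunctor L).map (ε'.app x) ≫ cross (𝟙 _)
        rw [inl_comp_cross, inl_comp_cross, hε]
        simp)
    ε' fun _ => rfl

/-- The functor between collages that is given by a square that commutes strictly. -/
def mapFunctor (S : X ⥤ X') (T : Y ⥤ Y') (h : S ⋙ L' = L ⋙ T) : Collage L ⥤ Collage L' :=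
  descFunctor (S ⋙ inlFunctor L') (T ⋙ inrFunctor L')
    { app := fun x => cross (eqToHom (Functor.congr_obj h x))
      naturality := fun x x' f => by
        refine (inl_comp_cross (L := L') _ _).trans ((congrArg cross ?_).trans
          (cross_comp_inr _ _).symm)
        change L'.map (S.map f) ≫ eqToHom _ = eqToHom _ ≫ T.map (L.map f)
        rw [← Functor.comp_map, Functor.congr_hom h f]
        simp }

lemma mapFunctor_map_cross_eqToHom (S : X ⥤ X') (T : Y ⥤ Y') (h : S ⋙ L' = L ⋙ T) {x : X} {y : Y}
    (e : L.obj x = y) :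
    (mapFunctor S T h).map (cross (eqToHom e)) =
      cross (L := L') (eqToHom ((Functor.congr_obj h x).trans (congrArg T.obj e))) := by
  subst e
  change cross (eqToHom (Functor.congr_obj h x) ≫ T.map (𝟙 _)) = _
  rw [T.map_id]
  exact congrArg cross (Category.comp_id _)

lemma cross_eqToHom_heq {x x' : X} {y y' : Y} (hx : x = x') (e : L.obj x = y)
    (e' : L.obj x' = y') : cross (eqToHom e) ≍ cross (eqToHom e') := by
  subst hx e e'
  rfl

section Functoriality

variable {I : Type*} [Category I] {F G : I ⥤ Cat.{u, u}} (L : F ⟶ G)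

lemma naturality_toFunctor {a b : I} (f : a ⟶ b) :
    (F.map f).toFunctor ⋙ (L.app b).toFunctor = (L.app a).toFunctor ⋙ (G.map f).toFunctor :=
  congrArg Cat.Hom.toFunctor (L.naturality f)

/-- The levelwise collage of a natural transformation between functors to the category of
categories. -/
def collageFunctor : I ⥤ Cat.{u, u} where
  obj a := Cat.of (Collage (L.app a).toFunctor)
  map f := (mapFunctor (F.map f).toFunctor (G.map f).toFunctor
    (naturality_toFunctor L f)).toCatHom
  map_id a := by
    refine congrArg Functor.toCatHom (functor_ext ?_ ?_ fun x => ?_)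
    · exact congrArg (fun T : F.obj a ⟶ F.obj a => T.toFunctor ⋙ inlFunctor _) (F.map_id a)
    · exact congrArg (fun T : G.obj a ⟶ G.obj a => T.toFunctor ⋙ inrFunctor _) (G.map_id a)
    · refine (heq_of_eq
        (mapFunctor_map_cross_eqToHom _ _ (naturality_toFunctor L (𝟙 a)) rfl)).trans ?_
      exact cross_eqToHom_heq
        (congrArg (fun T : F.obj a ⟶ F.obj a => T.toFunctor.obj x) (F.map_id a)) _ rfl
  map_comp {a b c} f g := by
    refine congrArg Functor.toCatHom (functor_ext ?_ ?_ fun x => ?_)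
    · exact congrArg (fun T : F.obj a ⟶ F.obj c => T.toFunctor ⋙ inlFunctor _) (F.map_comp f g)
    · exact congrArg (fun T : G.obj a ⟶ G.obj c => T.toFunctor ⋙ inrFunctor _) (G.map_comp f g)
    · have map_f := mapFunctor_map_cross_eqToHom _ _ (naturality_toFunctor L f)
        (rfl : (L.app a).toFunctor.obj x = _)
      have map_g := mapFunctor_map_cross_eqToHom _ _ (naturality_toFunctor L g)
        (Functor.congr_obj (naturality_toFunctor L f) x)
      have map_f_g := (congrArg (mapFunctor _ _ (naturality_toFunctor L g)).map map_f).trans map_g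
      refine (heq_of_eq
        (mapFunctor_map_cross_eqToHom _ _ (naturality_toFunctor L (f ≫ g)) rfl)).trans
        (HEq.trans ?_ (heq_of_eq map_f_g.symm))
      exact cross_eqToHom_heq
        (congrArg (fun T : F.obj a ⟶ F.obj c => T.toFunctor.obj x) (F.map_comp f g)) _ _

/-- The levelwise inclusion of the source in the collage. -/
def inlTrans : F ⟶ collageFunctor L where
  app a := (inlFunctor (L.app a).toFunctor).toCatHom
  naturality _ _ _ := rfl

/-- The levelwise inclusion of the target in the collage. -/
def inrTrans : G ⟶ collageFunctor L where
  app a := (inrFunctor (L.app a).toFunctor).toCatHom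
  naturality _ _ _ := rfl

/-- The levelwise projection of the collage to the target. -/
def projTrans : collageFunctor L ⟶ G where
  app a := (proj (L.app a).toFunctor).toCatHom
  naturality a b f := by
    refine congrArg Functor.toCatHom (functor_ext (naturality_toFunctor L f) rfl fun x => ?_)
    have map_cross := (congrArg (proj (L.app b).toFunctor).map (mapFunctor_map_cross_eqToHom _ _
      (naturality_toFunctor L f) (rfl : (L.app a).toFunctor.obj x = _))).trans
      (Category.id_comp _)
    have map_id := (congrArg (G.map f).toFunctor.map
      (proj_map_cross_id (L := (L.app a).toFunctor) x)).trans ((G.map f).toFunctor.map_id _)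
    have obj_eq := Functor.congr_obj (naturality_toFunctor L f) x
    exact (heq_of_eq map_cross).trans
      ((eqToHom_heq_eqToHom obj_eq obj_eq rfl).trans (heq_of_eq map_id.symm))

lemma inlTrans_projTrans : inlTrans L ≫ projTrans L = L := rfl

lemma inrTrans_projTrans : inrTrans L ≫ projTrans L = 𝟙 G := rfl

end Functoriality

end Collage

end Collages

namespace SymmetricSpectrum

open SSet

lemma WeakEquiv.comp {X Y Z : SSet.{u}} {f : X ⟶ Y} {g : Y ⟶ Z} (hf : WeakEquiv f)
    (hg : WeakEquiv g) : WeakEquiv (f ≫ g) := by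
  obtain ⟨e, he⟩ := hf
  obtain ⟨e', he'⟩ := hg
  refine ⟨e.trans e', ?_⟩
  rw [toTop.map_comp, TopCat.hom_comp, ← he, ← he']
  rfl

lemma WeakEquiv.of_comp_eq_id {X Y : SSet.{u}} {i : X ⟶ Y} {p : Y ⟶ X} (hi : WeakEquiv i)
    (hip : i ≫ p = 𝟙 X) : WeakEquiv p := by
  obtain ⟨e, he⟩ := hi
  have p_comp_e : (toTop.map p).hom.comp e.toFun = ContinuousMap.id _ := by
    rw [he, ← TopCat.hom_comp, ← toTop.map_comp, hip, toTop.map_id]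
    rfl
  have e_comp_p : (e.toFun.comp (toTop.map p).hom).Homotopic (ContinuousMap.id _) := by
    have cancel : (e.toFun.comp (toTop.map p).hom).comp (e.toFun.comp e.invFun) =
        e.toFun.comp e.invFun := by
      rw [ContinuousMap.comp_assoc, ← ContinuousMap.comp_assoc _ e.toFun, p_comp_e,
        ContinuousMap.id_comp]
    have homotopic := (ContinuousMap.Homotopic.refl (e.toFun.comp (toTop.map p).hom)).comp
      e.right_inv
    rw [cancel, ContinuousMap.comp_id] at homotopic
    exact homotopic.symm.trans e.right_inv
  exact ⟨⟨(toTop.map p).hom, e.toFun, e_comp_p, by rw [p_comp_e]⟩, rfl⟩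

lemma weakEquiv_diagonal_of_anodyneExtensions {X M : SimplicialObject SSet.{u}} (j : X ⟶ M)
    [∀ n, Mono (j.app n)] (hj : ∀ n, anodyneExtensions (j.app n)) : WeakEquiv (diagonal.map j) :=
  weakEquiv_of_anodyneExtensions (anodyneExtensions_diagonal_map j hj)

open Collage in
/-- The diagonals are compared through the levelwise collage: both of its ends are included by
anodyne extensions. -/
theorem weakEquiv_diagonal_nerve {F G : SimplexCategoryᵒᵖ ⥤ Cat.{u, u}} (L : F ⟶ G)
    (R : ∀ n, G.obj n ⥤ F.obj n) (ε : ∀ n, R n ⋙ (L.app n).toFunctor ⟶ 𝟭 (G.obj n))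
    (ε' : ∀ n, (L.app n).toFunctor ⋙ R n ⟶ 𝟭 (F.obj n))
    (hε : ∀ n x,
      (L.app n).toFunctor.map ((ε' n).app x) = (ε n).app ((L.app n).toFunctor.obj x)) :
    WeakEquiv (diagonal.map (Functor.whiskerRight L nerveFunctor)) := by
  have mono_inl : ∀ n, Mono ((Functor.whiskerRight (inlTrans L) nerveFunctor).app n) := fun n =>
    mono_nerveMap (inlFunctor (L.app n).toFunctor) inlFunctor_obj_injective
  have mono_inr : ∀ n, Mono ((Functor.whiskerRight (inrTrans L) nerveFunctor).app n) := fun n =>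
    mono_nerveMap (inrFunctor (L.app n).toFunctor) inrFunctor_obj_injective
  have inl : WeakEquiv (diagonal.map (Functor.whiskerRight (inlTrans L) nerveFunctor)) :=
    weakEquiv_diagonal_of_anodyneExtensions _ fun n =>
      anodyneExtensions_nerveMap_inl _ (R n) (ε n) (ε' n) (hε n)
  have inr : WeakEquiv (diagonal.map (Functor.whiskerRight (inrTrans L) nerveFunctor)) :=
    weakEquiv_diagonal_of_anodyneExtensions _ fun n => anodyneExtensions_nerveMap_inr _
  have proj : WeakEquiv (diagonal.map (Functor.whiskerRight (projTrans L) nerveFunctor)) :=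
    inr.of_comp_eq_id (by
      rw [← diagonal.map_comp, ← Functor.whiskerRight_comp, inrTrans_projTrans]
      exact diagonal.map_id _)
  have inl_proj := inl.comp proj
  rwa [← diagonal.map_comp, ← Functor.whiskerRight_comp, inlTrans_projTrans] at inl_proj

end SymmetricSpectrum

section TensorProductsOfSystems

variable {C : Type u} [Category.{v} C] [MonoidalCategory C]

lemma eqToHom_tensorHom_eqToHom {X Y X' Y' : C} (h : X = Y) (h' : X' = Y') :
    eqToHom h ⊗ₘ eqToHom h' = eqToHom (congrArg₂ tensorObj h h') := by
  subst h h'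
  simp

lemma tensorHom_comp_naturality {P Q P' Q' X Y Z X' Y' Z' : C} {a : P ⟶ P'} {b : Q ⟶ Q'}
    {f : P ⟶ X} {f' : P' ⟶ X'} {g : Q ⟶ Y} {g' : Q' ⟶ Y'} {x : X ⟶ X'} {y : Y ⟶ Y'} {z : Z ⟶ Z'}
    {r : X ⊗ Y ⟶ Z} {r' : X' ⊗ Y' ⟶ Z'} (hf : a ≫ f' = f ≫ x) (hg : b ≫ g' = g ≫ y)
    (hr : r ≫ z = (x ⊗ₘ y) ≫ r') :
    (a ⊗ₘ b) ≫ (f' ⊗ₘ g') ≫ r' = ((f ⊗ₘ g) ≫ r) ≫ z := by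
  rw [Category.assoc, hr, ← Category.assoc, ← Category.assoc, tensorHom_comp_tensorHom,
    tensorHom_comp_tensorHom, hf, hg]

variable [SymmetricCategory C]

lemma braiding_tensorμ (X₁ X₂ Y₁ Y₂ : C) :
    (β_ (X₁ ⊗ X₂) (Y₁ ⊗ Y₂)).hom ≫ tensorμ Y₁ Y₂ X₁ X₂ =
      tensorμ X₁ X₂ Y₁ Y₂ ≫ ((β_ X₁ Y₁).hom ⊗ₘ (β_ X₂ Y₂).hom) := by
  simp [tensorμ, SymmetricCategory.braiding_swap_eq_inv_braiding Y₁ X₂,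
    MonoidalCategory.tensorHom_def, SymmetricCategory.braiding_swap_eq_inv_braiding Y₂ X₁]

instance isIso_tensorμ (X₁ X₂ Y₁ Y₂ : C) : IsIso (tensorμ X₁ X₂ Y₁ Y₂) :=
  ⟨tensorδ X₁ X₂ Y₁ Y₂, tensorμ_tensorδ _ _ _ _, tensorδ_tensorμ _ _ _ _⟩

lemma tensorμ_comp_tensorHom {P Q R P' Q' R' X Y Z X' Y' Z' : C} {r : Q ⊗ R ⟶ P}
    {r' : Q' ⊗ R' ⟶ P'} {s : Y ⊗ Z ⟶ X} {s' : Y' ⊗ Z' ⟶ X'}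
    {f : P ⟶ X} {g : Q ⟶ Y} {h : R ⟶ Z} {f' : P' ⟶ X'} {g' : Q' ⟶ Y'} {h' : R' ⟶ Z'}
    (e : r ≫ f = (g ⊗ₘ h) ≫ s) (e' : r' ≫ f' = (g' ⊗ₘ h') ≫ s') :
    (tensorμ Q Q' R R' ≫ (r ⊗ₘ r')) ≫ (f ⊗ₘ f') =
      ((g ⊗ₘ g') ⊗ₘ (h ⊗ₘ h')) ≫ tensorμ Y Y' Z Z' ≫ (s ⊗ₘ s') := by
  rw [Category.assoc, tensorHom_comp_tensorHom, e, e', tensorμ_natural_assoc,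
    tensorHom_comp_tensorHom]

namespace System

variable {J : Shape} {W : MorphismProperty C}

lemma app_eqToHom {X Y : System C J W} (h : X = Y) (S : J.Idx) :
    Hom.app (eqToHom h) S = eqToHom (congrArg (fun Z : System C J W => Z.obj S) h) := by
  subst h
  rfl

/-- By the interchange law, two families of maps that commute with sums in direction `i` still do
so after they are added in direction `j`. -/
lemma tensorμ_comp_ρ (X : System C J W) {i j : J.Dir} {S T U S' T' U' S'' T'' U'' : J.Idx}
    (h : J.Split i S T U) (h' : J.Split i S' T' U') (h'' : J.Split i S'' T'' U'')
    (hS : J.Split j S S' S'') (hT : J.Split j T T' T'') (hU : J.Split j U U' U'')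
    {P Q R P' Q' R' : C} {r : Q ⊗ R ⟶ P} {r' : Q' ⊗ R' ⟶ P'}
    {fP : P ⟶ X.obj S'} {fQ : Q ⟶ X.obj T'} {fR : R ⟶ X.obj U'}
    {gP : P' ⟶ X.obj S''} {gQ : Q' ⟶ X.obj T''} {gR : R' ⟶ X.obj U''}
    (hf : r ≫ fP = (fQ ⊗ₘ fR) ≫ X.ρ h') (hg : r' ≫ gP = (gQ ⊗ₘ gR) ≫ X.ρ h'') :
    (tensorμ Q Q' R R' ≫ (r ⊗ₘ r')) ≫ (fP ⊗ₘ gP) ≫ X.ρ hS =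
      ((fQ ⊗ₘ gQ) ≫ X.ρ hT ⊗ₘ (fR ⊗ₘ gR) ≫ X.ρ hU) ≫ X.ρ h := by
  rw [← Category.assoc, tensorμ_comp_tensorHom hf hg, ← tensorHom_comp_tensorHom, Category.assoc,
    Category.assoc, Category.assoc, X.interchange hT hU h h' h'' hS]

lemma tensorHom_comp_ρ_heq (X : System C J W) {i : J.Dir} {S T U S' T' U' : J.Idx}
    (h : J.Split i S T U) (h' : J.Split i S' T' U') (hS : S = S') (hT : T = T') (hU : U = U')
    {P Q : C} {f : P ⟶ X.obj T} {f' : P ⟶ X.obj T'} {g : Q ⟶ X.obj U} {g' : Q ⟶ X.obj U'}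
    (hf : f ≍ f') (hg : g ≍ g') : (f ⊗ₘ g) ≫ X.ρ h ≍ (f' ⊗ₘ g') ≫ X.ρ h' := by
  subst hS hT hU
  rw [eq_of_heq hf, eq_of_heq hg]

lemma tensorHom_comp_ρ_of_isEmpty (X : System C J W) {i : J.Dir} {S T U : J.Idx} {P Q : C}
    (h : J.Split i S T U) (hT : J.IsEmpty T) {f : P ⟶ X.obj T} {g : Q ⟶ X.obj U}
    {e : P = X.obj T} {e' : Q = X.obj U} (hf : f = eqToHom e) (hg : g = eqToHom e')
    (k : P ⊗ Q = X.obj S) : (f ⊗ₘ g) ≫ X.ρ h = eqToHom k := by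
  obtain ⟨l, hl⟩ := X.ρ_empty h (Or.inl hT)
  rw [hl, hf, hg, eqToHom_tensorHom_eqToHom, eqToHom_trans]

end System

variable [PermutativeCategory C]

open PermutativeCategory

lemma tensorμ_unit_left (X Y : C) : ∃ e, tensorμ (𝟙_ C) (𝟙_ C) X Y = eqToHom e := by
  have h := interchange_unit₃ X Y (𝟙 (X ⊗ Y))
  rw [Category.comp_id, ← eqToHom_refl _ rfl, eqToHom_tensorHom_eqToHom,
    eqToHom_tensorHom_eqToHom, eqToHom_trans, eq_comm, comp_eqToHom_iff, eqToHom_trans] at h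
  exact ⟨_, h⟩

lemma tensorμ_unit_right (X Y : C) : ∃ e, tensorμ X Y (𝟙_ C) (𝟙_ C) = eqToHom e := by
  have h := interchange_unit₄ X Y (𝟙 (X ⊗ Y))
  rw [Category.comp_id, ← eqToHom_refl _ rfl, eqToHom_tensorHom_eqToHom,
    eqToHom_tensorHom_eqToHom, eqToHom_trans, eq_comm, comp_eqToHom_iff, eqToHom_trans] at h
  exact ⟨_, h⟩

namespace System

variable {J : Shape} [Subsingleton J.Dir]

/-- The objectwise tensor product of two systems of a shape with at most one direction. -/
def tensor (X Y : System C J ⊤) : System C J ⊤ where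
  obj S := X.obj S ⊗ Y.obj S
  ρ h := tensorμ _ _ _ _ ≫ (X.ρ h ⊗ₘ Y.ρ h)
  mem _ := trivial
  obj_empty h := by rw [X.obj_empty h, Y.obj_empty h, unit_tensor]
  ρ_empty {i S T U} h hTU := by
    obtain ⟨e, he⟩ := X.ρ_empty h hTU
    obtain ⟨e', he'⟩ := Y.ρ_empty h hTU
    have tensorμ_eq : ∃ k, tensorμ (X.obj T) (Y.obj T) (X.obj U) (Y.obj U) = eqToHom k := by
      rcases hTU with hT | hU
      · rw [X.obj_empty hT, Y.obj_empty hT]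
        exact tensorμ_unit_left _ _
      · rw [X.obj_empty hU, Y.obj_empty hU]
        exact tensorμ_unit_right _ _
    obtain ⟨k, hk⟩ := tensorμ_eq
    rw [he, he', hk, eqToHom_tensorHom_eqToHom, eqToHom_trans]
    exact ⟨_, rfl⟩
  ρ_symm h := by
    rw [← Category.assoc, braiding_tensorμ, Category.assoc, tensorHom_comp_tensorHom,
      X.ρ_symm h, Y.ρ_symm h]
  ρ_assoc h₁ h₂ h₃ h₄ := by
    simp only [comp_whiskerRight, MonoidalCategory.whiskerLeft_comp, Category.assoc]
    rw [tensorμ_natural_left_assoc, tensorμ_natural_right_assoc, tensorHom_comp_tensorHom,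
      tensorHom_comp_tensorHom, X.ρ_assoc h₁ h₂ h₃ h₄, Y.ρ_assoc h₁ h₂ h₃ h₄,
      ← tensor_associativity_assoc, tensorHom_comp_tensorHom]
  ρ_interchange hij := (hij (Subsingleton.elim _ _)).elim

instance isIso_tensor_ρ (X Y : System C J ⊤) {i : J.Dir} {S T U : J.Idx} (h : J.Split i S T U)
    [IsIso (X.ρ h)] [IsIso (Y.ρ h)] : IsIso ((X.tensor Y).ρ h) :=
  inferInstanceAs (IsIso (tensorμ _ _ _ _ ≫ (X.ρ h ⊗ₘ Y.ρ h)))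

/-- The objectwise tensor product of two functors to systems of a shape with at most one
direction. -/
def tensorFunctor {D : Type*} [Category* D] (F G : D ⥤ System C J ⊤) : D ⥤ System C J ⊤ where
  obj d := (F.obj d).tensor (G.obj d)
  map f :=
    { app := fun S => Hom.app (F.map f) S ⊗ₘ Hom.app (G.map f) S
      app_empty := fun h => (congrArg₂ (· ⊗ₘ ·) (Hom.app_empty _ h) (Hom.app_empty _ h)).trans
        (eqToHom_tensorHom_eqToHom _ _)
      comm := fun h => tensorμ_comp_tensorHom (Hom.comm (F.map f) h) (Hom.comm (G.map f) h) }
  map_id d := Hom.ext (funext fun S => by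
    rw [F.map_id, G.map_id]
    exact id_tensorHom_id _ _)
  map_comp f g := Hom.ext (funext fun S => by
    rw [F.map_comp, G.map_comp]
    exact (tensorHom_comp_tensorHom _ _ _ _).symm)

end System

end TensorProductsOfSystems

section Restriction

variable {A : Pointed.{0}} {ι : Type} {As : ι → Pointed.{0}}

/-- The endomorphism `S ↦ S ∩ D` of the shape of Segal's construction. -/
def segRestrict (D : FreeSet A) : Shape.Hom (segShape A) (segShape A) where
  idx S := ⟨S.1 ∩ D.1, fun h => S.2 h.1⟩
  dir := id
  empty {S} h := by
    change S.1 = ∅ at h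
    change S.1 ∩ D.1 = ∅
    rw [h, Set.empty_inter]
  split {_ S T U} h := by
    refine ⟨?_, ?_⟩
    · change T.1 ∩ D.1 ∪ U.1 ∩ D.1 = S.1 ∩ D.1
      rw [← Set.union_inter_distrib_right, h.1]
    · change T.1 ∩ D.1 ∩ (U.1 ∩ D.1) = ∅
      rw [← Set.inter_inter_distrib_right, h.2, Set.empty_inter]

lemma segRestrict_split {D D' D'' : FreeSet A} (h : IsDisjUnion D.1 D'.1 D''.1) (S : FreeSet A) :
    IsDisjUnion ((segRestrict D).idx S).1 ((segRestrict D').idx S).1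
      ((segRestrict D'').idx S).1 := by
  refine ⟨?_, ?_⟩
  · change S.1 ∩ D'.1 ∪ S.1 ∩ D''.1 = S.1 ∩ D.1
    rw [← Set.inter_union_distrib_left, h.1]
  · change S.1 ∩ D'.1 ∩ (S.1 ∩ D''.1) = ∅
    rw [← Set.inter_inter_distrib_left, h.2, Set.inter_empty]

lemma segRestrict_idx_of_nonempty {D : FreeSet A} (hD : D.1.Subsingleton) {S : FreeSet A}
    (h : ((segRestrict D).idx S).1.Nonempty) : (segRestrict D).idx S = D := by
  obtain ⟨x, hxS, hxD⟩ := h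
  refine Subtype.ext (Set.inter_eq_right.2 fun y hy => ?_)
  rwa [hD hy hxD]

/-- The endomorphism `(S i) ↦ (S i ∩ B i)` of the shape of the multivariable construction. -/
def multiRestrict (B : ∀ i, FreeSet (As i)) : Shape.Hom (multiShape As) (multiShape As) where
  idx S i := (segRestrict (B i)).idx (S i)
  dir := id
  empty := fun ⟨i, h⟩ => ⟨i, (segRestrict (B i)).empty h⟩
  split {i _ _ _} h := ⟨fun j hj => ⟨congrArg _ (h.1 j hj).1, congrArg _ (h.1 j hj).2⟩,
    (segRestrict (B i)).split (i := ()) h.2⟩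

lemma multiRestrict_split {i : ι} {B B' B'' : ∀ i, FreeSet (As i)}
    (h : (multiShape As).Split i B B' B'') (S : ∀ i, FreeSet (As i)) :
    (multiShape As).Split i ((multiRestrict B).idx S) ((multiRestrict B').idx S)
      ((multiRestrict B'').idx S) :=
  ⟨fun j hj => ⟨congrArg (fun D => (segRestrict D).idx (S j)) (h.1 j hj).1,
    congrArg (fun D => (segRestrict D).idx (S j)) (h.1 j hj).2⟩, segRestrict_split h.2 (S i)⟩

lemma prodShapeMap_multiRestrict (B S : ∀ i, FreeSet (As i)) :
    (prodShapeMap As).idx ((multiRestrict B).idx S) =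
      (segRestrict ((prodShapeMap As).idx B)).idx ((prodShapeMap As).idx S) := by
  refine smash.freeSet_ext fun a _ => ?_
  change _ ↔ _ ∧ _
  rw [mk_mem_prodShapeMap, mk_mem_prodShapeMap, mk_mem_prodShapeMap]
  exact forall_and

lemma prodShapeMap_nonempty_iff {S : ∀ i, FreeSet (As i)} :
    ((prodShapeMap As).idx S).1.Nonempty ↔ ∀ i, (S i).1.Nonempty := by
  refine ⟨fun ⟨_, a, _, ha⟩ i => ⟨a.1 i, ha i⟩, fun h => ?_⟩
  choose a ha using h
  exact ⟨smash.mk a, (mk_mem_prodShapeMap S a).2 ha⟩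

lemma prodShapeMap_subsingleton {S : ∀ i, FreeSet (As i)} (h : ∀ i, (S i).1.Subsingleton) :
    ((prodShapeMap As).idx S).1.Subsingleton := by
  rintro _ ⟨a, rfl, ha⟩ _ ⟨b, rfl, hb⟩
  exact congrArg some (Subtype.ext (funext fun i => h i (ha i) (hb i)))

/-- The largest subset that does not contain the basepoint. -/
def FreeSet.total (A : Pointed.{0}) : FreeSet A := ⟨{x | x ≠ A.point}, fun h => h rfl⟩

lemma segRestrict_total (S : FreeSet A) : (segRestrict (FreeSet.total A)).idx S = S :=
  Subtype.ext (Set.inter_eq_left.2 fun _ hx hpoint => S.2 (Set.mem_of_eq_of_mem hpoint.symm hx))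

lemma prodShapeMap_total :
    (prodShapeMap As).idx (fun i => FreeSet.total (As i)) = FreeSet.total (smash As) := by
  refine smash.freeSet_ext fun a ha => ?_
  rw [mk_mem_prodShapeMap, smash.mk_of_ne a ha]
  exact ⟨fun _ => Option.some_ne_none _, fun _ => ha⟩

lemma multiShape_split_update [DecidableEq ι] {B : ∀ i, FreeSet (As i)} {i : ι}
    {D D' : FreeSet (As i)} (h : IsDisjUnion (B i).1 D.1 D'.1) :
    (multiShape As).Split i B (Function.update B i D) (Function.update B i D') := by
  refine ⟨fun j hj => ?_, ?_⟩
  · rw [Function.update_of_ne hj, Function.update_of_ne hj]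
    exact ⟨rfl, rfl⟩
  · rw [Function.update_self, Function.update_self]
    exact h

lemma FreeSet.exists_isDisjUnion_ssubset {S : FreeSet A} (h : ¬ S.1.Subsingleton) :
    ∃ D D' : FreeSet A, IsDisjUnion S.1 D.1 D'.1 ∧ D.1 ⊂ S.1 ∧ D'.1 ⊂ S.1 := by
  obtain ⟨b, hb, c, hc, hbc⟩ := Set.not_subsingleton_iff.1 h
  exact ⟨⟨{b}, fun hpoint => S.2 (Set.mem_of_eq_of_mem hpoint hb)⟩,
    ⟨S.1 \ {b}, fun hpoint => S.2 hpoint.1⟩,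
    ⟨Set.union_sdiff_cancel (Set.singleton_subset_iff.2 hb), Set.inter_sdiff_self _ _⟩,
    ⟨Set.singleton_subset_iff.2 hb, fun hS => hbc (hS hc).symm⟩,
    ⟨Set.sdiff_subset, fun hS => (hS hb).2 rfl⟩⟩

lemma sum_ncard_update_lt [DecidableEq ι] [Fintype ι] [∀ i, Finite (As i)]
    {B : ∀ i, FreeSet (As i)} {i : ι} {D : FreeSet (As i)} (h : D.1 ⊂ (B i).1) :
    ∑ j, (Function.update B i D j).1.ncard < ∑ j, (B j).1.ncard := by
  refine Finset.sum_lt_sum (fun j _ => ?_) ⟨i, Finset.mem_univ i, ?_⟩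
  · by_cases hj : j = i
    · subst hj
      rw [Function.update_self]
      exact Set.ncard_le_ncard h.1 (Set.toFinite _)
    · rw [Function.update_of_ne hj]
  · rw [Function.update_self]
    exact Set.ncard_lt_ncard h (Set.toFinite _)

namespace Shape.PMap

variable {K : Shape}

open Classical in
/-- The partial map of shapes with value `k` on the sets that contain the element of `P`, if there
is one, and undefined elsewhere. -/
noncomputable def skyscraper (P : FreeSet A) (hP : P.1.Subsingleton) (k : K.Idx) :
    PMap (segShape A) K where
  idx T := if ((segRestrict P).idx T).1.Nonempty then some k else none
  dir _ := none
  empty {T} h := by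
    have restrict_empty : ((segRestrict P).idx T).1 = ∅ := (segRestrict P).empty h
    simp [restrict_empty]
  split {_ S T U} h := by
    obtain ⟨union_eq, inter_eq⟩ := (segRestrict P).split (i := ()) h
    have nonempty_iff : ((segRestrict P).idx S).1.Nonempty ↔
        ((segRestrict P).idx T).1.Nonempty ∨ ((segRestrict P).idx U).1.Nonempty := by
      rw [← union_eq, Set.union_nonempty]
    have not_both : ¬ (((segRestrict P).idx T).1.Nonempty ∧
        ((segRestrict P).idx U).1.Nonempty) := by
      rintro ⟨⟨x, hxT, hxP⟩, y, hyU, hyP⟩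
      obtain rfl := hP hxP hyP
      exact Set.eq_empty_iff_forall_notMem.1 inter_eq x ⟨⟨hxT, hxP⟩, hyU, hyP⟩
    change (_ ∧ _) ∨ (_ ∧ _)
    by_cases hT : ((segRestrict P).idx T).1.Nonempty <;>
      by_cases hU : ((segRestrict P).idx U).1.Nonempty <;> simp_all

lemma skyscraper_idx_of_nonempty {P : FreeSet A} (hP : P.1.Subsingleton) (k : K.Idx)
    {T : FreeSet A} (h : ((segRestrict P).idx T).1.Nonempty) :
    (skyscraper P hP k).idx T = some k := if_pos h

lemma skyscraper_idx_of_not_nonempty {P : FreeSet A} (hP : P.1.Subsingleton) (k : K.Idx)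
    {T : FreeSet A} (h : ¬ ((segRestrict P).idx T).1.Nonempty) :
    (skyscraper P hP k).idx T = none := if_neg h

end Shape.PMap

end Restriction

section ComparisonCounit

lemma Shape.plus_isEmpty_none (K : Shape) : K.plus.IsEmpty none :=
  fun _ hk => nomatch hk

variable {C : Type u} [Category.{v} C] [MonoidalCategory C] [SymmetricCategory C]

namespace System

/-- The inclusion of the systems with all maps `ρ` in `W` into all systems. -/
def forget (J : Shape) (W : MorphismProperty C) : System C J W ⥤ System C J ⊤ where
  obj X :=
    { obj := X.obj
      ρ := X.ρ
      mem := fun _ => trivial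
      obj_empty := X.obj_empty
      ρ_empty := X.ρ_empty
      ρ_symm := X.ρ_symm
      ρ_assoc := X.ρ_assoc
      ρ_interchange := X.ρ_interchange }
  map {X Y} f := Hom.mk (fun S => Hom.app (X := X) (Y := Y) f S) (Hom.app_empty f) (Hom.comm f)

/-- The factorization through `System.forget` of a functor whose values have all maps `ρ` in
`W`. -/
def lift {D : Type*} [Category* D] {J : Shape} {W : MorphismProperty C} (F : D ⥤ System C J ⊤)
    (hF : ∀ d {i S T U} (h : J.Split i S T U), W ((F.obj d).ρ h)) : D ⥤ System C J W where
  obj d :=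
    { obj := (F.obj d).obj
      ρ := (F.obj d).ρ
      mem := hF d
      obj_empty := (F.obj d).obj_empty
      ρ_empty := (F.obj d).ρ_empty
      ρ_symm := (F.obj d).ρ_symm
      ρ_assoc := (F.obj d).ρ_assoc
      ρ_interchange := (F.obj d).ρ_interchange }
  map {d e} f := Hom.mk (fun S => Hom.app (X := F.obj d) (Y := F.obj e) (F.map f) S)
    (Hom.app_empty (F.map f)) (Hom.comm (F.map f))
  map_id d := Hom.ext (funext fun S => (congrArg (fun g => Hom.app g S) (F.map_id d) :))
  map_comp f g := Hom.ext (funext fun S => (congrArg (fun g => Hom.app g S) (F.map_comp f g) :))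

section Pull

variable [PermutativeCategory C] {J K : Shape} {W W' : MorphismProperty C} [W.ContainsIdentities]

lemma pull_ofTotal_eq_id {φ : Shape.Hom J J} (hidx : ∀ S, φ.idx S = S) (hdir : ∀ i, φ.dir i = i) :
    pull (C := C) (Shape.PMap.ofTotal φ) (le_refl W) = 𝟭 _ := by
  obtain rfl : φ = ⟨id, id, id, id⟩ := Shape.Hom.ext (funext hidx) (funext hdir)
  exact pull_ofTotal_id

lemma pull_congr_of_dir_eq_none {φ ψ : Shape.PMap J K} (h : W ≤ W') (hdir : ∀ i, φ.dir i = none)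
    (hidx : ∀ S, φ.idx S = ψ.idx S ∨ K.plus.IsEmpty (φ.idx S) ∧ K.plus.IsEmpty (ψ.idx S)) :
    pull (C := C) φ h = pull ψ h :=
  pull_congr h hidx fun i => Or.inr fun S T U split => by
    have split_φ := φ.split split
    rw [hdir i] at split_φ
    rcases split_φ with ⟨-, hU⟩ | ⟨hT, -⟩
    · exact Or.inr (hU ▸ K.plus_isEmpty_none)
    · exact Or.inl (hT ▸ K.plus_isEmpty_none)

lemma isIso_pull_skyscraper_ρ {A : Pointed.{0}} {P : FreeSet A} (hP : P.1.Subsingleton)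
    (k : K.Idx) (h : W ≤ W') (X : System C K W) {i S T U} (hS : (segShape A).Split i S T U) :
    IsIso (((pull (Shape.PMap.skyscraper P hP k) h).obj X).ρ hS) :=
  inferInstanceAs (IsIso (eqToHom (X.objPlus_eq ((Shape.PMap.skyscraper P hP k).split hS))))

end Pull

end System

variable [PermutativeCategory C] {ι : Type} {A : ι → Pointed.{0}}

variable (C A) in
/-- The comparison functor on the systems whose maps `ρ` need not be isomorphisms. -/
abbrev laxCompare : System C (segShape (smash A)) ⊤ ⥤ System C (multiShape A) ⊤ :=
  System.pull (Shape.PMap.ofTotal (prodShapeMap A)) le_rfl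

lemma pull_skyscraper_comp_laxCompare {B : ∀ i, FreeSet (A i)} (hB : ∀ i, (B i).1.Subsingleton) :
    System.pull (C := C) (W := ⊤) (W' := ⊤)
        (Shape.PMap.skyscraper _ (prodShapeMap_subsingleton hB) B) le_rfl ⋙ laxCompare C A =
      System.pull (Shape.PMap.ofTotal (multiRestrict B)) le_rfl := by
  refine (System.pull_comp _ _ _ _).trans
    (System.pull_congr_of_dir_eq_none _ (fun _ => rfl) fun S => ?_)
  let skyscraper : Shape.PMap _ (multiShape A) :=
    Shape.PMap.skyscraper _ (prodShapeMap_subsingleton hB) B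
  change skyscraper.idx ((prodShapeMap A).idx S) = some _ ∨
    (multiShape A).plus.IsEmpty (skyscraper.idx ((prodShapeMap A).idx S)) ∧ _
  have nonempty_iff : ((segRestrict ((prodShapeMap A).idx B)).idx
      ((prodShapeMap A).idx S)).1.Nonempty ↔ ∀ i, ((multiRestrict B).idx S i).1.Nonempty := by
    rw [← prodShapeMap_multiRestrict, prodShapeMap_nonempty_iff]
  by_cases hS : ∀ i, ((multiRestrict B).idx S i).1.Nonempty
  · left
    rw [Shape.PMap.skyscraper_idx_of_nonempty _ _ (nonempty_iff.2 hS)]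
    exact congrArg some (funext fun i => (segRestrict_idx_of_nonempty (hB i) (hS i)).symm)
  · right
    rw [Shape.PMap.skyscraper_idx_of_not_nonempty _ _ (mt nonempty_iff.1 hS)]
    push Not at hS
    refine ⟨Shape.plus_isEmpty_none _, ?_⟩
    rintro _ ⟨⟩
    exact hS

lemma laxCompare_comp_pull_skyscraper (B : ∀ i, FreeSet (A i))
    (hB : ((prodShapeMap A).idx B).1.Subsingleton) :
    laxCompare C A ⋙ System.pull (W' := ⊤) (Shape.PMap.skyscraper _ hB B) le_rfl =
      System.pull (Shape.PMap.ofTotal (segRestrict ((prodShapeMap A).idx B))) le_rfl := by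
  refine (System.pull_comp _ _ _ _).trans
    (System.pull_congr_of_dir_eq_none _ (fun _ => rfl) fun S => ?_)
  let skyscraper : Shape.PMap _ (multiShape A) := Shape.PMap.skyscraper _ hB B
  change Option.bind (skyscraper.idx S) _ = some _ ∨
    (segShape (smash A)).plus.IsEmpty (Option.bind (skyscraper.idx S) _) ∧ _
  by_cases hS : ((segRestrict ((prodShapeMap A).idx B)).idx S).1.Nonempty
  · left
    rw [Shape.PMap.skyscraper_idx_of_nonempty _ _ hS]
    exact congrArg some (segRestrict_idx_of_nonempty hB hS).symm
  · right
    rw [Shape.PMap.skyscraper_idx_of_not_nonempty _ _ hS]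
    refine ⟨Shape.plus_isEmpty_none _, ?_⟩
    rintro _ ⟨⟩
    exact Set.not_nonempty_iff_eq_empty.1 hS

/-- A functor `R` from multivariable systems to systems on the subsets of the smash product whose
composites with the comparison functor map compatibly to the functors that restrict systems to the
subsets of the `B i`. If every `B i` is as large as possible, then the restrictions are identity
functors. -/
structure RestrictedCounit (C : Type u) [Category.{v} C] [MonoidalCategory C]
    [SymmetricCategory C] [PermutativeCategory C] (B : ∀ i, FreeSet (A i)) where
  R : System C (multiShape A) ⊤ ⥤ System C (segShape (smash A)) ⊤
  isIso_ρ : ∀ X {i S T U} (h : (segShape (smash A)).Split i S T U), IsIso ((R.obj X).ρ h)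
  ε : R ⋙ laxCompare C A ⟶ System.pull (Shape.PMap.ofTotal (multiRestrict B)) le_rfl
  ε' : laxCompare C A ⋙ R ⟶
    System.pull (Shape.PMap.ofTotal (segRestrict ((prodShapeMap A).idx B))) le_rfl
  app_heq : ∀ X S, System.Hom.app (ε.app ((laxCompare C A).obj X)) S ≍
    System.Hom.app (ε'.app X) ((prodShapeMap A).idx S)

namespace RestrictedCounit

section Add

variable {i : ι} {B B₁ B₂ : ∀ i, FreeSet (A i)} (h : (multiShape A).Split i B B₁ B₂)
  (F : RestrictedCounit C B₁) (G : RestrictedCounit C B₂)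

/-- The transformation `RestrictedCounit.ε` of a sum. -/
def addε : System.tensorFunctor F.R G.R ⋙ laxCompare C A ⟶
    System.pull (Shape.PMap.ofTotal (multiRestrict B)) le_rfl where
  app X := System.Hom.mk
    (fun S => (System.Hom.app (F.ε.app X) S ⊗ₘ System.Hom.app (G.ε.app X) S) ≫
      X.ρ (multiRestrict_split h S))
    (fun k => X.tensorHom_comp_ρ_of_isEmpty _ ((multiRestrict B₁).empty k)
      (System.Hom.app_empty (F.ε.app X) k) (System.Hom.app_empty (G.ε.app X) k) _)
    (fun {_ S T U} k => X.tensorμ_comp_ρ ((multiRestrict B).split k)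
      ((multiRestrict B₁).split k) ((multiRestrict B₂).split k) (multiRestrict_split h S)
      (multiRestrict_split h T) (multiRestrict_split h U)
      (System.Hom.comm (F.ε.app X) k) (System.Hom.comm (G.ε.app X) k))
  naturality _ _ f := System.Hom.ext (funext fun S =>
    tensorHom_comp_naturality (congrArg (fun g => System.Hom.app g S) (F.ε.naturality f))
      (congrArg (fun g => System.Hom.app g S) (G.ε.naturality f))
      (System.Hom.comm f (multiRestrict_split h S)))

/-- The transformation `RestrictedCounit.ε'` of a sum. -/
def addε' : laxCompare C A ⋙ System.tensorFunctor F.R G.R ⟶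
    System.pull (Shape.PMap.ofTotal (segRestrict ((prodShapeMap A).idx B))) le_rfl where
  app X := System.Hom.mk
    (fun S => (System.Hom.app (F.ε'.app X) S ⊗ₘ System.Hom.app (G.ε'.app X) S) ≫
      X.ρ (i := ()) (segRestrict_split ((prodShapeMap A).split h) S))
    (fun k => X.tensorHom_comp_ρ_of_isEmpty _ ((segRestrict ((prodShapeMap A).idx B₁)).empty k)
      (System.Hom.app_empty (F.ε'.app X) k) (System.Hom.app_empty (G.ε'.app X) k) _)
    (fun {_ S T U} k => X.tensorμ_comp_ρ ((segRestrict ((prodShapeMap A).idx B)).split k)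
      ((segRestrict ((prodShapeMap A).idx B₁)).split k)
      ((segRestrict ((prodShapeMap A).idx B₂)).split k)
      (segRestrict_split ((prodShapeMap A).split h) S)
      (segRestrict_split ((prodShapeMap A).split h) T)
      (segRestrict_split ((prodShapeMap A).split h) U)
      (System.Hom.comm (F.ε'.app X) k) (System.Hom.comm (G.ε'.app X) k))
  naturality _ _ f := System.Hom.ext (funext fun S =>
    tensorHom_comp_naturality (congrArg (fun g => System.Hom.app g S) (F.ε'.naturality f))
      (congrArg (fun g => System.Hom.app g S) (G.ε'.naturality f))
      (System.Hom.comm f (segRestrict_split ((prodShapeMap A).split h) S)))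

/-- The sum of restricted counits on the two parts of a splitting. -/
def add : RestrictedCounit C B where
  R := System.tensorFunctor F.R G.R
  isIso_ρ X _ _ _ _ k := by
    have := F.isIso_ρ X k
    have := G.isIso_ρ X k
    exact System.isIso_tensor_ρ _ _ k
  ε := addε h F G
  ε' := addε' h F G
  app_heq X S := X.tensorHom_comp_ρ_heq _ _ (prodShapeMap_multiRestrict B S)
    (prodShapeMap_multiRestrict B₁ S) (prodShapeMap_multiRestrict B₂ S) (F.app_heq X S)
    (G.app_heq X S)

end Add

/-- The restricted counit for subsets with at most one element. -/
noncomputable def point {B : ∀ i, FreeSet (A i)} (hB : ∀ i, (B i).1.Subsingleton) :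
    RestrictedCounit C B where
  R := System.pull (Shape.PMap.skyscraper _ (prodShapeMap_subsingleton hB) B) le_rfl
  isIso_ρ X _ _ _ _ h := System.isIso_pull_skyscraper_ρ _ _ _ X h
  ε := eqToHom (pull_skyscraper_comp_laxCompare hB)
  ε' := eqToHom (laxCompare_comp_pull_skyscraper B _)
  app_heq X S := by
    rw [eqToHom_app, eqToHom_app, System.app_eqToHom, System.app_eqToHom]
    exact eqToHom_heq_eqToHom rfl _ _

theorem nonempty [Finite ι] [∀ i, Finite (A i)] (B : ∀ i, FreeSet (A i)) :
    Nonempty (RestrictedCounit C B) := by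
  classical
  have := Fintype.ofFinite ι
  induction hn : ∑ i, (B i).1.ncard using Nat.strong_induction_on generalizing B with
  | _ n ih =>
    by_cases hB : ∀ i, (B i).1.Subsingleton
    · exact ⟨point hB⟩
    · push Not at hB
      obtain ⟨i, hi⟩ := hB
      obtain ⟨D, D', split, hD, hD'⟩ := FreeSet.exists_isDisjUnion_ssubset
        (Set.not_subsingleton_iff.2 hi)
      obtain ⟨F⟩ := ih _ (hn ▸ sum_ncard_update_lt hD) _ rfl
      obtain ⟨G⟩ := ih _ (hn ▸ sum_ncard_update_lt hD') _ rfl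
      exact ⟨add (multiShape_split_update split) F G⟩

end RestrictedCounit

theorem exists_laxCompare_counit (C : Type u) [Category.{v} C] [MonoidalCategory C]
    [SymmetricCategory C] [PermutativeCategory C] [Finite ι] (A : ι → Pointed.{0})
    [∀ i, Finite (A i)] :
    ∃ (R : System C (multiShape A) ⊤ ⥤ System C (segShape (smash A)) ⊤)
      (ε : R ⋙ laxCompare C A ⟶ 𝟭 _) (ε' : laxCompare C A ⋙ R ⟶ 𝟭 _),
      (∀ X {i S T U} (h : (segShape (smash A)).Split i S T U), IsIso ((R.obj X).ρ h)) ∧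
        ∀ X, (laxCompare C A).map (ε'.app X) = ε.app ((laxCompare C A).obj X) := by
  obtain ⟨F⟩ := RestrictedCounit.nonempty (C := C) fun i => FreeSet.total (A i)
  have restrict_multi : System.pull (C := C) (W := ⊤)
      (Shape.PMap.ofTotal (multiRestrict fun i => FreeSet.total (A i))) le_rfl = 𝟭 _ :=
    System.pull_ofTotal_eq_id (fun S => funext fun i => segRestrict_total (S i)) fun _ => rfl
  have restrict_seg : System.pull (C := C) (W := ⊤) (Shape.PMap.ofTotal
      (segRestrict ((prodShapeMap A).idx fun i => FreeSet.total (A i)))) le_rfl = 𝟭 _ :=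
    System.pull_ofTotal_eq_id
      (fun S => by rw [prodShapeMap_total]; exact segRestrict_total S) fun _ => rfl
  refine ⟨F.R, F.ε ≫ eqToHom restrict_multi, F.ε' ≫ eqToHom restrict_seg, F.isIso_ρ,
    fun X => System.Hom.ext (funext fun S => ?_)⟩
  change System.Hom.app ((F.ε' ≫ eqToHom restrict_seg).app X) ((prodShapeMap A).idx S) = _
  rw [NatTrans.comp_app, NatTrans.comp_app, System.comp_app, System.comp_app, eqToHom_app,
    eqToHom_app, System.app_eqToHom, System.app_eqToHom]
  exact eq_of_heq ((comp_eqToHom_heq _ _).trans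
    ((F.app_heq X S).symm.trans (comp_eqToHom_heq _ _).symm))

theorem exists_compareFunctor_counit (C : Type u) [SmallCategory C] [MonoidalCategory C]
    [SymmetricCategory C] [PermutativeCategory C] [Finite ι] (A : ι → Pointed.{0})
    [∀ i, Finite (A i)] :
    ∃ (R : (multiCat C ι).obj A ⥤ (segalCat C).obj (smash A))
      (ε : R ⋙ (compareFunctor C A).toFunctor ⟶ 𝟭 _)
      (ε' : (compareFunctor C A).toFunctor ⋙ R ⟶ 𝟭 _),
      ∀ X, (compareFunctor C A).toFunctor.map (ε'.app X) =
        ε.app ((compareFunctor C A).toFunctor.obj X) := by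
  obtain ⟨R, ε, ε', isIso_ρ, hε⟩ := exists_laxCompare_counit C A
  let I := System.forget (segShape (smash A)) (MorphismProperty.isomorphisms C)
  refine ⟨System.lift R isIso_ρ,
    { app := fun X => System.Hom.mk (fun S => System.Hom.app (ε.app X) S)
        (System.Hom.app_empty (ε.app X)) (System.Hom.comm (ε.app X))
      naturality := fun X Y f => System.Hom.ext (funext fun S =>
        congrArg (fun g => System.Hom.app g S) (ε.naturality f)) },
    { app := fun X => System.Hom.mk (fun S => System.Hom.app (ε'.app (I.obj X)) S)
        (System.Hom.app_empty (ε'.app (I.obj X))) (System.Hom.comm (ε'.app (I.obj X)))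
      naturality := fun X Y f => System.Hom.ext (funext fun S =>
        (congrArg (fun g => System.Hom.app g S) (ε'.naturality (I.map f)) :)) },
    fun X => System.Hom.ext (funext fun S =>
      (congrArg (fun g => System.Hom.app g S) (hε (I.obj X)) :))⟩

end ComparisonCounit

theorem mainTheorem5 (C : Type u) [SmallCategory C] [MonoidalCategory C] [SymmetricCategory C]
    [PermutativeCategory C] : SymmetricSpectrum.IsLevelEquiv (segalToNew C) := by
  intro p
  have finite_circle (n) : Finite (circle.obj n) := inferInstanceAs (Finite (Fin _))
  choose R ε ε' hε using fun n : SimplexCategoryᵒᵖ =>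
    exists_compareFunctor_counit C (fun _ : Fin p => circle.obj n)
  exact SymmetricSpectrum.weakEquiv_diagonal_nerve
    (F := circle ⋙ (segalSequence C).F p) (G := circle ⋙ (multiSequence C).F p)
    (Functor.whiskerLeft circle ((compareHom C).app p)) R ε ε' hε
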